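/- Let $k$ be a field of characteristic $0$, $K\supseteq k$ a field, and $f:X\to \mathrm{Spec}\,K$ a smooth projective (integral) curve with function field $K(X)$. Differential forms $\Omega^p_X,\Omega^p_K$ are taken over $k$, and $\omega=\omega_{X/K}$. Let $\mathcal D=\sum_x m_x x$ be an effective divisor supported on $K$-rational points, $D=\mathcal D_{red}$, $\mathcal I=\mathcal O_X(-\mathcal D)$, and let $$AD^2(X/K)=\mathbb H^2\big(X,\ \mathcal K_2\xrightarrow{d\log}\Omega^2_X/(\mathcal O_X\otimes\Omega^2_K)\big),\qquad \mathcal K_2 \text{ in degree } 0,$$ computed with the total Čech differential $(a,b)\mapsto(\delta a,\ d\log a-\delta b)$. At a point of multiplicity $m\ge 1$ with local parameter $z$, $\Omega^1_X\{\mathcal D\}$ consists of the forms $h\,dz/z^m+\eta/z^{m-1}$ with $h\in\mathcal O_{X}$, $\eta\in\mathcal O_X\otimes\Omega^1_K$; off $D$ it is $\Omega^1_X$. Let $E$ be a vector bundle of rank $r$ on $X$ with an absolute meromorphic connection $\nabla$, regular off $D$, written $\nabla=d+A$ in local bases ($\nabla e_j=\sum_i e_i\otimes A_{ij}$). Assume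 that $\nabla$ is vertical, i.e. its curvature $dA+A\wedge A$ has entries in $K(X)\otimes\Omega^2_K$, and pseudo-admissible: at each point with $m_x\ge 2$, $\nabla$ takes values in $E\otimes\Omega^1_X\{\mathcal D\}$ and the relative polar part $E|_{\mathcal D}\to E\otimes(\omega(\mathcal D)/\omega)$ is an isomorphism at $x$; at each point with $m_x=1$, in some local basis $A=g\,dz/z+\eta/z$ with $g\in GL_r(\mathcal O_{X,x})$ and $\eta\in M_r(\mathcal O_{X,x}\otimes\Omega^1_K)$. Let $s$ be a meromorphic section of $\omega(\mathcal D)$ generating it at the points of $\mathcal D$. For local bases of $E$ at the points of $\mathcal D$, with connection matrices $A$, define $g\in GL_r(\mathcal O_{X,x})$ by $\nabla_{/K}=d+gs$. The forms $\mathrm{Tr}(dg\,g^{-1}A)$ define a section over $X$ of $\Omega^2_X(\mathcal D)/(\Omega^2_X+\mathcal O_X(\mathcal D)\otimes\Omega^2_K)$; if $\beta_i$ are local lifts of it to $\Omega^2_X(\mathcal D)/(\mathcal O_X(\mathcal D)\otimes\Omega^2_K)$, the class of the cocycle $(0,\beta_j-\beta_i)$ is denoted $\mathrm{Tr}(dg\,g^{-1}A)\in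 AD^2(X/K)$. Let $(\omega(\mathcal D),s)\in \mathrm{Pic}(X,\mathcal D)=H^1(X,(1+\mathcal I)^\times)$ be the class of $\lambda_{ij}=t_j/t_i$, where $t_i$ are local generators of $\omega(\mathcal D)$ that restrict to $s$ on $\mathcal D$, and let $(\det E,\det\nabla)\in\mathbb H^1(X,\mathcal O_X^\times\to\Omega^1_X\{\mathcal D\})$ be the class of $(g_{ij},\alpha_i)$, where, for local bases $e_i$ of $E$ with $e_j=e_i\varphi_{ij}$ and connection matrices $A_i$, $g_{ij}=\det\varphi_{ij}$ and $\alpha_i=\mathrm{Tr}\,A_i$. Let $\{(\omega(\mathcal D),s),(\det E,\det\nabla)\}\in AD^2(X/K)$ be their product, the class of $\big(\{\lambda_{ij},g_{jl}\},\,-d\log\lambda_{ij}\wedge\alpha_j\big)$. Then these classes are well defined, and: (1) for fixed $s$, the class $\mathrm{Tr}(dg\,g^{-1}A)\in AD^2(X/K)$ does not depend on the choice of the local bases of $E$ around $\mathcal D$; (2) the class $-\{(\omega(\mathcal D),s),(\det E,\det\nabla)\}+\mathrm{Tr}(dg\,g^{-1}A)\in AD^2(X/K)$ depends neither on the choice of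 the local bases nor on the choice of $s$. -/

import Mathlib

open AlgebraicGeometry CategoryTheory TensorProduct KaehlerDifferential

universe u v

noncomputable section

namespace RelAD

/-! ### Milnor's `K₂` of a commutative ring -/

/-- The Steinberg relations `u ⊗ v`, `u + v = 1`. -/
def steinberg (R : Type u) [CommRing R] : AddSubgroup (Additive Rˣ ⊗[ℤ] Additive Rˣ) :=
  AddSubgroup.closure
    {t | ∃ p q : Rˣ, (p : R) + q = 1 ∧ t = Additive.ofMul p ⊗ₜ[ℤ] Additive.ofMul q}

/-- `K₂` of a commutative ring by symbols: `Rˣ ⊗ Rˣ` modulo the Steinberg relations.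
For a local ring with infinite residue field this is the usual `K₂`. -/
def K2 (R : Type u) [CommRing R] : Type u :=
  (Additive Rˣ ⊗[ℤ] Additive Rˣ) ⧸ steinberg R

instance (R : Type u) [CommRing R] : AddCommGroup (K2 R) :=
  inferInstanceAs (AddCommGroup ((Additive Rˣ ⊗[ℤ] Additive Rˣ) ⧸ steinberg R))

/-- The symbol `{p, q}`. -/
def K2.symbol {R : Type u} [CommRing R] (p q : Rˣ) : K2 R :=
  QuotientAddGroup.mk' (steinberg R) (Additive.ofMul p ⊗ₜ[ℤ] Additive.ofMul q)

/-- A bimultiplicative map that kills the Steinberg relations factors through `K₂`. -/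
def K2.lift {R : Type u} [CommRing R] {M : Type v} [AddCommGroup M]
    (b : Additive Rˣ →+ Additive Rˣ →+ M)
    (hb : ∀ p q : Rˣ, (p : R) + q = 1 → b (Additive.ofMul p) (Additive.ofMul q) = 0) :
    K2 R →+ M :=
  QuotientAddGroup.lift (steinberg R)
    (TensorProduct.liftAddHom b (fun n x y => by simp)) (by
      refine (AddSubgroup.closure_le _).2 ?_
      rintro _ ⟨p, q, h, rfl⟩
      simpa using hb p q h)

theorem K2.lift_symbol {R : Type u} [CommRing R] {M : Type v} [AddCommGroup M]
    (b : Additive Rˣ →+ Additive Rˣ →+ M)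
    (hb : ∀ p q : Rˣ, (p : R) + q = 1 → b (Additive.ofMul p) (Additive.ofMul q) = 0)
    (p q : Rˣ) : K2.lift b hb (K2.symbol p q) = b (Additive.ofMul p) (Additive.ofMul q) := rfl

theorem K2.symbol_mul_left {R : Type u} [CommRing R] (p p' q : Rˣ) :
    K2.symbol (p * p') q = K2.symbol p q + K2.symbol p' q := by
  change QuotientAddGroup.mk' (steinberg R) _ = QuotientAddGroup.mk' (steinberg R) _ +
    QuotientAddGroup.mk' (steinberg R) _
  rw [ofMul_mul, TensorProduct.add_tmul, map_add]

theorem K2.symbol_mul_right {R : Type u} [CommRing R] (p q q' : Rˣ) :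
    K2.symbol p (q * q') = K2.symbol p q + K2.symbol p q' := by
  change QuotientAddGroup.mk' (steinberg R) _ = QuotientAddGroup.mk' (steinberg R) _ +
    QuotientAddGroup.mk' (steinberg R) _
  rw [ofMul_mul, TensorProduct.tmul_add, map_add]

theorem K2.hom_ext {R : Type u} [CommRing R] {M : Type v} [AddCommGroup M] {φ ψ : K2 R →+ M}
    (h : ∀ p q : Rˣ, φ (K2.symbol p q) = ψ (K2.symbol p q)) : φ = ψ := by
  refine QuotientAddGroup.addMonoidHom_ext _ (AddMonoidHom.ext fun t => ?_)
  induction t using TensorProduct.induction_on with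
  | zero => rw [map_zero, map_zero]
  | tmul p q => exact h p.toMul q.toMul
  | add a b ha hb => rw [map_add, map_add, ha, hb]

/-- The symbol as a bimultiplicative map. -/
def K2.symbolHom (R : Type u) [CommRing R] : Additive Rˣ →+ Additive Rˣ →+ K2 R :=
  AddMonoidHom.mk' (fun p => AddMonoidHom.mk' (fun q => K2.symbol p.toMul q.toMul)
    (fun _ _ => K2.symbol_mul_right _ _ _))
    (fun _ _ => AddMonoidHom.ext fun _ => K2.symbol_mul_left _ _ _)

/-- Functoriality of `K₂`. -/
def K2.map {R : Type u} {S : Type v} [CommRing R] [CommRing S] (φ : R →+* S) : K2 R →+ K2 S :=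
  K2.lift (((K2.symbolHom S).comp (Units.map φ.toMonoidHom).toAdditive).compl₂
      (Units.map φ.toMonoidHom).toAdditive) (by
    intro p q h
    refine (QuotientAddGroup.eq_zero_iff _).2 (AddSubgroup.subset_closure ⟨_, _, ?_, rfl⟩)
    have := congrArg φ h
    simpa using this)

theorem K2.map_symbol {R : Type u} {S : Type v} [CommRing R] [CommRing S] (φ : R →+* S)
    (p q : Rˣ) : K2.map φ (K2.symbol p q) =
      K2.symbol (Units.map φ.toMonoidHom p) (Units.map φ.toMonoidHom q) := rfl

theorem K2.map_map {R S T : Type u} [CommRing R] [CommRing S] [CommRing T] (φ : R →+* S)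
    (ψ : S →+* T) (t : K2 R) : K2.map ψ (K2.map φ t) = K2.map (ψ.comp φ) t :=
  DFunLike.congr_fun (K2.hom_ext (φ := (K2.map ψ).comp (K2.map φ)) (ψ := K2.map (ψ.comp φ))
    fun _ _ => rfl) t

theorem K2.map_inclusion {R : Type u} [CommRing R] {A B C : Subring R} (h : A ≤ B) (h' : B ≤ C)
    (t : K2 A) : K2.map (Subring.inclusion h') (K2.map (Subring.inclusion h) t) =
      K2.map (Subring.inclusion (h.trans h')) t :=
  K2.map_map _ _ t

/-! ### Two-forms of a field extension, exterior derivative, `d log` -/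

section Forms

variable (k : Type u) (F : Type u) [Field k] [Field F] [Algebra k F]

/-- `Ω²_F`, the second exterior power of `Ω¹_{F/k}`. -/
abbrev Om2 : Type u := ⋀[F]^2 (Ω[F⁄k])

/-- The wedge product of two one-forms. -/
def wedge : Ω[F⁄k] →ₗ[F] Ω[F⁄k] →ₗ[F] Om2 k F :=
  LinearMap.mk₂ F (fun a b => exteriorPower.ιMulti F 2 ![a, b])
    (fun a a' b => Subtype.ext (by simp [ExteriorAlgebra.ιMulti_apply, add_mul]))
    (fun c a b => Subtype.ext (by simp [ExteriorAlgebra.ιMulti_apply]))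
    (fun a b b' => Subtype.ext (by simp [ExteriorAlgebra.ιMulti_apply, mul_add]))
    (fun c a b => Subtype.ext (by simp [ExteriorAlgebra.ιMulti_apply]))

theorem wedge_self (a : Ω[F⁄k]) : wedge k F a a = 0 :=
  Subtype.ext (by simp [wedge, ExteriorAlgebra.ιMulti_apply])

theorem wedge_comm (a b : Ω[F⁄k]) : wedge k F a b = - wedge k F b a := by
  have h := wedge_self k F (a + b)
  simp only [map_add, LinearMap.add_apply, wedge_self, zero_add, add_zero] at h
  exact eq_neg_of_add_eq_zero_right h

/-- `Σ f · [g] ↦ Σ df ∧ dg` on formal sums. -/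
def extDerivAux : (F →₀ F) →+ Om2 k F :=
  Finsupp.liftAddHom (fun g => AddMonoidHom.mk' (fun f => wedge k F (D k F f) (D k F g))
    (fun f f' => by simp))

theorem extDerivAux_single (f g : F) :
    extDerivAux k F (Finsupp.single g f) = wedge k F (D k F f) (D k F g) := by
  simp [extDerivAux]

theorem extDerivAux_kerTotal (t : F →₀ F) (ht : t ∈ kerTotal k F) : extDerivAux k F t = 0 := by
  have key : ∀ c : F, extDerivAux k F (c • t) = 0 := by
    refine Submodule.span_induction (p := fun t _ => ∀ c : F, extDerivAux k F (c • t) = 0)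
      ?_ ?_ ?_ ?_ ht
    · rintro _ ((⟨⟨x, y⟩, rfl⟩ | ⟨⟨x, y⟩, rfl⟩) | ⟨x, rfl⟩) c
      · simp [smul_sub, smul_add, extDerivAux_single, Finsupp.smul_single]
      · simp only [smul_sub, smul_add, Finsupp.smul_single, smul_eq_mul, map_sub, map_add,
          extDerivAux_single, mul_one, Derivation.leibniz, LinearMap.add_apply, map_smul,
          LinearMap.smul_apply]
        rw [wedge_comm k F (D k F x) (D k F y)]
        module
      · simp [Finsupp.smul_single, extDerivAux_single]
    · simp
    · intro x y _ _ hx hy c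
      simp [smul_add, hx c, hy c]
    · intro a x _ hx c
      rw [smul_smul]
      exact hx _
  simpa using key 1

/-- The exterior derivative `d : Ω¹_F → Ω²_F`, `d(f dg) = df ∧ dg`. -/
def extDeriv : Ω[F⁄k] →+ Om2 k F :=
  (QuotientAddGroup.lift (kerTotal k F).toAddSubgroup (extDerivAux k F)
    (fun t ht => extDerivAux_kerTotal k F t ht)).comp
    ((quotKerTotalEquiv k F).symm.toLinearMap.toAddMonoidHom)

theorem extDeriv_smul_D (f g : F) :
    extDeriv k F (f • D k F g) = wedge k F (D k F f) (D k F g) := by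
  have h : (quotKerTotalEquiv k F).symm (f • D k F g) =
      Submodule.Quotient.mk (Finsupp.single g f) := by
    rw [LinearEquiv.symm_apply_eq]
    simp [quotKerTotalEquiv]
  refine Eq.trans ?_ (extDerivAux_single k F f g)
  change QuotientAddGroup.lift (kerTotal k F).toAddSubgroup (extDerivAux k F)
    (fun t ht => extDerivAux_kerTotal k F t ht) ((quotKerTotalEquiv k F).symm (f • D k F g)) = _
  rw [h]
  rfl

/-- `d log p = dp / p`. -/
def dlog (p : Fˣ) : Ω[F⁄k] := ((p⁻¹ : Fˣ) : F) • D k F (p : F)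

theorem dlog_mul (p q : Fˣ) : dlog k F (p * q) = dlog k F p + dlog k F q := by
  simp only [dlog, mul_inv, Units.val_mul, Derivation.leibniz, smul_add, smul_smul]
  rw [add_comm]
  congr 2
  · rw [mul_comm, mul_comm ((p⁻¹ : Fˣ) : F), ← mul_assoc]; simp
  · rw [mul_right_comm]; simp

variable (K : Type u) [Field K] [Algebra K F]

/-- The image of `F ⊗ Ω²_K` in `Ω²_F`. -/
def baseForms2 : Submodule F (Om2 k F) :=
  Submodule.span F {w | ∃ a b : K,
    w = wedge k F (D k F (algebraMap K F a)) (D k F (algebraMap K F b))}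

/-- `Ω²_F / (F ⊗ Ω²_K)`. -/
def RelForms2 : Type u := Om2 k F ⧸ baseForms2 k F K

instance : AddCommGroup (RelForms2 k F K) :=
  inferInstanceAs (AddCommGroup (Om2 k F ⧸ baseForms2 k F K))

instance : Module F (RelForms2 k F K) :=
  inferInstanceAs (Module F (Om2 k F ⧸ baseForms2 k F K))

/-- The projection `Ω²_F → Ω²_F / (F ⊗ Ω²_K)`. -/
def toRel : Om2 k F →ₗ[F] RelForms2 k F K := (baseForms2 k F K).mkQ

/-- The wedge product with values in `Ω²_F / (F ⊗ Ω²_K)`. -/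
def wedgeRel : Ω[F⁄k] →ₗ[F] Ω[F⁄k] →ₗ[F] RelForms2 k F K :=
  (wedge k F).compr₂ (toRel k F K)

/-- `d log : K₂(F) → Ω²_F / (F ⊗ Ω²_K)`, `{p, q} ↦ dp/p ∧ dq/q`. -/
def dlogK2 : K2 F →+ RelForms2 k F K :=
  K2.lift
    (AddMonoidHom.mk' (fun p => AddMonoidHom.mk'
        (fun q => wedgeRel k F K (dlog k F p.toMul) (dlog k F q.toMul))
        (fun q q' => by simp [dlog_mul]))
      (fun p p' => by ext q; simp [dlog_mul])) (by
    intro p q h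
    have hq : (q : F) = 1 - p := by rw [← h]; ring
    have : D k F (q : F) = - D k F (p : F) := by rw [hq]; simp
    simp [dlog, this, wedgeRel, wedge_self])

theorem dlogK2_symbol (p q : Fˣ) :
    dlogK2 k F K (K2.symbol p q) = wedgeRel k F K (dlog k F p) (dlog k F q) := rfl

end Forms

/-! ### The curve: function field, local rings, divisors, differential forms -/

section Curve

variable {K : Type u} [Field K] {X : Scheme.{u}} [IsIntegral X]

/-- The function field of `X`, regarded as an extension of `K` by means of `f`. -/
def FF (_f : X ⟶ Spec (.of K)) : Type u := X.functionField

variable (f : X ⟶ Spec (.of K))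

instance : Field (FF f) := inferInstanceAs (Field X.functionField)

/-- The structure homomorphism `K → Γ(X, 𝒪) → K(X)`. -/
def constants : K →+* FF f :=
  ((Scheme.ΓSpecIso (.of K)).inv ≫ f.appTop ≫
    X.presheaf.germ ⊤ (genericPoint X) trivial).hom

instance {k : Type u} [Field k] [Algebra k K] : Algebra k (FF f) :=
  ((constants f).comp (algebraMap k K)).toAlgebra

instance {k : Type u} [Field k] [Algebra k K] : IsScalarTower k K (FF f) :=
  IsScalarTower.of_algebraMap_eq (fun _ => rfl)

/-- The local ring `𝒪_{X,x}`, as a subring of the function field. -/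
def O (x : X) : Subring (FF f) :=
  (algebraMap (X.presheaf.stalk x) X.functionField).range

instance (x : X) : IsLocalRing (O f x) :=
  IsLocalRing.of_surjective' (algebraMap (X.presheaf.stalk x) X.functionField).rangeRestrict
    (RingHom.rangeRestrict_surjective _)

/-- The functions regular on an open set, as a subring of the function field. -/
def OU (U : X.Opens) : Subring (FF f) := ⨅ x : U, O f x

theorem OU_le {U : X.Opens} {x : X} (hx : x ∈ U) : OU f U ≤ O f x :=
  iInf_le (fun x : U => O f x) ⟨x, hx⟩

/-- The residue field of `x` is `K`. -/
def IsRational (x : X) : Prop :=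
  ∀ a : O f x, ∃ c : K, ∃ b ∈ IsLocalRing.maximalIdeal (O f x),
    (a : FF f) = algebraMap K (FF f) c + b

/-- `z` is a local parameter at `x`. -/
def IsLocalParam (x : X) (z : O f x) : Prop :=
  z ≠ 0 ∧ IsLocalRing.maximalIdeal (O f x) = Ideal.span {z}

/-- The stalk `Ω¹_{X/k,x}` inside `Ω¹` of the function field. For `k = K` it is `ω_{X/K,x}`. -/
def regForms (k : Type u) [Field k] [Algebra k K] (x : X) :
    Submodule (O f x) (Ω[FF f⁄k]) :=
  Submodule.span (O f x) (Set.range fun a : O f x => D k (FF f) (a : FF f))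

/-- The stalk of `𝒪_X ⊗ Ω¹_K` at `x`. -/
def baseForms (k : Type u) [Field k] [Algebra k K] (x : X) :
    Submodule (O f x) (Ω[FF f⁄k]) :=
  Submodule.span (O f x) (Set.range fun c : K => D k (FF f) (algebraMap K (FF f) c))

/-- The stalk of `Ω²_X / (𝒪_X ⊗ Ω²_K)` at `x`. -/
def regForms2 (k : Type u) [Field k] [Algebra k K] (x : X) :
    Submodule (O f x) (RelForms2 k (FF f) K) :=
  Submodule.span (O f x) {w | ∃ a b : O f x,
    w = wedgeRel k (FF f) K (D k (FF f) (a : FF f)) (D k (FF f) (b : FF f))}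

variable (𝔇 : X →₀ ℕ)

/-- The stalk at `x` of the ideal sheaf `𝓘 = 𝒪(-𝔇)`. -/
def idealAt (x : X) : Ideal (O f x) := IsLocalRing.maximalIdeal (O f x) ^ 𝔇 x

/-- Membership in the stalk `ω_{X/K}(𝔇)_x`. -/
def InOmegaD (x : X) (w : Ω[FF f⁄K]) : Prop :=
  ∀ a ∈ idealAt f 𝔇 x, a • w ∈ regForms f K x

/-- `t` generates `ω_{X/K}(𝔇)` at `x`. -/
def GeneratesOmegaD (x : X) (t : Ω[FF f⁄K]) : Prop :=
  ∀ w : Ω[FF f⁄K], InOmegaD f 𝔇 x w ↔ ∃ a : O f x, w = a • t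

/-- Membership in the stalk `Ω¹_X{𝔇}_x`: regular forms off `𝔇`, and at a point of multiplicity
`m ≥ 1` the forms `h dz / z ^ m + η / z ^ (m - 1)`, `h ∈ 𝒪_x`, `η ∈ 𝒪_x ⊗ Ω¹_K`. -/
def InOmegaBrace (k : Type u) [Field k] [Algebra k K] (x : X) (α : Ω[FF f⁄k]) : Prop :=
  (𝔇 x = 0 ∧ α ∈ regForms f k x) ∨
  (𝔇 x ≠ 0 ∧ ∃ z : O f x, IsLocalParam f x z ∧ ∃ h : O f x, ∃ η ∈ baseForms f k x,
    α = ((h : FF f) / (z : FF f) ^ 𝔇 x) • D k (FF f) (z : FF f) +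
      ((z : FF f) ^ (𝔇 x - 1))⁻¹ • η)

/-! ### Sheaves of sections over open sets -/

/-- `Γ(U, 𝒪_X^×)`. -/
def unitsOn (U : X.Opens) : Subgroup (FF f)ˣ where
  carrier := {p | ∀ x ∈ U, (p : FF f) ∈ O f x ∧ ((p⁻¹ : (FF f)ˣ) : FF f) ∈ O f x}
  one_mem' := fun x _ => by simp [one_mem]
  mul_mem' := fun {p q} hp hq x hx => by
    rw [mul_inv, Units.val_mul, Units.val_mul]
    exact ⟨mul_mem (hp x hx).1 (hq x hx).1, mul_mem (hp x hx).2 (hq x hx).2⟩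
  inv_mem' := fun {p} hp x hx => by
    rw [inv_inv]
    exact ⟨(hp x hx).2, (hp x hx).1⟩

/-- The germ at `x` of a unit on `U ∋ x`. -/
def unitGerm {U : X.Opens} (p : unitsOn f U) {x : X} (hx : x ∈ U) : (O f x)ˣ where
  val := ⟨_, (p.2 x hx).1⟩
  inv := ⟨_, (p.2 x hx).2⟩
  val_inv := Subtype.ext (by simp)
  inv_val := Subtype.ext (by simp)

/-- `Γ(U, (1 + 𝓘)^×)`: units that are congruent to `1` modulo `𝓘`. -/
def IsOneModI {U : X.Opens} (p : unitsOn f U) : Prop :=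
  ∀ (x : X) (hx : x ∈ U), ((unitGerm f p hx : (O f x)ˣ) : O f x) - 1 ∈ idealAt f 𝔇 x

/-- `Γ(U, 𝒦₂)`, where `𝒦₂` is the sheaf associated with `V ↦ K₂(𝒪(V))`: families of germs that
locally come from some `K₂(𝒪(V))`. -/
def SheafK2 (U : X.Opens) : AddSubgroup (∀ x : U, K2 (O f x)) where
  carrier := {s | ∀ x ∈ U, ∃ V : X.Opens, x ∈ V ∧ ∃ t : K2 (OU f V),
    ∀ (y : U) (hy : (y : X) ∈ V), s y = K2.map (Subring.inclusion (OU_le f hy)) t}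
  zero_mem' := fun x hx => ⟨U, hx, 0, fun y hy => by simp⟩
  add_mem' := by
    intro s s' hs hs' x hx
    obtain ⟨V, hV, t, ht⟩ := hs x hx
    obtain ⟨V', hV', t', ht'⟩ := hs' x hx
    have h1 : OU f V ≤ OU f (V ⊓ V') := le_iInf fun y => OU_le f y.2.1
    have h2 : OU f V' ≤ OU f (V ⊓ V') := le_iInf fun y => OU_le f y.2.2
    refine ⟨V ⊓ V', ⟨hV, hV'⟩,
      K2.map (Subring.inclusion h1) t + K2.map (Subring.inclusion h2) t', fun y hy => ?_⟩
    rw [map_add, K2.map_inclusion h1 (OU_le f hy), K2.map_inclusion h2 (OU_le f hy)]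
    exact congrArg₂ (· + ·) (ht y hy.1) (ht' y hy.2)
  neg_mem' := by
    intro s hs x hx
    obtain ⟨V, hV, t, ht⟩ := hs x hx
    exact ⟨V, hV, -t, fun y hy => by rw [Pi.neg_apply, ht y hy, map_neg]⟩

/-- The germ at `x` of a section of `𝒦₂`. -/
def germK2 {U : X.Opens} {x : X} (hx : x ∈ U) : SheafK2 f U →+ K2 (O f x) :=
  (Pi.evalAddMonoidHom (fun x : U => K2 (O f x)) ⟨x, hx⟩).comp (SheafK2 f U).subtype

/-- Restriction of sections of `𝒦₂`. -/
def resK2 {U V : X.Opens} (h : V ≤ U) : SheafK2 f U →+ SheafK2 f V where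
  toFun s := ⟨fun y => germK2 f (h y.2) s, fun x hx => by
    obtain ⟨W, hW, t, ht⟩ := s.2 x (h hx)
    exact ⟨W, hW, t, fun y hy => ht ⟨y, h y.2⟩ hy⟩⟩
  map_zero' := Subtype.ext (funext fun _ => map_zero _)
  map_add' _ _ := Subtype.ext (funext fun _ => map_add _ _ _)

/-- The symbol `{p, q} ∈ Γ(U, 𝒦₂)` of two units on `U`. -/
def symbolOn {U : X.Opens} (p q : unitsOn f U) : SheafK2 f U :=
  ⟨fun x => K2.symbol (unitGerm f p x.2) (unitGerm f q x.2), fun x hx => by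
    have hmem : ∀ {a : FF f}, (∀ y ∈ U, a ∈ O f y) → a ∈ OU f U := fun h =>
      (Subring.mem_iInf).2 fun y => h y y.2
    let lft : unitsOn f U → (OU f U)ˣ := fun p =>
      { val := ⟨_, hmem fun y hy => (p.2 y hy).1⟩
        inv := ⟨_, hmem fun y hy => (p.2 y hy).2⟩
        val_inv := Subtype.ext (by simp)
        inv_val := Subtype.ext (by simp) }
    refine ⟨U, hx, K2.symbol (lft p) (lft q), fun y hy => ?_⟩
    rw [K2.map_symbol]
    exact congrArg₂ K2.symbol (Units.ext rfl) (Units.ext rfl)⟩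

variable (k : Type u) [Field k] [Algebra k K]

/-- `d log` on germs of `𝒦₂`. -/
def dlogGerm (x : X) : K2 (O f x) →+ RelForms2 k (FF f) K :=
  (dlogK2 k (FF f) K).comp (K2.map (O f x).subtype)

/-- `Γ(U, Ω²_X / (𝒪_X ⊗ Ω²_K))` for a non-empty open set `U`, as a subgroup of the generic
stalk. -/
def forms2On (U : X.Opens) : AddSubgroup (RelForms2 k (FF f) K) :=
  ⨅ x : U, (regForms2 f k (x : X)).toAddSubgroup

theorem mem_forms2On {U : X.Opens} {w : RelForms2 k (FF f) K} :
    w ∈ forms2On f k U ↔ ∀ x ∈ U, w ∈ regForms2 f k x := by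
  simp [forms2On, AddSubgroup.mem_iInf]

/-! ### Čech hypercohomology and the group `AD²(X/K)` -/

/-- Open coverings of `X` indexed by the points of `X`, with `x ∈ U x`. They are cofinal among all
open coverings, and refinement maps between them are canonical. -/
structure PtCover (X : Scheme.{u}) : Type u where
  /-- The member of the covering that belongs to the point `x`. -/
  U : X → X.Opens
  mem : ∀ x, x ∈ U x

/-- `𝒰 ≤ 𝒱` if `𝒱` refines `𝒰`. -/
instance (X : Scheme.{u}) : Preorder (PtCover X) where
  le 𝒰 𝒱 := ∀ x, 𝒱.U x ≤ 𝒰.U x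
  le_refl _ _ := le_rfl
  le_trans _ _ _ h h' x := (h' x).trans (h x)

variable (𝒰 : PtCover X)

/-- `U_i ∩ U_j`. -/
abbrev PtCover.U₂ {X : Scheme.{u}} (𝒰 : PtCover X) (i j : X) : X.Opens := 𝒰.U i ⊓ 𝒰.U j

/-- `U_i ∩ U_j ∩ U_l`. -/
abbrev PtCover.U₃ {X : Scheme.{u}} (𝒰 : PtCover X) (i j l : X) : X.Opens :=
  𝒰.U i ⊓ 𝒰.U j ⊓ 𝒰.U l

theorem PtCover.mem₂ {X : Scheme.{u}} {𝒰 : PtCover X} {i j x : X} (hi : x ∈ 𝒰.U i)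
    (hj : x ∈ 𝒰.U j) : x ∈ 𝒰.U₂ i j := ⟨hi, hj⟩

theorem PtCover.mem₃ {X : Scheme.{u}} {𝒰 : PtCover X} {i j l x : X} (hi : x ∈ 𝒰.U i)
    (hj : x ∈ 𝒰.U j) (hl : x ∈ 𝒰.U l) : x ∈ 𝒰.U₃ i j l := ⟨⟨hi, hj⟩, hl⟩

instance (X : Scheme.{u}) : DecidableEq (PtCover X) := Classical.decEq _

/-- Čech cochains of total degree `2` of the complex `𝒦₂ → Ω²_X / (𝒪_X ⊗ Ω²_K)`, with `𝒦₂` in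
degree `0`: pairs of a `2`-cochain of `𝒦₂` and a `1`-cochain of two-forms. -/
abbrev Cochain2 : Type u :=
  (∀ i j l : X, SheafK2 f (𝒰.U₃ i j l)) × (∀ i j : X, forms2On f k (𝒰.U₂ i j))

/-- The cocycles: `δ a = 0` and `d log a = δ b`. (The total differential is
`(a, b) ↦ (δ a, d log a - δ b)`.) -/
def cocycles2 : AddSubgroup (Cochain2 f k 𝒰) where
  carrier := {c |
    (∀ (i j l n x : X) (hi : x ∈ 𝒰.U i) (hj : x ∈ 𝒰.U j) (hl : x ∈ 𝒰.U l) (hn : x ∈ 𝒰.U n),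
      germK2 f (PtCover.mem₃ hj hl hn) (c.1 j l n) - germK2 f (PtCover.mem₃ hi hl hn) (c.1 i l n) +
        germK2 f (PtCover.mem₃ hi hj hn) (c.1 i j n) - germK2 f (PtCover.mem₃ hi hj hl) (c.1 i j l) = 0) ∧
    ∀ (i j l x : X) (hx : x ∈ 𝒰.U₃ i j l),
      dlogGerm f k x (germK2 f hx (c.1 i j l)) =
        (c.2 j l : RelForms2 k (FF f) K) - c.2 i l + c.2 i j}
  zero_mem' := by
    refine ⟨fun i j l n x hi hj hl hn => ?_, fun i j l x hx => ?_⟩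
    · simp only [Prod.fst_zero, Pi.zero_apply, map_zero, sub_zero, add_zero]
    · simp only [Prod.fst_zero, Prod.snd_zero, Pi.zero_apply, map_zero, ZeroMemClass.coe_zero,
        sub_zero, add_zero]
  add_mem' := by
    rintro c c' ⟨h1, h2⟩ ⟨h1', h2'⟩
    refine ⟨fun i j l n x hi hj hl hn => ?_, fun i j l x hx => ?_⟩
    · have := congrArg₂ (· + ·) (h1 i j l n x hi hj hl hn) (h1' i j l n x hi hj hl hn)
      simp only [Prod.fst_add, Pi.add_apply, map_add]
      rw [← add_zero (0 : K2 (O f x)), ← this]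
      abel
    · simp only [Prod.fst_add, Prod.snd_add, Pi.add_apply, map_add, AddSubgroup.coe_add,
        h2 i j l x hx, h2' i j l x hx]
      abel
  neg_mem' := by
    rintro c ⟨h1, h2⟩
    refine ⟨fun i j l n x hi hj hl hn => ?_, fun i j l x hx => ?_⟩
    · have := congrArg (- ·) (h1 i j l n x hi hj hl hn)
      simp only [Prod.fst_neg, Pi.neg_apply, map_neg]
      rw [← neg_zero, ← this]
      abel
    · simp only [Prod.fst_neg, Prod.snd_neg, Pi.neg_apply, map_neg, AddSubgroup.coe_neg,
        h2 i j l x hx]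
      abel

/-- The coboundaries `(δ c, d log c - δ e)` of the cochains `(c, e)` of total degree `1`. -/
def coboundaries2 : AddSubgroup (Cochain2 f k 𝒰) where
  carrier := {b | ∃ (c : ∀ i j : X, SheafK2 f (𝒰.U₂ i j)) (e : ∀ i : X, forms2On f k (𝒰.U i)),
    (∀ (i j l x : X) (hi : x ∈ 𝒰.U i) (hj : x ∈ 𝒰.U j) (hl : x ∈ 𝒰.U l),
      germK2 f (PtCover.mem₃ hi hj hl) (b.1 i j l) =
        germK2 f (PtCover.mem₂ hj hl) (c j l) - germK2 f (PtCover.mem₂ hi hl) (c i l) + germK2 f (PtCover.mem₂ hi hj) (c i j)) ∧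
    ∀ (i j x : X) (hx : x ∈ 𝒰.U₂ i j),
      (b.2 i j : RelForms2 k (FF f) K) =
        dlogGerm f k x (germK2 f hx (c i j)) - ((e j : RelForms2 k (FF f) K) - e i)}
  zero_mem' := by
    refine ⟨0, 0, fun i j l x hi hj hl => ?_, fun i j x hx => ?_⟩
    · simp only [Prod.fst_zero, Pi.zero_apply, map_zero, sub_zero, add_zero]
    · simp only [Prod.snd_zero, Pi.zero_apply, map_zero, ZeroMemClass.coe_zero, sub_zero]
  add_mem' := by
    rintro b b' ⟨c, e, h1, h2⟩ ⟨c', e', h1', h2'⟩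
    refine ⟨c + c', e + e', fun i j l x hi hj hl => ?_, fun i j x hx => ?_⟩
    · simp only [Prod.fst_add, Pi.add_apply, map_add, h1 i j l x hi hj hl, h1' i j l x hi hj hl]
      abel
    · simp only [Prod.snd_add, Pi.add_apply, map_add, AddSubgroup.coe_add, h2 i j x hx,
        h2' i j x hx]
      abel
  neg_mem' := by
    rintro b ⟨c, e, h1, h2⟩
    refine ⟨-c, -e, fun i j l x hi hj hl => ?_, fun i j x hx => ?_⟩
    · simp only [Prod.fst_neg, Pi.neg_apply, map_neg, h1 i j l x hi hj hl]
      abel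
    · simp only [Prod.snd_neg, Pi.neg_apply, map_neg, AddSubgroup.coe_neg, h2 i j x hx]
      abel

/-- `H²` of the Čech complex of a covering. -/
abbrev CechH2 : Type u :=
  cocycles2 f k 𝒰 ⧸ (coboundaries2 f k 𝒰).addSubgroupOf (cocycles2 f k 𝒰)

variable {𝒰}

/-- Restriction of cochains to a finer covering. -/
def resCochain {𝒱 : PtCover X} (h : 𝒰 ≤ 𝒱) : Cochain2 f k 𝒰 →+ Cochain2 f k 𝒱 where
  toFun c :=
    (fun i j l => resK2 f (inf_le_inf (inf_le_inf (h i) (h j)) (h l)) (c.1 i j l),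
      fun i j => ⟨c.2 i j, (mem_forms2On f k).2 fun x hx =>
        (mem_forms2On f k).1 (c.2 i j).2 x ⟨h i hx.1, h j hx.2⟩⟩)
  map_zero' := by
    refine Prod.ext ?_ ?_
    · funext i j l
      exact map_zero _
    · funext i j
      rfl
  map_add' c c' := by
    refine Prod.ext ?_ ?_
    · funext i j l
      exact map_add _ _ _
    · funext i j
      rfl

/-- Restriction of cocycles to a finer covering. -/
def resCocycle {𝒱 : PtCover X} (h : 𝒰 ≤ 𝒱) : cocycles2 f k 𝒰 →+ cocycles2 f k 𝒱 :=
  ((resCochain f k h).comp (cocycles2 f k 𝒰).subtype).codRestrict _ fun c => by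
    exact ⟨fun i j l n x hi hj hl hn => c.2.1 i j l n x (h i hi) (h j hj) (h l hl) (h n hn),
      fun i j l x hx => c.2.2 i j l x ⟨⟨h i hx.1.1, h j hx.1.2⟩, h l hx.2⟩⟩

/-- The refinement map on `H²`. -/
def resH2 {𝒱 : PtCover X} (h : 𝒰 ≤ 𝒱) : CechH2 f k 𝒰 →+ CechH2 f k 𝒱 :=
  QuotientAddGroup.map _ _ (resCocycle f k h) (by
    intro b hb
    have hb' : (b : Cochain2 f k 𝒰) ∈ coboundaries2 f k 𝒰 := hb
    obtain ⟨c, e, h1, h2⟩ := hb'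
    change ((resCocycle f k h b : cocycles2 f k 𝒱) : Cochain2 f k 𝒱) ∈ coboundaries2 f k 𝒱
    exact ⟨fun i j => resK2 f (inf_le_inf (h i) (h j)) (c i j),
      fun i => ⟨e i, (mem_forms2On f k).2 fun x hx => (mem_forms2On f k).1 (e i).2 x (h i hx)⟩,
      fun i j l x hi hj hl => h1 i j l x (h i hi) (h j hj) (h l hl),
      fun i j x hx => h2 i j x ⟨h i hx.1, h j hx.2⟩⟩)

/-- `AD²(X/K) = ℍ²(X, 𝒦₂ → Ω²_X / (𝒪_X ⊗ Ω²_K))`: the hypercohomology, as the direct limit of the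
Čech hypercohomology groups of the open coverings of the curve `X`. -/
def AD2 : Type u :=
  AddCommGroup.DirectLimit (fun 𝒰 : PtCover X => CechH2 f k 𝒰) (fun _ _ h => resH2 f k h)

instance : AddCommGroup (AD2 f k) :=
  inferInstanceAs (AddCommGroup (AddCommGroup.DirectLimit (fun 𝒰 : PtCover X => CechH2 f k 𝒰)
    (fun _ _ h => resH2 f k h)))

/-- The class of a cocycle. -/
def AD2.mk (c : cocycles2 f k 𝒰) : AD2 f k :=
  AddCommGroup.DirectLimit.of (fun 𝒰 : PtCover X => CechH2 f k 𝒰) (fun _ _ h => resH2 f k h) 𝒰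
    (QuotientAddGroup.mk' _ c)

/-! ### The boundary map on principal parts -/

/-- `c ∈ AD²(X/K)` is the boundary of the family `τ` of principal parts along `𝔇`: local lifts
`β_i` that are congruent to `τ_x` modulo `Ω²_{X,x}` at the points `x ∈ 𝔇 ∩ U_i` and regular at the
other points of `U_i` give the class `(0, β_j - β_i)`. The value of `τ` off `𝔇` is irrelevant. -/
def IsBoundary (τ : X → RelForms2 k (FF f) K) (c : AD2 f k) : Prop :=
  ∃ (𝒰 : PtCover X) (β : X → RelForms2 k (FF f) K) (z : cocycles2 f k 𝒰),
    (∀ i, ∀ x ∈ 𝒰.U i, 𝔇 x ≠ 0 → β i - τ x ∈ regForms2 f k x) ∧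
    (∀ i, ∀ x ∈ 𝒰.U i, 𝔇 x = 0 → β i ∈ regForms2 f k x) ∧
    z.1.1 = 0 ∧ (∀ i j, (z.1.2 i j : RelForms2 k (FF f) K) = β j - β i) ∧
    c = AD2.mk f k z

/-! ### The pairing `Pic(X, 𝔇) × ℍ¹(X, 𝒪_X^× → Ω¹_X{𝔇}) → AD²(X/K)` -/

/-- A Čech `1`-cocycle of `(1 + 𝓘)^×`; its class is an element of `Pic(X, 𝔇)`. -/
structure RelPicCocycle (𝒰 : PtCover X) where
  /-- The transition functions. -/
  lam : ∀ i j : X, unitsOn f (𝒰.U₂ i j)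
  one_mod : ∀ i j, IsOneModI f 𝔇 (lam i j)
  cocycle : ∀ i j l : X, (lam i l : (FF f)ˣ) = lam i j * lam j l

/-- A Čech `1`-cocycle of `𝒪_X^× → Ω¹_X{𝔇}`. -/
structure ConnCocycle (𝒰 : PtCover X) where
  /-- The transition functions. -/
  g : ∀ i j : X, unitsOn f (𝒰.U₂ i j)
  /-- The local connection forms. -/
  α : X → Ω[FF f⁄k]
  mem : ∀ i, ∀ x ∈ 𝒰.U i, InOmegaBrace f 𝔇 k x (α i)
  cocycle : ∀ i j l : X, (g i l : (FF f)ˣ) = g i j * g j l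
  dlog_g : ∀ i j : X, dlog k (FF f) (g i j) = α j - α i

/-- Restriction of units. -/
def resUnits {U V : X.Opens} (h : V ≤ U) (p : unitsOn f U) : unitsOn f V :=
  ⟨p.1, fun x hx => p.2 x (h hx)⟩

theorem constants_mem (x : X) (c : K) : algebraMap K (FF f) c ∈ O f x := by
  refine ⟨((Scheme.ΓSpecIso (.of K)).inv ≫ f.appTop ≫ X.presheaf.germ ⊤ x trivial).hom c, ?_⟩
  have h : (Scheme.ΓSpecIso (.of K)).inv ≫ f.appTop ≫ X.presheaf.germ ⊤ (genericPoint X) trivial =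
      ((Scheme.ΓSpecIso (.of K)).inv ≫ f.appTop ≫ X.presheaf.germ ⊤ x trivial) ≫
        X.presheaf.stalkSpecializes ((genericPoint_spec X).specializes trivial) := by
    simp only [Category.assoc]
    rw [X.presheaf.germ_stalkSpecializes (U := ⊤) trivial]
  exact (DFunLike.congr_fun (congrArg CommRingCat.Hom.hom h) c).symm

theorem wedge_regForms {x : X} {a b : Ω[FF f⁄k]} (ha : a ∈ regForms f k x)
    (hb : b ∈ regForms f k x) : wedgeRel k (FF f) K a b ∈ regForms2 f k x := by
  induction ha using Submodule.span_induction with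
  | mem a ha =>
    obtain ⟨a, rfl⟩ := ha
    induction hb using Submodule.span_induction with
    | mem b hb =>
      obtain ⟨b, rfl⟩ := hb
      exact Submodule.subset_span ⟨a, b, rfl⟩
    | zero => rw [map_zero]; exact zero_mem _
    | add b b' _ _ h h' => rw [map_add]; exact add_mem h h'
    | smul c b _ h =>
      have : wedgeRel k (FF f) K (D k (FF f) (a : FF f)) (c • b) =
          c • wedgeRel k (FF f) K (D k (FF f) (a : FF f)) b := map_smul _ (c : FF f) b
      rw [this]
      exact Submodule.smul_mem _ _ h
  | zero => rw [map_zero]; exact zero_mem _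
  | add b b' _ _ h h' => rw [map_add]; exact add_mem h h'
  | smul c a _ h =>
    have : wedgeRel k (FF f) K (c • a) b = c • wedgeRel k (FF f) K a b := by
      have := map_smul (wedgeRel k (FF f) K) (c : FF f) a
      exact DFunLike.congr_fun this b
    rw [this]
    exact Submodule.smul_mem _ _ h

theorem baseForms_le (x : X) : baseForms f k x ≤ regForms f k x := by
  refine Submodule.span_le.2 ?_
  rintro _ ⟨c, rfl⟩
  exact Submodule.subset_span ⟨⟨_, constants_mem f x c⟩, rfl⟩

theorem D_mem (x : X) (a : O f x) : D k (FF f) (a : FF f) ∈ regForms f k x :=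
  Submodule.subset_span ⟨a, rfl⟩

/-- `d log (1 + 𝓘)^× ∧ Ω¹_X{𝔇} ⊆ Ω²_X`. -/
theorem dlog_wedge_mem {U : X.Opens} (p : unitsOn f U) (hp : IsOneModI f 𝔇 p) {x : X}
    (hx : x ∈ U) {α : Ω[FF f⁄k]} (hα : InOmegaBrace f 𝔇 k x α) :
    wedgeRel k (FF f) K (dlog k (FF f) p) α ∈ regForms2 f k x := by
  have hlog : dlog k (FF f) p =
      (((unitGerm f p hx)⁻¹ : (O f x)ˣ) : O f x) •
        D k (FF f) ((unitGerm f p hx : (O f x)ˣ) : FF f) := rfl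
  rcases hα with ⟨_, hα⟩ | ⟨hm, z, ⟨hz0, hz⟩, h, η, hη, rfl⟩
  · refine wedge_regForms f k ?_ hα
    rw [hlog]
    exact Submodule.smul_mem _ _ (D_mem f k x _)
  · have hz0' : (z : FF f) ≠ 0 := fun h0 => hz0 (Subtype.ext h0)
    have h1 := hp x hx
    rw [idealAt, hz, Ideal.span_singleton_pow, Ideal.mem_span_singleton] at h1
    obtain ⟨b, hb⟩ := h1
    obtain ⟨n, hn⟩ := Nat.exists_eq_succ_of_ne_zero hm
    have hp' : ((unitGerm f p hx : (O f x)ˣ) : FF f) = 1 + (z : FF f) ^ (n + 1) * b := by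
      have := congrArg (Subtype.val) hb
      rw [hn] at this
      rw [← sub_eq_iff_eq_add']
      simpa using this
    have hD : D k (FF f) ((unitGerm f p hx : (O f x)ˣ) : FF f) =
        (z : FF f) ^ n • ((n + 1 : ℕ) • (b : FF f) • D k (FF f) (z : FF f) +
          (z : FF f) • D k (FF f) (b : FF f)) := by
      rw [hp']
      simp only [map_add, Derivation.map_one_eq_zero, Derivation.leibniz, Derivation.leibniz_pow,
        zero_add, Nat.add_sub_cancel]
      rw [pow_succ]
      module
    have key : wedgeRel k (FF f) K (D k (FF f) ((unitGerm f p hx : (O f x)ˣ) : FF f))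
        (((h : FF f) / (z : FF f) ^ 𝔇 x) • D k (FF f) (z : FF f) +
          ((z : FF f) ^ (𝔇 x - 1))⁻¹ • η) =
        h • wedgeRel k (FF f) K (D k (FF f) (b : FF f)) (D k (FF f) (z : FF f)) +
          wedgeRel k (FF f) K ((((n + 1 : ℕ) : O f x) * b) • D k (FF f) (z : FF f) +
            z • D k (FF f) (b : FF f)) η := by
      have e1 : (((n + 1 : ℕ) : O f x) * b) • D k (FF f) (z : FF f) =
          (((n + 1 : ℕ) : FF f) * (b : FF f)) • D k (FF f) (z : FF f) := by
        rw [algebra_compatible_smul (FF f) (((n + 1 : ℕ) : O f x) * b), map_mul, map_natCast]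
        rfl
      have e3 : z • D k (FF f) (b : FF f) = (z : FF f) • D k (FF f) (b : FF f) :=
        algebra_compatible_smul (FF f) z _
      rw [hD, hn, e1, e3, Subring.smul_def h, Nat.succ_sub_one]
      have hs : wedgeRel k (FF f) K (D k (FF f) (z : FF f)) (D k (FF f) (z : FF f)) = 0 := by
        simp [wedgeRel, wedge_self]
      simp only [map_add, map_smul, LinearMap.add_apply, LinearMap.smul_apply, hs,
        smul_zero, zero_add, smul_add, smul_smul, ← Nat.cast_smul_eq_nsmul (FF f)]
      have hzn : (z : FF f) ^ n ≠ 0 := pow_ne_zero _ hz0'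
      congr 1
      · congr 1
        rw [Nat.succ_eq_add_one, pow_succ]
        field_simp
      · congr 2
        · field_simp
        · field_simp
    have e2 : ∀ (c : O f x) (a b : Ω[FF f⁄k]),
        wedgeRel k (FF f) K (c • a) b = c • wedgeRel k (FF f) K a b := fun c a b =>
      DFunLike.congr_fun (map_smul (wedgeRel k (FF f) K) (c : FF f) a) b
    rw [hlog, e2, key]
    refine Submodule.smul_mem _ _ (add_mem (Submodule.smul_mem _ _ ?_) ?_)
    · exact wedge_regForms f k (D_mem f k x _) (D_mem f k x _)
    · exact wedge_regForms f k (add_mem (Submodule.smul_mem _ _ (D_mem f k x _))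
        (Submodule.smul_mem _ _ (D_mem f k x _))) (baseForms_le f k x hη)

variable {f} {k} {𝔇}

theorem germ_symbolOn {U : X.Opens} (p q : unitsOn f U) {x : X} (hx : x ∈ U) :
    germK2 f hx (symbolOn f p q) = K2.symbol (unitGerm f p hx) (unitGerm f q hx) := rfl

theorem dlogGerm_symbol {U : X.Opens} (p q : unitsOn f U) {x : X} (hx : x ∈ U) :
    dlogGerm f k x (K2.symbol (unitGerm f p hx) (unitGerm f q hx)) =
      wedgeRel k (FF f) K (dlog k (FF f) p) (dlog k (FF f) q) := by
  change dlogK2 k (FF f) K (K2.map _ (K2.symbol _ _)) = _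
  rw [K2.map_symbol, dlogK2_symbol]
  exact congrArg₂ (fun a b => wedgeRel k (FF f) K (dlog k (FF f) a) (dlog k (FF f) b))
    (Units.ext rfl) (Units.ext rfl)

theorem unitGerm_mul {U V W : X.Opens} {p : unitsOn f U} {q : unitsOn f V} {r : unitsOn f W}
    (h : (p : (FF f)ˣ) = q * r) {x : X} (hU : x ∈ U) (hV : x ∈ V) (hW : x ∈ W) :
    unitGerm f p hU = unitGerm f q hV * unitGerm f r hW :=
  Units.ext (Subtype.ext (congrArg Units.val h))

/-- The product of the classes of two cocycles: `({λ_ij, g_jl}, - d log λ_ij ∧ α_j)`. -/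
def cup (L : RelPicCocycle f 𝔇 𝒰) (C : ConnCocycle f 𝔇 k 𝒰) : cocycles2 f k 𝒰 :=
  ⟨(fun i j l => symbolOn f (resUnits f inf_le_left (L.lam i j))
      (resUnits f (le_inf (inf_le_left.trans inf_le_right) inf_le_right) (C.g j l)),
    fun i j => ⟨- wedgeRel k (FF f) K (dlog k (FF f) (L.lam i j)) (C.α j),
      (mem_forms2On f k).2 fun x hx => neg_mem
        (dlog_wedge_mem f 𝔇 k (L.lam i j) (L.one_mod i j) hx (C.mem j x hx.2))⟩), by
    refine ⟨fun i j l n x hi hj hl hn => ?_, fun i j l x hx => ?_⟩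
    · change K2.symbol (unitGerm f (L.lam j l) (PtCover.mem₂ hj hl))
            (unitGerm f (C.g l n) (PtCover.mem₂ hl hn)) -
          K2.symbol (unitGerm f (L.lam i l) (PtCover.mem₂ hi hl))
            (unitGerm f (C.g l n) (PtCover.mem₂ hl hn)) +
          K2.symbol (unitGerm f (L.lam i j) (PtCover.mem₂ hi hj))
            (unitGerm f (C.g j n) (PtCover.mem₂ hj hn)) -
          K2.symbol (unitGerm f (L.lam i j) (PtCover.mem₂ hi hj))
            (unitGerm f (C.g j l) (PtCover.mem₂ hj hl)) = 0
      rw [unitGerm_mul (L.cocycle i j l) _ (PtCover.mem₂ hi hj) (PtCover.mem₂ hj hl),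
        unitGerm_mul (C.cocycle j l n) _ (PtCover.mem₂ hj hl) (PtCover.mem₂ hl hn),
        K2.symbol_mul_left, K2.symbol_mul_right]
      abel
    · rw [germ_symbolOn, dlogGerm_symbol]
      change wedgeRel k (FF f) K (dlog k (FF f) (L.lam i j)) (dlog k (FF f) (C.g j l)) =
        - wedgeRel k (FF f) K (dlog k (FF f) (L.lam j l)) (C.α l) -
          - wedgeRel k (FF f) K (dlog k (FF f) (L.lam i l)) (C.α l) +
          - wedgeRel k (FF f) K (dlog k (FF f) (L.lam i j)) (C.α j)
      rw [C.dlog_g, L.cocycle i j l, dlog_mul]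
      simp only [map_add, map_sub, LinearMap.add_apply]
      abel⟩


variable (f) (k) (𝔇)

/-! ### Vector bundles and connections -/

/-- A vector bundle of rank `r` on `X`, as a locally free subsheaf of its generic stalk `V`:
near every point there is a basis of `V` that is a basis of the stalks. -/
structure Bundle (r : ℕ) (V : Type v) [AddCommGroup V] [Module (FF f) V] where
  /-- The stalks, as lattices in the generic stalk. -/
  stalk : ∀ x : X, Submodule (O f x) V
  locally_free : ∀ x : X, ∃ U : X.Opens, x ∈ U ∧ ∃ b : Module.Basis (Fin r) (FF f) V,
    ∀ y ∈ U, stalk y = Submodule.span (O f y) (Set.range b)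

section Bundle

variable {f} {r : ℕ} {V : Type v} [AddCommGroup V] [Module (FF f) V]

/-- `e` is a basis of the bundle at `x` (and hence in a neighbourhood of `x`). -/
def Bundle.IsBasisAt (E : Bundle f r V) (x : X) (e : Module.Basis (Fin r) (FF f) V) : Prop :=
  E.stalk x = Submodule.span (O f x) (Set.range e)

variable (f) (V) in
/-- An absolute (that is, relative to `k`) meromorphic connection, given on the generic stalk. -/
structure Conn where
  /-- The map `∇`. -/
  toFun : V →+ V ⊗[FF f] Ω[FF f⁄k]
  leibniz : ∀ (a : FF f) (v : V), toFun (a • v) = a • toFun v + v ⊗ₜ D k (FF f) a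

variable {k}

/-- The connection matrix `A` in a basis `e`: `∇ e_j = ∑ e_i ⊗ A_ij`, so `∇ = d + A`. -/
def Conn.matrix (nabla : Conn f k V) (e : Module.Basis (Fin r) (FF f) V) :
    Matrix (Fin r) (Fin r) (Ω[FF f⁄k]) :=
  fun i j => TensorProduct.lid (FF f) (Ω[FF f⁄k])
    ((e.coord i).rTensor (Ω[FF f⁄k]) (nabla.toFun (e j)))

/-- The trace of the connection matrix: the connection form of `det ∇` in the basis
`e_1 ∧ ⋯ ∧ e_r`. -/
def Conn.traceForm (nabla : Conn f k V) (e : Module.Basis (Fin r) (FF f) V) : Ω[FF f⁄k] :=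
  ∑ i, nabla.matrix e i i

/-- The connection is vertical: the entries of its curvature matrix `dA + A ∧ A` come from
`Ω²_K`. -/
def Conn.IsVertical (nabla : Conn f k V) (r : ℕ) : Prop :=
  ∀ (e : Module.Basis (Fin r) (FF f) V) (i j : Fin r),
    extDeriv k (FF f) (nabla.matrix e i j) +
      ∑ l, wedge k (FF f) (nabla.matrix e i l) (nabla.matrix e l j) ∈ baseForms2 k (FF f) K

/-- `A = g dz / z ^ m + η / z ^ n` with `g` regular and `η` with entries in `𝒪_x ⊗ Ω¹_K`. -/
def HasPolarShape (x : X) (A : Matrix (Fin r) (Fin r) (Ω[FF f⁄k])) (z : O f x) (m n : ℕ)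
    (g : Matrix (Fin r) (Fin r) (O f x)) : Prop :=
  ∃ η : Matrix (Fin r) (Fin r) (Ω[FF f⁄k]), (∀ i j, η i j ∈ baseForms f k x) ∧
    ∀ i j, A i j = ((g i j : FF f) / (z : FF f) ^ m) • D k (FF f) (z : FF f) +
      ((z : FF f) ^ n)⁻¹ • η i j

/-- Pseudo-admissible connections on `E` with singularities along `𝔇`. -/
structure IsPseudoAdmissible (E : Bundle f r V) (nabla : Conn f k V) : Prop where
  /-- The connection is regular off `𝔇`. -/
  regular : ∀ x, 𝔇 x = 0 → ∃ e, E.IsBasisAt x e ∧ ∀ i j, nabla.matrix e i j ∈ regForms f k x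
  /-- Points of multiplicity `m ≥ 2` are admissible: `∇` takes values in `E ⊗ Ω¹_X{𝔇}`, and the
  relative polar part `E|_𝔇 → E ⊗ (ω(𝔇) / ω)`, whose matrix is `g` modulo `𝓘` in terms of the
  generator `dz / z ^ m` of `ω(𝔇)`, is an isomorphism. -/
  admissible : ∀ x, 2 ≤ 𝔇 x → ∃ e, E.IsBasisAt x e ∧ ∃ z : O f x, IsLocalParam f x z ∧
    ∃ g : Matrix (Fin r) (Fin r) (O f x),
      HasPolarShape x (nabla.matrix e) z (𝔇 x) (𝔇 x - 1) g ∧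
      IsUnit (g.map (Ideal.Quotient.mk (idealAt f 𝔇 x)))
  /-- Points of multiplicity `1` are pseudo-logarithmic: `A = g dz / z + η / z` with `g`
  invertible. -/
  pseudoLog : ∀ x, 𝔇 x = 1 → ∃ e, E.IsBasisAt x e ∧ ∃ z : O f x, IsLocalParam f x z ∧
    ∃ g : Matrix (Fin r) (Fin r) (O f x),
      HasPolarShape x (nabla.matrix e) z 1 1 g ∧ IsUnit g

/-! ### The local and the global class -/

/-- The two-form `Tr(dg g⁻¹ A)` modulo `Ω²_K`. -/
def trForm (g : GL (Fin r) (FF f)) (A : Matrix (Fin r) (Fin r) (Ω[FF f⁄k])) :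
    RelForms2 k (FF f) K :=
  ∑ i, ∑ j, ∑ l, ((g⁻¹ : GL (Fin r) (FF f)) j l) •
    wedgeRel k (FF f) K (D k (FF f) (g i j)) (A l i)

/-- `s` is a meromorphic section of `ω(𝔇)` that generates it at the points of `𝔇`. -/
def IsTrivializing (s : Ω[FF f⁄K]) : Prop := ∀ x, 𝔇 x ≠ 0 → GeneratesOmegaD f 𝔇 x s

/-- `e` is a family of local bases of `E` at the points of `𝔇`. -/
def IsLocalBases (E : Bundle f r V) (e : X → Module.Basis (Fin r) (FF f) V) : Prop :=
  ∀ x, 𝔇 x ≠ 0 → E.IsBasisAt x (e x)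

/-- `c` is the class of `Tr(dg g⁻¹ A)` in `AD²(X/K)`, where at `x ∈ 𝔇` the matrix `A` is the
connection matrix in the basis `e x` and `g ∈ GL_r(𝒪_x)` is determined by `∇_{/K} = d + g s`. -/
def IsLocalClass (nabla : Conn f k V) (s : Ω[FF f⁄K])
    (e : X → Module.Basis (Fin r) (FF f) V) (c : AD2 f k) : Prop :=
  ∃ g : ∀ x, GL (Fin r) (O f x),
    (∀ x, 𝔇 x ≠ 0 → ∀ i j,
      KaehlerDifferential.map k K (FF f) (FF f) (nabla.matrix (e x) i j) = (g x i j : FF f) • s) ∧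
    IsBoundary f 𝔇 k (fun x => trForm (Matrix.GeneralLinearGroup.map (O f x).subtype (g x))
      (nabla.matrix (e x))) c

/-- The cocycle `L` represents the rigidified line bundle `(ω(𝔇), s) ∈ Pic(X, 𝔇)`: there are local
generators `t_i` of `ω(𝔇)` that restrict to `s` on `𝔇`, with `t_j = λ_ij t_i`. -/
def RelPicCocycle.Represents {𝒰 : PtCover X} (L : RelPicCocycle f 𝔇 𝒰) (s : Ω[FF f⁄K]) : Prop :=
  ∃ t : X → Ω[FF f⁄K],
    (∀ i, ∀ x ∈ 𝒰.U i, GeneratesOmegaD f 𝔇 x (t i)) ∧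
    (∀ i, ∀ x ∈ 𝒰.U i, 𝔇 x ≠ 0 → t i - s ∈ regForms f K x) ∧
    ∀ i j, t j = ((L.lam i j : (FF f)ˣ) : FF f) • t i

/-- The cocycle `C` represents `(det E, det ∇)`: there are local bases `e_i` of `E` such that
`g_ij` is the determinant of the change of bases from `e_i` to `e_j` and `α_i` is the trace of the
connection matrix. -/
def ConnCocycle.Represents {𝒰 : PtCover X} (C : ConnCocycle f 𝔇 k 𝒰) (E : Bundle f r V)
    (nabla : Conn f k V) : Prop :=
  ∃ e : X → Module.Basis (Fin r) (FF f) V,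
    (∀ i, ∀ x ∈ 𝒰.U i, E.IsBasisAt x (e i)) ∧
    (∀ i j, ((C.g i j : (FF f)ˣ) : FF f) = ((e i).toMatrix (e j)).det) ∧
    ∀ i, C.α i = nabla.traceForm (e i)

/-- `c` is the class `{(ω(𝔇), s), (det E, det ∇)}`. -/
def IsGlobalClass (E : Bundle f r V) (nabla : Conn f k V) (s : Ω[FF f⁄K]) (c : AD2 f k) : Prop :=
  ∃ (𝒰 : PtCover X) (L : RelPicCocycle f 𝔇 𝒰) (C : ConnCocycle f 𝔇 k 𝒰),
    L.Represents 𝔇 s ∧ C.Represents 𝔇 E nabla ∧ c = AD2.mk f k (cup L C)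

end Bundle

end Curve

end RelAD

end

/-! The content is local at the points of `𝔇`. At such a point write `A = g dz / z ^ m + η / z ^ n`,
with `η` coming from the base and either `n = m - 1` or `m = n = 1`. Contracting the vertical
curvature with the derivation dual to `dz` kills `Ω²_K` and leaves one polar identity: `z⁻ⁿ [g, η] -
n z ^ (m - n - 1) η` is regular (`commutator_regular`). So `[g, η] / z ^ (m - 1)` is regular when `n
= m - 1`, while `([g, η] - η) / z` is regular at a pseudo-logarithmic point.

A change of basis `φ` with `dφ φ⁻¹ = θ = τ dz + ψ` replaces `g` by `φ⁻¹ (g + z ^ m τ) φ` and `A` by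
`φ⁻¹ (A + θ) φ`. Modulo regular forms, the change of `Tr(dg g⁻¹ A)` is `m z ^ (m - 1 - n) Tr(τ dz ∧
g⁻¹ η) - Tr(θ ∧ g⁻¹ z⁻ⁿ [g, η])`. For `n = m - 1` both terms are regular. For `m = n = 1` the
commutator may be replaced by `η`, the contribution of `ψ` is a base form, and the two polar terms
cancel. This is `trD_gauge_sub_mem`; it gives (1), because the boundary class depends only on
principal parts modulo regular forms (`IsBoundary.unique`).

For (2), take `dz / z ^ m` as reference generator of `ω(𝔇)`. If `s = u dz / z ^ m`, then passing to
`s` changes the principal part by `-dlog u ∧ Tr A` (`trD_smul`). This is the only dependence on `s`,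
so each point of `𝔇` carries an invariant `τ` (`exists_local_invariant`). In the product, new
generators `μ_i t_i` and new bases change the cocycle by a Čech coboundary of symbols, up to the
forms `dlog μ_i ∧ α_i` (`neg_mk_cup_add_eq`). These need not be regular on `𝔇`, but there `μ_i`
agrees with `u' / u` modulo `(1 + 𝓘)^×`, and `dlog (1 + 𝓘)^× ∧ Ω¹{𝔇}` is regular. Hence they cancel
the change of the local term (`neg_global_add_local_unique`).

Existence of the classes rests on geometry: `ω` is locally free of rank one, `dz` generates it at a
rational point, and `z` is invertible in a punctured neighbourhood. On the algebraic side, Jacobi's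
formula makes `(det φ_ij, Tr A_i)` a cocycle. -/

noncomputable section

namespace RelAD

/-! ### Sections as elements of the function field -/

section Geometry

variable {K : Type u} [Field K] {X : Scheme.{u}} [IsIntegral X] (f : X ⟶ Spec (.of K))

/-- A section over a non-empty open set, as an element of the function field. -/
def secFF {U : X.Opens} {x : X} (hx : x ∈ U) : Γ(X, U) →+* FF f :=
  (algebraMap (X.presheaf.stalk x) X.functionField).comp (X.presheaf.germ U x hx).hom

theorem secFF_eq {U : X.Opens} {x y : X} (hx : x ∈ U) (hy : y ∈ U) (b : Γ(X, U)) :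
    secFF f hx b = secFF f hy b := by
  have : Nonempty U := ⟨⟨x, hx⟩⟩
  exact (Scheme.algebraMap_germ_eq_germToFunctionField X hx b).trans
    (Scheme.algebraMap_germ_eq_germToFunctionField X hy b).symm

theorem secFF_mem {U : X.Opens} {x y : X} (hx : x ∈ U) (hy : y ∈ U) (b : Γ(X, U)) :
    secFF f hx b ∈ O f y := by
  rw [secFF_eq f hx hy]
  exact ⟨_, rfl⟩

theorem algebraMap_stalk_injective (x : X) :
    Function.Injective (algebraMap (X.presheaf.stalk x) X.functionField) :=
  IsFractionRing.injective _ _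

theorem secFF_injective {U : X.Opens} {x : X} (hx : x ∈ U) :
    Function.Injective (secFF f hx) :=
  (algebraMap_stalk_injective x).comp (germ_injective_of_isIntegral X x hx)

/-- Moves the question where a section is invertible into the function field, so that specialization
can be treated by comparing subrings. -/
theorem mem_basicOpen_iff {U : X.Opens} {x y : X} (hx : x ∈ U) (hy : y ∈ U) (b : Γ(X, U)) :
    y ∈ X.basicOpen b ↔ secFF f hx b ≠ 0 ∧ (secFF f hx b)⁻¹ ∈ O f y := by
  rw [secFF_eq f hx hy, Scheme.mem_basicOpen X b y hy]
  constructor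
  · intro h
    refine ⟨(h.map (algebraMap (X.presheaf.stalk y) X.functionField)).ne_zero, ?_⟩
    obtain ⟨w, hw⟩ := h.exists_right_inv
    refine ⟨w, ?_⟩
    have := congrArg (algebraMap (X.presheaf.stalk y) X.functionField) hw
    rw [map_mul, map_one] at this
    exact eq_inv_of_mul_eq_one_right this
  · rintro ⟨h0, w, hw⟩
    refine IsUnit.of_mul_eq_one w (algebraMap_stalk_injective y ?_)
    rw [map_mul, map_one]
    exact (congrArg (secFF f hy b * ·) hw).trans (mul_inv_cancel₀ h0)

theorem exists_section {x : X} {a : FF f} (ha : a ∈ O f x) :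
    ∃ (U : X.Opens) (hx : x ∈ U) (b : Γ(X, U)), secFF f hx b = a := by
  obtain ⟨a, rfl⟩ := ha
  obtain ⟨U, hx, b, rfl⟩ := X.presheaf.exists_germ_eq a
  exact ⟨U, hx, b, rfl⟩

/-- A function that is regular at `x` is regular in a neighbourhood of `x`. -/
theorem exists_nhd_mem {x : X} {a : FF f} (ha : a ∈ O f x) :
    ∃ U : X.Opens, x ∈ U ∧ ∀ y ∈ U, a ∈ O f y := by
  obtain ⟨U, hx, b, rfl⟩ := exists_section f ha
  exact ⟨U, hx, fun y hy => secFF_mem f hx hy b⟩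

/-- The stalk is a localization of the affine coordinate ring, so every germ is a quotient of
sections with denominator invertible at `x`. -/
theorem exists_fraction {U : X.Opens} (hU : IsAffineOpen U) {x : X} (hx : x ∈ U) {a : FF f}
    (ha : a ∈ O f x) :
    ∃ b c : Γ(X, U), x ∈ X.basicOpen c ∧ a * secFF f hx c = secFF f hx b := by
  obtain ⟨a, rfl⟩ := ha
  have := hU.isLocalization_stalk ⟨x, hx⟩
  let : Algebra Γ(X, U) (X.presheaf.stalk x) := (X.presheaf.germ U x hx).hom.toAlgebra
  obtain ⟨⟨b, c⟩, hbc⟩ := IsLocalization.surj (S := X.presheaf.stalk x)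
    (hU.primeIdealOf ⟨x, hx⟩).asIdeal.primeCompl a
  refine ⟨b, c, ?_, ?_⟩
  · rw [Scheme.mem_basicOpen X _ x hx]
    exact IsLocalization.map_units (X.presheaf.stalk x) c
  · have h := congrArg (algebraMap (X.presheaf.stalk x) X.functionField) hbc
    rw [map_mul] at h
    exact h

/-- The constants, as sections over an open set. -/
def constSec (U : X.Opens) : K →+* Γ(X, U) :=
  ((Scheme.ΓSpecIso (.of K)).inv ≫ f.appTop ≫ X.presheaf.map (homOfLE le_top).op).hom

theorem secFF_constSec {U : X.Opens} {x : X} (hx : x ∈ U) (c : K) :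
    secFF f hx (constSec f U c) = algebraMap K (FF f) c := by
  have hg : genericPoint X ∈ U :=
    ((genericPoint_spec X).mem_open_set_iff U.isOpen).mpr ⟨x, trivial, hx⟩
  have : Nonempty U := ⟨⟨x, hx⟩⟩
  refine (Scheme.algebraMap_germ_eq_germToFunctionField X hx (constSec f U c)).trans ?_
  have h : ((Scheme.ΓSpecIso (.of K)).inv ≫ f.appTop ≫ X.presheaf.map (homOfLE le_top).op) ≫
      X.presheaf.germ U (genericPoint X) hg = (Scheme.ΓSpecIso (.of K)).inv ≫ f.appTop ≫
        X.presheaf.germ ⊤ (genericPoint X) trivial := by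
    simp only [Category.assoc]
    rw [X.presheaf.germ_res]
  exact DFunLike.congr_fun (congrArg CommRingCat.Hom.hom h) c

theorem O_le_of_specializes {x y : X} (h : x ⤳ y) : O f y ≤ O f x := by
  intro a ha
  obtain ⟨U, hy, hU⟩ := exists_nhd_mem f ha
  exact hU x (h.mem_open U.isOpen hy)

/-- Units of the local ring are the elements whose inverse is regular. -/
theorem isUnit_iff_inv_mem {x : X} (a : O f x) : IsUnit a ↔ (a : FF f) ≠ 0 ∧ (a : FF f)⁻¹ ∈ O f x := by
  constructor
  · intro h
    obtain ⟨w, hw⟩ := h.exists_right_inv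
    have hw' : (a : FF f) * (w : FF f) = 1 := congrArg Subtype.val hw
    refine ⟨left_ne_zero_of_mul_eq_one hw', ?_⟩
    rw [← eq_inv_of_mul_eq_one_right hw']
    exact w.2
  · rintro ⟨h0, h⟩
    exact IsUnit.of_mul_eq_one ⟨_, h⟩ (Subtype.ext (mul_inv_cancel₀ h0))

/-- Basic open sets form a basis of the neighbourhoods of a point of an affine open set, so they
suffice to test specialization. -/
theorem specializes_of_basicOpen {X : Scheme.{u}} {U : X.Opens} (hU : IsAffineOpen U) {x y : X} (hy : y ∈ U)
    (h : ∀ b : Γ(X, U), y ∈ X.basicOpen b → x ∈ X.basicOpen b) : x ⤳ y := by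
  rw [specializes_iff_forall_open]
  intro W hW hyW
  obtain ⟨b, hb, hyb⟩ := hU.exists_basicOpen_le (V := ⟨W, hW⟩) ⟨y, hyW⟩ hy
  exact hb (h b hyb)

/-- Rational points are closed. -/
theorem IsRational.isClosed {x : X} (hx : IsRational f x) : IsClosed ({x} : Set X) := by
  rw [isClosed_iff_clusterPt]
  intro y hy
  have hxy : x ⤳ y := by
    rw [specializes_iff_mem_closure, mem_closure_iff_clusterPt]
    exact hy
  suffices h : y ⤳ x from (h.antisymm hxy).eq
  obtain ⟨_, ⟨U, hU, rfl⟩, hyU, -⟩ :=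
    X.isBasis_affineOpens.exists_subset_of_mem_open (Set.mem_univ y) isOpen_univ
  have hyU : y ∈ U := hyU
  have hxU : x ∈ U := hxy.mem_open U.isOpen hyU
  refine specializes_of_basicOpen hU hxU fun b hb => ?_
  -- Write `b = c + n` with `c` constant and `n` in the maximal ideal at `x`. As `b` is invertible
  -- at `x`, `c ≠ 0`. Since `x ⤳ y`, `n` is also a non-unit at `y`; were `b` a non-unit at `y`, then
  -- so would be `c = b - n`.
  obtain ⟨c, n, hn, hc⟩ := hx ⟨secFF f hyU b, secFF_mem f hyU hxU b⟩
  have hb' := (mem_basicOpen_iff f hyU hxU b).1 hb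
  have hc0 : c ≠ 0 := by
    rintro rfl
    have : (⟨secFF f hyU b, secFF_mem f hyU hxU b⟩ : O f x) = n :=
      Subtype.ext (by simpa using hc)
    rw [← this, IsLocalRing.mem_maximalIdeal, mem_nonunits_iff, isUnit_iff_inv_mem] at hn
    exact hn hb'
  have hny : (n : FF f) ∈ O f y := by
    have : (n : FF f) = secFF f hyU b - algebraMap K (FF f) c := by rw [← sub_eq_of_eq_add' hc]
    rw [this]
    exact sub_mem (secFF_mem f hyU hyU b) (constants_mem f y c)
  have hnm : (⟨n, hny⟩ : O f y) ∈ IsLocalRing.maximalIdeal (O f y) := by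
    rw [IsLocalRing.mem_maximalIdeal, mem_nonunits_iff, isUnit_iff_inv_mem] at hn ⊢
    exact fun h => hn ⟨h.1, O_le_of_specializes f hxy h.2⟩
  have hcu : IsUnit (⟨algebraMap K (FF f) c, constants_mem f y c⟩ : O f y) := by
    rw [isUnit_iff_inv_mem]
    refine ⟨by simpa using hc0, ?_⟩
    change (algebraMap K (FF f) c)⁻¹ ∈ _
    rw [← map_inv₀]
    exact constants_mem f y _
  have hu : IsUnit (⟨secFF f hyU b, secFF_mem f hyU hyU b⟩ : O f y) := by
    by_contra hnu
    have h1 : (⟨secFF f hyU b, secFF_mem f hyU hyU b⟩ : O f y) ∈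
      IsLocalRing.maximalIdeal (O f y) := hnu
    have h2 := sub_mem h1 hnm
    have h3 : (⟨secFF f hyU b, secFF_mem f hyU hyU b⟩ : O f y) - ⟨n, hny⟩ =
        ⟨algebraMap K (FF f) c, constants_mem f y c⟩ :=
      Subtype.ext (sub_eq_of_eq_add hc)
    rw [h3] at h2
    exact h2 hcu
  exact (mem_basicOpen_iff f hyU hyU b).2 ((isUnit_iff_inv_mem f _).1 hu)

/-- A local parameter at a closed point is a unit in a punctured neighbourhood of the point. -/
theorem exists_nhd_param [IsLocallyNoetherian X] {x : X} (hcl : IsClosed ({x} : Set X))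
    {z : O f x} (hz : IsLocalParam f x z) :
    ∃ U : X.Opens, x ∈ U ∧ ∀ y ∈ U, y ≠ x → (z : FF f)⁻¹ ∈ O f y := by
  obtain ⟨_, ⟨U, hU, rfl⟩, hxU, -⟩ :=
    X.isBasis_affineOpens.exists_subset_of_mem_open (Set.mem_univ x) isOpen_univ
  have hxU : x ∈ U := hxU
  have : IsNoetherianRing Γ(X, U) := IsLocallyNoetherian.component_noetherian ⟨U, hU⟩
  obtain ⟨b, c, hc, hbc⟩ := exists_fraction f hU hxU z.2
  have hc' := (mem_basicOpen_iff f hxU hxU c).1 hc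
  let p : Ideal Γ(X, U) := (IsLocalRing.maximalIdeal (X.presheaf.stalk x)).comap
    (X.presheaf.germ U x hxU).hom
  have hp : ∀ n, n ∈ p ↔ x ∉ X.basicOpen n := fun n => by
    rw [Scheme.mem_basicOpen X n x hxU]
    rfl
  -- Since `z = b / c` generates the maximal ideal at `x`, every section vanishing at `x` is a
  -- multiple of `b` after clearing a denominator that is invertible at `x`.
  have hquot : ∀ n ∈ p, ∃ d e : Γ(X, U), x ∈ X.basicOpen d ∧ d * n = e * b := by
    intro n hn
    have hn' : (⟨secFF f hxU n, secFF_mem f hxU hxU n⟩ : O f x) ∈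
        IsLocalRing.maximalIdeal (O f x) := by
      rw [IsLocalRing.mem_maximalIdeal, mem_nonunits_iff, isUnit_iff_inv_mem]
      rwa [hp, mem_basicOpen_iff f hxU hxU] at hn
    rw [hz.2, Ideal.mem_span_singleton] at hn'
    obtain ⟨w, hw⟩ := hn'
    have hw' : secFF f hxU n = z * w := congrArg Subtype.val hw
    obtain ⟨e, d, hd, hed⟩ := exists_fraction f hU hxU w.2
    refine ⟨d * c, e, ?_, ?_⟩
    · rw [Scheme.basicOpen_mul]
      exact ⟨hd, hc⟩
    · apply secFF_injective f hxU
      rw [map_mul, map_mul, map_mul, hw', ← hed, ← hbc]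
      ring
  -- The ideal `p` is finitely generated, so the product of the denominators of the generators
  -- serves for all of `p`.
  have hfin : ∃ d : Γ(X, U), x ∈ X.basicOpen d ∧ ∀ n ∈ p, ∃ e, d * n = e * b := by
    classical
    obtain ⟨T, hT⟩ := (isNoetherianRing_iff_ideal_fg _).1 inferInstance p
    have hTp : ∀ n ∈ T, n ∈ p := fun n hn => hT ▸ Ideal.subset_span hn
    choose! d e hd hde using hquot
    refine ⟨∏ n ∈ T, d n, ?_, ?_⟩
    · rw [Scheme.mem_basicOpen X _ x hxU, map_prod]
      refine IsUnit.prod_iff.2 fun n hn => ?_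
      exact (Scheme.mem_basicOpen X _ x hxU).1 (hd n (hTp n hn))
    · intro n hn
      rw [← hT] at hn
      induction hn using Submodule.span_induction with
      | mem n hn =>
        refine ⟨(∏ m ∈ T.erase n, d m) * e n, ?_⟩
        rw [← Finset.mul_prod_erase T d hn]
        linear_combination (∏ m ∈ T.erase n, d m) * hde n (hTp n hn)
      | zero => exact ⟨0, by simp⟩
      | add n n' _ _ h h' =>
        obtain ⟨e, he⟩ := h
        obtain ⟨e', he'⟩ := h'
        exact ⟨e + e', by rw [mul_add, he, he', add_mul]⟩
      | smul a n _ h =>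
        obtain ⟨e, he⟩ := h
        exact ⟨a * e, by rw [smul_eq_mul, mul_left_comm, he, mul_assoc]⟩
  obtain ⟨d, hd, hde⟩ := hfin
  refine ⟨X.basicOpen d ⊓ X.basicOpen c, ⟨hd, hc⟩, fun y hy hyx => ?_⟩
  have hyU : y ∈ U := X.basicOpen_le d hy.1
  -- If `b` vanished at `y`, then by `d * n = e * b` so would every `n ∈ p`, which makes `y` a
  -- specialization of the closed point `x`, hence equal to it.
  have hby : y ∈ X.basicOpen b := by
    by_contra hb
    refine hyx (Set.mem_singleton_iff.1 (hcl.closure_subset ?_))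
    rw [← specializes_iff_mem_closure]
    refine specializes_of_basicOpen hU hyU fun n hn => ?_
    by_contra hxn
    obtain ⟨e, he⟩ := hde n ((hp n).2 hxn)
    have : y ∈ X.basicOpen (d * n) := by
      rw [Scheme.basicOpen_mul]
      exact ⟨hy.1, hn⟩
    rw [he, Scheme.basicOpen_mul] at this
    exact hb this.2
  have h1 := ((mem_basicOpen_iff f hxU hyU b).1 hby)
  have h3 : (z : FF f)⁻¹ = secFF f hxU c * (secFF f hxU b)⁻¹ := by
    rw [← hbc, mul_inv, mul_left_comm, mul_inv_cancel₀ hc'.1, mul_one]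
  rw [h3]
  exact mul_mem (secFF_mem f hxU hyU c) h1.2

end Geometry

/-! ### The canonical line bundle -/

section Canonical

variable {K : Type u} [Field K] {X : Scheme.{u}} [IsIntegral X] (f : X ⟶ Spec (.of K))

theorem exists_chart {X : Scheme.{u}} (f : X ⟶ Spec (.of K)) [SmoothOfRelativeDimension 1 f] (i : X) :
    ∃ V : X.Opens, IsAffineOpen V ∧ i ∈ V ∧
      (constSec f V).IsStandardSmoothOfRelativeDimension 1 := by
  obtain ⟨U, hU, V, hV, hi, e, h⟩ :=
    SmoothOfRelativeDimension.exists_isStandardSmoothOfRelativeDimension (n := 1) (f := f) i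
  -- The base is a single point, so the affine open set of the base in the smooth chart is
  -- everything.
  obtain rfl : U = ⊤ := by
    ext p
    have : Subsingleton (Spec (.of K)) :=
      inferInstanceAs (Subsingleton (PrimeSpectrum K))
    rw [Subsingleton.elim p (f i)]
    simpa using e hi
  refine ⟨V, hV, hi, ?_⟩
  have h2 := RingHom.isStandardSmoothOfRelativeDimension_respectsIso.2 _
    (Scheme.ΓSpecIso (.of K)).symm.commRingCatIsoToRingEquiv h
  convert! h2 using 1

variable (k : Type u) [Field k] [Algebra k K]

theorem O_smul {x : X} (a : O f x) (w : Ω[FF f⁄k]) : a • w = (a : FF f) • w :=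
  algebra_compatible_smul (FF f) a w

/-- The map `Ω¹_{X/k} → ω_{X/K}` on generic stalks. -/
abbrev relMap : Ω[FF f⁄k] →ₗ[FF f] Ω[FF f⁄K] := KaehlerDifferential.map k K (FF f) (FF f)

theorem relMap_D (a : FF f) : relMap f k (D k (FF f) a) = D K (FF f) a := by
  simp [relMap]

theorem relMap_const (c : K) : relMap f k (D k (FF f) (algebraMap K (FF f) c)) = 0 := by
  rw [relMap_D]
  exact Derivation.map_algebraMap _ c

variable {f k} in
theorem relMap_baseForms {x : X} {η : Ω[FF f⁄k]} (hη : η ∈ baseForms f k x) :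
    relMap f k η = 0 := by
  induction hη using Submodule.span_induction with
  | mem w hw => obtain ⟨c, rfl⟩ := hw; exact relMap_const f k c
  | zero => exact map_zero _
  | add w w' _ _ h h' => rw [map_add, h, h', add_zero]
  | smul a w _ h => rw [O_smul, map_smul, h, smul_zero]

variable {f k} in
theorem relMap_regForms {x : X} {w : Ω[FF f⁄k]} (hw : w ∈ regForms f k x) :
    relMap f k w ∈ regForms f K x := by
  induction hw using Submodule.span_induction with
  | mem w hw => obtain ⟨c, rfl⟩ := hw; rw [relMap_D]; exact D_mem f K x c
  | zero => rw [map_zero]; exact zero_mem _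
  | add w w' _ _ h h' => rw [map_add]; exact add_mem h h'
  | smul a w _ h => rw [O_smul, map_smul]; exact Submodule.smul_mem _ a h

/-- Near every point, the canonical bundle is generated by one form. -/
theorem exists_generator [SmoothOfRelativeDimension 1 f] (i : X) :
    ∃ U : X.Opens, i ∈ U ∧ ∃ t : Ω[FF f⁄k], relMap f k t ≠ 0 ∧
      (∀ w : Ω[FF f⁄K], ∃ a : FF f, w = a • relMap f k t) ∧
      ∀ x ∈ U, regForms f k x = Submodule.span (O f x) {t} ⊔ baseForms f k x := by
  obtain ⟨V, hV, hi, h⟩ := exists_chart f i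
  refine ⟨V, hi, ?_⟩
  let B := Γ(X, V)
  have : Nonempty V := ⟨⟨i, hi⟩⟩
  let : Algebra K B := (constSec f V).toAlgebra
  let : Algebra k B := ((constSec f V).comp (algebraMap k K)).toAlgebra
  let : Algebra B (FF f) := inferInstanceAs (Algebra Γ(X, V) X.functionField)
  have hmap : ∀ b : B, algebraMap B (FF f) b = secFF f hi b := fun b =>
    (Scheme.algebraMap_germ_eq_germToFunctionField X hi b).symm
  have : IsScalarTower K B (FF f) :=
    IsScalarTower.of_algebraMap_eq fun c =>
      (secFF_constSec f hi c).symm.trans (hmap (constSec f V c)).symm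
  have : IsScalarTower k K B := IsScalarTower.of_algebraMap_eq fun _ => rfl
  have : IsScalarTower k B (FF f) :=
    IsScalarTower.of_algebraMap_eq fun c =>
      (secFF_constSec f hi (algebraMap k K c)).symm.trans
        (hmap (constSec f V (algebraMap k K c))).symm
  have hstd : Algebra.IsStandardSmoothOfRelativeDimension 1 K B := h
  have : Nontrivial B := (secFF f hi).domain_nontrivial
  have hrank := Algebra.IsStandardSmoothOfRelativeDimension.rank_kaehlerDifferential
    (R := K) (S := B) 1
  have : Algebra.IsStandardSmooth K B := hstd.isStandardSmooth
  have hfrac : IsFractionRing B (FF f) := functionField_isFractionRing_of_isAffineOpen X V hV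
  have hloc := KaehlerDifferential.isLocalizedModule_map (R := K) (S := B) (T := FF f)
    (nonZeroDivisors B)
  let b : Module.Basis Unit B (Ω[B⁄K]) :=
    Module.basisUnique Unit (Module.rank_eq_one_iff_finrank_eq_one.1 (by simpa using hrank))
  let b' := b.ofIsLocalizedModule (FF f) (nonZeroDivisors B) (KaehlerDifferential.map K K B (FF f))
  have hb' : b' () = KaehlerDifferential.map K K B (FF f) (b ()) :=
    b.ofIsLocalizedModule_apply _ _ _ _
  -- The generator of the relative forms is lifted to an absolute form: the same `t` generates `ω`
  -- through `relMap`, and `Ω¹` modulo the base forms.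
  obtain ⟨t, ht⟩ := KaehlerDifferential.map_surjective (R := k) (S := K) (B := B) (b ())
  let T := KaehlerDifferential.map k k B (FF f) t
  have hT : relMap f k T = b' () := by
    rw [hb', ← ht]
    have : ∀ w : Ω[B⁄k], relMap f k (KaehlerDifferential.map k k B (FF f) w) =
        KaehlerDifferential.map K K B (FF f) (KaehlerDifferential.map k K B B w) := by
      intro w
      have hw : w ∈ Submodule.span B (Set.range (D k B)) := by
        rw [KaehlerDifferential.span_range_derivation]
        trivial
      induction hw using Submodule.span_induction with
      | mem w hw =>
        obtain ⟨a, rfl⟩ := hw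
        simp [relMap]
      | zero => simp only [map_zero]
      | add w w' _ _ h h' => simp only [map_add, h, h']
      | smul a w _ h =>
        rw [map_smul (KaehlerDifferential.map k k B (FF f)),
          map_smul (KaehlerDifferential.map k K B B),
          map_smul (KaehlerDifferential.map K K B (FF f)), ← h, ← algebraMap_smul (FF f) a,
          map_smul, algebraMap_smul]
    exact this t
  refine ⟨T, by rw [hT]; exact b'.ne_zero (), fun w => ⟨b'.repr w (), ?_⟩,
    fun x hx => le_antisymm ?_ ?_⟩
  · have := b'.sum_repr w
    simp only [Finset.univ_unique, Finset.sum_singleton, PUnit.default_eq_unit] at this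
    rw [hT]
    exact this.symm
  · have hmem : ∀ c : B, algebraMap B (FF f) c ∈ O f x := fun c => by
      rw [hmap]; exact secFF_mem f hi hx c
    have hbase : ∀ w : B ⊗[K] Ω[K⁄k], KaehlerDifferential.map k k B (FF f)
        (KaehlerDifferential.mapBaseChange k K B w) ∈ baseForms f k x := by
      intro w
      induction w using TensorProduct.induction_on with
      | zero => rw [map_zero, map_zero]; exact zero_mem _
      | add w w' h h' => rw [map_add, map_add]; exact add_mem h h'
      | tmul c w =>
        rw [KaehlerDifferential.mapBaseChange_tmul, map_smul, ← algebraMap_smul (FF f) c]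
        refine Submodule.smul_mem _ (⟨_, hmem c⟩ : O f x) ?_
        have hw : w ∈ Submodule.span K (Set.range (D k K)) := by
          rw [KaehlerDifferential.span_range_derivation]
          trivial
        induction hw using Submodule.span_induction with
        | mem w hw =>
          obtain ⟨a, rfl⟩ := hw
          refine Submodule.subset_span ⟨a, ?_⟩
          rw [KaehlerDifferential.map_D, KaehlerDifferential.map_D,
            ← IsScalarTower.algebraMap_apply]
        | zero => rw [map_zero, map_zero]; exact zero_mem _
        | add w w' _ _ h h' => rw [map_add, map_add]; exact add_mem h h'
        | smul a w _ h =>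
          rw [map_smul, ← algebraMap_smul B a, map_smul, ← algebraMap_smul (FF f) (algebraMap K B a)]
          exact Submodule.smul_mem _ (⟨_, hmem _⟩ : O f x) h
    have hDs : ∀ a : B, D k (FF f) (secFF f hx a) ∈
        Submodule.span (O f x) {T} ⊔ baseForms f k x := by
      intro a
      -- Exactness of `B ⊗ Ω_K → Ω_{B/k} → Ω_{B/K}`: after subtracting its coefficient times `t`,
      -- the form `da` dies in the relative forms and so comes from the base.
      have h0 : KaehlerDifferential.map k K B B (D k B a - b.repr (D K B a) () • t) = 0 := by
        have := b.sum_repr (D K B a)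
        simp only [Finset.univ_unique, Finset.sum_singleton, PUnit.default_eq_unit] at this
        rw [map_sub, map_smul, ht, this, KaehlerDifferential.map_D]
        simp
      obtain ⟨w, hw⟩ := (KaehlerDifferential.exact_mapBaseChange_map k K B _).1 h0
      have h1 := hbase w
      rw [hw, map_sub, map_smul, KaehlerDifferential.map_D, ← algebraMap_smul (FF f) (b.repr _ _)]
        at h1
      rw [secFF_eq f hx hi, ← hmap, ← sub_add_cancel (D k (FF f) _)
        (algebraMap B (FF f) (b.repr (D K B a) ()) • T)]
      exact add_mem (Submodule.mem_sup_right h1) (Submodule.mem_sup_left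
        (Submodule.smul_mem _ (⟨_, hmem _⟩ : O f x) (Submodule.mem_span_singleton_self _)))
    refine Submodule.span_le.2 ?_
    rintro _ ⟨a, rfl⟩
    -- The quotient rule for `a = n / d` reduces germs to sections over the chart.
    obtain ⟨n, d, hd, hnd⟩ := exists_fraction f hV hx a.2
    obtain ⟨hd0, hd⟩ := (mem_basicOpen_iff f hx hx d).1 hd
    have hl := congrArg (D k (FF f)) hnd
    rw [Derivation.leibniz] at hl
    have hDa : D k (FF f) (a : FF f) = (secFF f hx d)⁻¹ •
        (D k (FF f) (secFF f hx n) - (a : FF f) • D k (FF f) (secFF f hx d)) := by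
      rw [← hl, add_sub_cancel_left, smul_smul, inv_mul_cancel₀ hd0, one_smul]
    change D k (FF f) (a : FF f) ∈ _
    rw [hDa]
    exact Submodule.smul_mem _ (⟨_, hd⟩ : O f x) (sub_mem (hDs n) (Submodule.smul_mem _ a (hDs d)))
  · refine sup_le ?_ (baseForms_le f k x)
    rw [Submodule.span_singleton_le_iff_mem]
    have hmem : ∀ w : Ω[B⁄k], KaehlerDifferential.map k k B (FF f) w ∈ regForms f k x := by
      intro w
      have hw : w ∈ Submodule.span B (Set.range (D k B)) := by
        rw [KaehlerDifferential.span_range_derivation]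
        trivial
      induction hw using Submodule.span_induction with
      | mem w hw =>
        obtain ⟨a, rfl⟩ := hw
        rw [KaehlerDifferential.map_D, hmap]
        exact D_mem f k x ⟨_, secFF_mem f hi hx a⟩
      | zero => rw [map_zero]; exact zero_mem _
      | add w w' _ _ h h' => rw [map_add]; exact add_mem h h'
      | smul a w _ h =>
        rw [map_smul, ← algebraMap_smul (FF f) a, hmap]
        exact Submodule.smul_mem _ (⟨_, secFF_mem f hi hx a⟩ : O f x) h
    exact hmem _

/-- At a rational point, the differential of a local parameter generates the regular forms modulo
the forms that come from the base. -/
theorem regForms_eq_param [SmoothOfRelativeDimension 1 f] {x : X} (hx : IsRational f x) {z : O f x}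
    (hz : IsLocalParam f x z) :
    regForms f k x = Submodule.span (O f x) {D k (FF f) (z : FF f)} ⊔ baseForms f k x := by
  obtain ⟨U, hxU, t, -, -, hU⟩ := exists_generator f k x
  have ht := hU x hxU
  set M := Submodule.span (O f x) {D k (FF f) (z : FF f)} ⊔ baseForms f k x with hM
  have hle : M ≤ regForms f k x := sup_le
    ((Submodule.span_singleton_le_iff_mem _ _).2 (D_mem f k x z)) (baseForms_le f k x)
  -- A Nakayama argument. Rationality gives `a = c + z b`, hence `da = dc + b dz + z db`, and `db`
  -- is a multiple of `t` modulo base forms; so every regular form lies in `z 𝒪_x t + M`.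
  have key : ∀ w ∈ regForms f k x, ∃ u : O f x, w - (z * u) • t ∈ M := by
    intro w hw
    induction hw using Submodule.span_induction with
    | mem w hw =>
      obtain ⟨a, rfl⟩ := hw
      obtain ⟨c, n, hn, hc⟩ := hx a
      rw [hz.2, Ideal.mem_span_singleton] at hn
      obtain ⟨b, rfl⟩ := hn
      have hb := D_mem f k x b
      rw [ht, Submodule.mem_sup] at hb
      obtain ⟨w, hw, η, hη, hwη⟩ := hb
      obtain ⟨u, rfl⟩ := Submodule.mem_span_singleton.1 hw
      refine ⟨u, ?_⟩
      have : D k (FF f) (a : FF f) - (z * u) • t = b • D k (FF f) (z : FF f) +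
          (D k (FF f) (algebraMap K (FF f) c) + z • η) := by
        rw [hc, map_add, Subring.coe_mul, Derivation.leibniz, ← hwη]
        simp only [O_smul, Subring.coe_mul]
        module
      change D k (FF f) (a : FF f) - (z * u) • t ∈ M
      rw [this]
      exact add_mem (Submodule.mem_sup_left (Submodule.smul_mem _ _
        (Submodule.mem_span_singleton_self _))) (Submodule.mem_sup_right (add_mem
          (Submodule.subset_span ⟨c, rfl⟩) (Submodule.smul_mem _ _ hη)))
    | zero => exact ⟨0, by
      rw [mul_zero, O_smul, ZeroMemClass.coe_zero, zero_smul, sub_zero]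
      exact zero_mem _⟩
    | add w w' _ _ h h' =>
      obtain ⟨u, hu⟩ := h
      obtain ⟨u', hu'⟩ := h'
      refine ⟨u + u', ?_⟩
      convert! add_mem hu hu' using 1
      rw [mul_add, add_smul]
      abel
    | smul a w _ h =>
      obtain ⟨u, hu⟩ := h
      refine ⟨a * u, ?_⟩
      convert! Submodule.smul_mem _ a hu using 1
      rw [smul_sub, smul_smul]
      congr 2
      ring
  refine le_antisymm ?_ hle
  rw [ht]
  refine sup_le ((Submodule.span_singleton_le_iff_mem _ _).2 ?_) le_sup_right
  obtain ⟨u, hu⟩ := key t (ht ▸ Submodule.mem_sup_left (Submodule.mem_span_singleton_self t))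
  -- Applied to `t` itself, `key` gives `(1 - z u) t ∈ M`, and `1 - z u` is a unit of the local
  -- ring.
  have hzu : IsUnit (1 - z * u) := by
    refine (IsLocalRing.isUnit_or_isUnit_of_add_one (a := 1 - z * u) (b := z * u)
      (by ring)).resolve_right fun h => ?_
    have : z * u ∈ IsLocalRing.maximalIdeal (O f x) := by
      rw [hz.2]
      exact Ideal.mul_mem_right _ _ (Ideal.mem_span_singleton_self z)
    exact this h
  obtain ⟨v, hv⟩ := hzu.exists_left_inv
  have : t = v • (t - (z * u) • t) := by
    conv_lhs => rw [← one_smul (O f x) t, ← hv, mul_smul, sub_smul, one_smul]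
  rw [this]
  exact Submodule.smul_mem _ _ hu

variable {f} {k} in
theorem mem_regForms_param [SmoothOfRelativeDimension 1 f] {x : X} (hx : IsRational f x)
    {z : O f x} (hz : IsLocalParam f x z) {w : Ω[FF f⁄k]} (hw : w ∈ regForms f k x) :
    ∃ h : O f x, ∃ η ∈ baseForms f k x, w = (h : FF f) • D k (FF f) (z : FF f) + η := by
  rw [regForms_eq_param f k hx hz, Submodule.mem_sup] at hw
  obtain ⟨y, hy, η, hη, rfl⟩ := hw
  obtain ⟨h, rfl⟩ := Submodule.mem_span_singleton.1 hy
  exact ⟨h, η, hη, rfl⟩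

theorem baseForms_self (x : X) : baseForms f K x = ⊥ := by
  refine (Submodule.span_eq_bot).2 ?_
  rintro _ ⟨c, rfl⟩
  exact Derivation.map_algebraMap _ c

variable {f} in
/-- At a rational point, the differential of a local parameter generates `ω`. -/
theorem mem_regForms_iff_param [SmoothOfRelativeDimension 1 f] {x : X} (hx : IsRational f x)
    {z : O f x} (hz : IsLocalParam f x z) {w : Ω[FF f⁄K]} :
    w ∈ regForms f K x ↔ ∃ h : O f x, w = (h : FF f) • D K (FF f) (z : FF f) := by
  rw [regForms_eq_param f K hx hz, baseForms_self, sup_bot_eq, Submodule.mem_span_singleton]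
  exact ⟨fun ⟨a, ha⟩ => ⟨a, ha.symm⟩, fun ⟨a, ha⟩ => ⟨a, ha.symm⟩⟩

variable {f} in
-- Otherwise every regular relative form at `x` would be zero, but `ω` has a non-zero local
-- generator.
theorem D_param_ne_zero [SmoothOfRelativeDimension 1 f] {x : X} (hx : IsRational f x)
    {z : O f x} (hz : IsLocalParam f x z) : D K (FF f) (z : FF f) ≠ 0 := by
  intro h0
  obtain ⟨U, hxU, t, ht0, -, hU⟩ := exists_generator f K x
  have ht : relMap f K t ∈ regForms f K x := relMap_regForms
    (hU x hxU ▸ Submodule.mem_sup_left (Submodule.mem_span_singleton_self t))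
  obtain ⟨h, hh⟩ := (mem_regForms_iff_param hx hz).1 ht
  exact ht0 (by rw [hh, h0, smul_zero])

end Canonical

/-! ### Exterior derivative, contraction and matrices of forms -/

section FormAlgebra

variable (k : Type u) (F : Type u) [Field k] [Field F] [Algebra k F]

theorem extDeriv_smul (a : F) (w : Ω[F⁄k]) :
    extDeriv k F (a • w) = wedge k F (D k F a) w + a • extDeriv k F w := by
  have hw : w ∈ Submodule.span F (Set.range (D k F)) := by
    rw [KaehlerDifferential.span_range_derivation]
    trivial
  induction hw using Submodule.span_induction generalizing a with
  | mem w hw =>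
    obtain ⟨g, rfl⟩ := hw
    have h1 := extDeriv_smul_D k F 1 g
    rw [one_smul, Derivation.map_one_eq_zero, map_zero, LinearMap.zero_apply] at h1
    rw [extDeriv_smul_D, h1, smul_zero, add_zero]
  | zero => simp
  | add w w' _ _ h h' =>
    rw [smul_add, map_add, h, h', map_add, map_add, smul_add]
    abel
  | smul b w _ h =>
    rw [smul_smul, h, h, Derivation.leibniz, map_add, LinearMap.add_apply, map_smul, map_smul,
      map_smul, LinearMap.smul_apply, LinearMap.smul_apply]
    module

theorem extDeriv_D (a : F) : extDeriv k F (D k F a) = 0 := by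
  have h1 := extDeriv_smul_D k F 1 a
  rwa [one_smul, Derivation.map_one_eq_zero, map_zero, LinearMap.zero_apply] at h1

variable (K : Type u) [Field K] [Algebra K F]

theorem toRel_eq_zero {w : Om2 k F} (hw : w ∈ baseForms2 k F K) : toRel k F K w = 0 :=
  (Submodule.Quotient.mk_eq_zero _).2 hw

theorem wedgeRel_self (a : Ω[F⁄k]) : wedgeRel k F K a a = 0 := by
  simp [wedgeRel, wedge_self]

theorem wedgeRel_comm (a b : Ω[F⁄k]) : wedgeRel k F K a b = - wedgeRel k F K b a := by
  simp only [wedgeRel, LinearMap.compr₂_apply]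
  rw [wedge_comm, map_neg]

/-- Contraction of a two-form with a functional. -/
def contract (l : Ω[F⁄k] →ₗ[F] F) : Om2 k F →ₗ[F] Ω[F⁄k] :=
  ExteriorAlgebra.ιInv ∘ₗ CliffordAlgebra.contractLeft (Q := 0) l ∘ₗ Submodule.subtype _

/-- The antiderivation rule for the Clifford contraction with zero quadratic form, followed by the
projection of the exterior algebra to degree one. -/
theorem contract_wedge (l : Ω[F⁄k] →ₗ[F] F) (a b : Ω[F⁄k]) :
    contract k F l (wedge k F a b) = l a • b - l b • a := by
  have h : ((wedge k F a b : Om2 k F) : ExteriorAlgebra F (Ω[F⁄k])) =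
      ExteriorAlgebra.ι F a * ExteriorAlgebra.ι F b := by
    simp [wedge, ExteriorAlgebra.ιMulti_apply]
  change ExteriorAlgebra.ιInv (CliffordAlgebra.contractLeft (Q := 0) l
    ((wedge k F a b : Om2 k F) : ExteriorAlgebra F (Ω[F⁄k]))) = _
  rw [h]
  have h2 : CliffordAlgebra.contractLeft (Q := 0) l
      (ExteriorAlgebra.ι F a * ExteriorAlgebra.ι F b) =
      l a • ExteriorAlgebra.ι F b - l b • ExteriorAlgebra.ι F a := by
    refine (CliffordAlgebra.contractLeft_ι_mul (Q := 0) l a _).trans ?_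
    refine congrArg₂ (· - ·) rfl ?_
    refine (congrArg (_ * ·) (CliffordAlgebra.contractLeft_ι (Q := 0) _ _)).trans ?_
    exact ((Algebra.commutes _ _).symm.trans (Algebra.smul_def _ _).symm)
  rw [h2, map_sub, map_smul, map_smul, ExteriorAlgebra.ι_leftInverse, ExteriorAlgebra.ι_leftInverse]

/-- Contraction with a functional that kills the forms of the base kills `F ⊗ Ω²_K`. -/
theorem contract_baseForms2 (l : Ω[F⁄k] →ₗ[F] F)
    (hl : ∀ c : K, l (D k F (algebraMap K F c)) = 0) {w : Om2 k F} (hw : w ∈ baseForms2 k F K) :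
    contract k F l w = 0 := by
  induction hw using Submodule.span_induction with
  | mem w hw => obtain ⟨a, b, rfl⟩ := hw; rw [contract_wedge, hl, hl, zero_smul, zero_smul, sub_zero]
  | zero => exact map_zero _
  | add w w' _ _ h h' => rw [map_add, h, h', add_zero]
  | smul a w _ h => rw [map_smul, h, smul_zero]

/-! ### Calculus of matrices of functions and matrices of forms -/

variable {k F} {r : ℕ}

/-- The product of a matrix of functions and a matrix of forms. -/
def lm : Matrix (Fin r) (Fin r) F →ₗ[F] Matrix (Fin r) (Fin r) (Ω[F⁄k]) →ₗ[F]
    Matrix (Fin r) (Fin r) (Ω[F⁄k]) :=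
  LinearMap.mk₂ F (fun G P => Matrix.of fun i j => ∑ l, G i l • P l j)
    (fun G G' P => by ext i j; simp [add_smul, Finset.sum_add_distrib])
    (fun c G P => by ext i j; simp [mul_smul, Finset.smul_sum])
    (fun G P P' => by ext i j; simp [Finset.sum_add_distrib])
    (fun c G P => by ext i j; simp [Finset.smul_sum, smul_comm c])

/-- The product of a matrix of forms and a matrix of functions. -/
def rm : Matrix (Fin r) (Fin r) (Ω[F⁄k]) →ₗ[F] Matrix (Fin r) (Fin r) F →ₗ[F]
    Matrix (Fin r) (Fin r) (Ω[F⁄k]) :=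
  LinearMap.mk₂ F (fun P G => Matrix.of fun i j => ∑ l, G l j • P i l)
    (fun G P P' => by ext i j; simp [Finset.sum_add_distrib])
    (fun c G P => by ext i j; simp [Finset.smul_sum, smul_comm c])
    (fun G G' P => by ext i j; simp [add_smul, Finset.sum_add_distrib])
    (fun c G P => by ext i j; simp [mul_smul, Finset.smul_sum])

/-- The product of a matrix of functions and a form. -/
def fm : Matrix (Fin r) (Fin r) F →ₗ[F] Ω[F⁄k] →ₗ[F] Matrix (Fin r) (Fin r) (Ω[F⁄k]) :=
  LinearMap.mk₂ F (fun G w => Matrix.of fun i j => G i j • w)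
    (fun G G' w => by ext i j; simp [add_smul])
    (fun c G w => by ext i j; simp [mul_smul])
    (fun G w w' => by ext i j; simp)
    (fun c G w => by ext i j; simp [smul_comm c])

/-- The differential of a matrix of functions. -/
def dM : Matrix (Fin r) (Fin r) F →+ Matrix (Fin r) (Fin r) (Ω[F⁄k]) where
  toFun G := Matrix.of fun i j => D k F (G i j)
  map_zero' := by ext i j; simp
  map_add' G H := by ext i j; simp

/-- The trace of a matrix of forms. -/
def trM : Matrix (Fin r) (Fin r) (Ω[F⁄k]) →ₗ[F] Ω[F⁄k] := Matrix.traceLinearMap (Fin r) F _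

variable (k F) in
/-- The two-form `Tr(P ∧ Q)` modulo the forms of the base. -/
def trW : Matrix (Fin r) (Fin r) (Ω[F⁄k]) →ₗ[F] Matrix (Fin r) (Fin r) (Ω[F⁄k]) →ₗ[F]
    RelForms2 k F K :=
  LinearMap.mk₂ F (fun P Q => ∑ i, ∑ j, wedgeRel k F K (P i j) (Q j i))
    (fun P P' Q => by simp [Finset.sum_add_distrib])
    (fun c P Q => by simp [Finset.smul_sum])
    (fun P Q Q' => by simp [Finset.sum_add_distrib])
    (fun c P Q => by simp [Finset.smul_sum])

theorem lm_apply (G : Matrix (Fin r) (Fin r) F) (P : Matrix (Fin r) (Fin r) (Ω[F⁄k]))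
    (i j : Fin r) : lm G P i j = ∑ l, G i l • P l j := rfl

theorem rm_apply (G : Matrix (Fin r) (Fin r) F) (P : Matrix (Fin r) (Fin r) (Ω[F⁄k]))
    (i j : Fin r) : rm P G i j = ∑ l, G l j • P i l := rfl

theorem fm_apply (G : Matrix (Fin r) (Fin r) F) (w : Ω[F⁄k]) (i j : Fin r) :
    fm G w i j = G i j • w := rfl

theorem dM_apply (G : Matrix (Fin r) (Fin r) F) (i j : Fin r) :
    dM (k := k) G i j = D k F (G i j) := rfl

theorem trM_apply (P : Matrix (Fin r) (Fin r) (Ω[F⁄k])) : trM P = ∑ i, P i i := rfl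

theorem trW_apply (P Q : Matrix (Fin r) (Fin r) (Ω[F⁄k])) :
    trW k F K P Q = ∑ i, ∑ j, wedgeRel k F K (P i j) (Q j i) := rfl

theorem lm_lm (G H : Matrix (Fin r) (Fin r) F) (P : Matrix (Fin r) (Fin r) (Ω[F⁄k])) :
    lm G (lm H P) = lm (G * H) P := by
  ext i j
  simp only [lm_apply, Matrix.mul_apply, Finset.smul_sum, Finset.sum_smul, smul_smul]
  exact Finset.sum_comm

theorem rm_rm (G H : Matrix (Fin r) (Fin r) F) (P : Matrix (Fin r) (Fin r) (Ω[F⁄k])) :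
    rm (rm P G) H = rm P (G * H) := by
  ext i j
  simp only [rm_apply, Matrix.mul_apply, Finset.smul_sum, Finset.sum_smul, smul_smul]
  rw [Finset.sum_comm]
  simp only [mul_comm]

theorem rm_lm (G H : Matrix (Fin r) (Fin r) F) (P : Matrix (Fin r) (Fin r) (Ω[F⁄k])) :
    rm (lm G P) H = lm G (rm P H) := by
  ext i j
  simp only [lm_apply, rm_apply, Finset.smul_sum, smul_smul]
  rw [Finset.sum_comm]
  simp only [mul_comm]

theorem one_lm (P : Matrix (Fin r) (Fin r) (Ω[F⁄k])) : lm 1 P = P := by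
  ext i j
  simp [lm_apply, Matrix.one_apply]

theorem rm_one (P : Matrix (Fin r) (Fin r) (Ω[F⁄k])) : rm P 1 = P := by
  ext i j
  simp [rm_apply, Matrix.one_apply]

theorem lm_fm (G H : Matrix (Fin r) (Fin r) F) (w : Ω[F⁄k]) : lm G (fm H w) = fm (G * H) w := by
  ext i j
  simp only [lm_apply, fm_apply, Matrix.mul_apply, Finset.sum_smul, smul_smul]

theorem rm_fm (G H : Matrix (Fin r) (Fin r) F) (w : Ω[F⁄k]) : rm (fm H w) G = fm (H * G) w := by
  ext i j
  simp only [rm_apply, fm_apply, Matrix.mul_apply, Finset.sum_smul, smul_smul, mul_comm]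

theorem dM_mul (G H : Matrix (Fin r) (Fin r) F) :
    dM (k := k) (G * H) = rm (dM G) H + lm G (dM H) := by
  ext i j
  simp only [Matrix.add_apply, lm_apply, rm_apply, dM_apply, Matrix.mul_apply, map_sum,
    Derivation.leibniz, Finset.sum_add_distrib]
  rw [add_comm]

theorem dM_one : dM (k := k) (1 : Matrix (Fin r) (Fin r) F) = 0 := by
  ext i j
  by_cases h : i = j
  · simp [dM_apply, h]
  · simp [dM_apply, Matrix.one_apply_ne h]

theorem dM_smul (a : F) (G : Matrix (Fin r) (Fin r) F) :
    dM (k := k) (a • G) = a • dM G + fm G (D k F a) := by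
  ext i j
  simp [dM_apply, fm_apply]

theorem trW_comm (P Q : Matrix (Fin r) (Fin r) (Ω[F⁄k])) :
    trW k F K P Q = - trW k F K Q P := by
  rw [trW_apply, trW_apply, Finset.sum_comm, ← Finset.sum_neg_distrib]
  refine Finset.sum_congr rfl fun i _ => ?_
  rw [← Finset.sum_neg_distrib]
  exact Finset.sum_congr rfl fun j _ => wedgeRel_comm k F K _ _

theorem trW_rm (G : Matrix (Fin r) (Fin r) F) (P Q : Matrix (Fin r) (Fin r) (Ω[F⁄k])) :
    trW k F K (rm P G) Q = trW k F K P (lm G Q) := by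
  simp only [trW_apply, rm_apply, lm_apply, map_sum, map_smul, LinearMap.sum_apply,
    LinearMap.smul_apply]
  exact Finset.sum_congr rfl fun i _ => Finset.sum_comm

/-- Cyclicity of the trace: the sign from exchanging the two one-forms occurs twice, since a matrix
of functions has degree zero. -/
theorem trW_lm (G : Matrix (Fin r) (Fin r) F) (P Q : Matrix (Fin r) (Fin r) (Ω[F⁄k])) :
    trW k F K (lm G P) Q = trW k F K P (rm Q G) := by
  rw [trW_comm, ← trW_rm, trW_comm, neg_neg]

theorem trW_fm (G : Matrix (Fin r) (Fin r) F) (w : Ω[F⁄k])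
    (P : Matrix (Fin r) (Fin r) (Ω[F⁄k])) :
    trW k F K (fm G w) P = wedgeRel k F K w (trM (lm G P)) := by
  simp only [trW_apply, fm_apply, trM_apply, lm_apply, map_sum, map_smul, LinearMap.smul_apply]

theorem trM_comm (G : Matrix (Fin r) (Fin r) F) (P : Matrix (Fin r) (Fin r) (Ω[F⁄k])) :
    trM (lm G P) = trM (rm P G) := by
  simp only [trM_apply, lm_apply, rm_apply]
  exact Finset.sum_comm

/-! ### The differential of a determinant -/

theorem dlog_prod {ι : Type*} (s : Finset ι) (d : ι → Fˣ) :
    dlog k F (∏ i ∈ s, d i) = ∑ i ∈ s, dlog k F (d i) := by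
  classical
  induction s using Finset.induction_on with
  | empty => simp [dlog]
  | insert a s ha h => rw [Finset.prod_insert ha, Finset.sum_insert ha, dlog_mul, h]

/-- By cyclicity `Tr((AB)⁻¹ d(AB)) = Tr(A⁻¹ dA) + Tr(B⁻¹ dB)`. This is the multiplicative step in
the induction that proves Jacobi's formula. -/
theorem D_det_mul {A B : Matrix (Fin r) (Fin r) F} (hA : A.det ≠ 0) (hB : B.det ≠ 0)
    (ihA : D k F A.det = A.det • trM (lm A⁻¹ (dM A)))
    (ihB : D k F B.det = B.det • trM (lm B⁻¹ (dM B))) :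
    D k F (A * B).det = (A * B).det • trM (lm (A * B)⁻¹ (dM (A * B))) := by
  have hA' : IsUnit A.det := isUnit_iff_ne_zero.2 hA
  have hB' : IsUnit B.det := isUnit_iff_ne_zero.2 hB
  have h1 : trM (lm (A * B)⁻¹ (rm (dM (k := k) A) B)) = trM (lm A⁻¹ (dM A)) := by
    rw [Matrix.mul_inv_rev, ← lm_lm, trM_comm, ← rm_lm, rm_rm, Matrix.mul_nonsing_inv _ hB', rm_one]
  have h2 : lm (A * B)⁻¹ (lm A (dM (k := k) B)) = lm B⁻¹ (dM B) := by
    rw [lm_lm, Matrix.mul_inv_rev, Matrix.mul_assoc, Matrix.nonsing_inv_mul _ hA', Matrix.mul_one]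
  rw [Matrix.det_mul, Derivation.leibniz, ihA, ihB, dM_mul, map_add, map_add, h1, h2, smul_add,
    smul_smul, smul_smul, mul_comm B.det, add_comm]

/-- Jacobi's formula for the differential of a determinant. -/
theorem D_det (G : Matrix (Fin r) (Fin r) F) (hG : G.det ≠ 0) :
    D k F G.det = G.det • trM (lm G⁻¹ (dM G)) := by
  -- Diagonal matrices and transvections generate the invertible matrices, and the formula is
  -- multiplicative.
  refine Matrix.diagonal_transvection_induction_of_det_ne_zero
    (fun G => D k F G.det = G.det • trM (lm G⁻¹ (dM G))) G hG (fun d hd => ?_) (fun t => ?_)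
    fun A B hA hB ihA ihB => D_det_mul hA hB ihA ihB
  · rw [Matrix.det_diagonal] at hd ⊢
    have hd' : ∀ i, d i ≠ 0 := fun i => (Finset.prod_ne_zero_iff.1 hd) i (Finset.mem_univ i)
    have h := dlog_prod (k := k) Finset.univ fun i => Units.mk0 (d i) (hd' i)
    have hp : ∏ i, Units.mk0 (d i) (hd' i) = Units.mk0 (∏ i, d i) hd := Units.ext (by simp)
    rw [hp] at h
    have h2 : trM (lm (Matrix.diagonal d)⁻¹ (dM (k := k) (Matrix.diagonal d))) =
        ∑ i, dlog k F (Units.mk0 (d i) (hd' i)) := by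
      have : (Matrix.diagonal d)⁻¹ = Matrix.diagonal fun i => (d i)⁻¹ :=
        Matrix.inv_eq_left_inv (by
          rw [Matrix.diagonal_mul_diagonal, ← Matrix.diagonal_one]
          congr 1
          ext i
          exact inv_mul_cancel₀ (hd' i))
      rw [this, trM_apply]
      refine Finset.sum_congr rfl fun i _ => ?_
      rw [lm_apply, Finset.sum_eq_single i]
      · simp [dM_apply, dlog]
      · intro j _ hj
        simp [Matrix.diagonal_apply_ne _ (Ne.symm hj)]
      · simp
    rw [h2, ← h]
    simp only [dlog, Units.val_inv_eq_inv_val, Units.val_mk0]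
    rw [smul_smul, mul_inv_cancel₀ hd, one_smul]
  -- For a transvection the determinant is constant, and `t⁻¹ dt` has its only entry off the
  -- diagonal, so both sides vanish.
  · rw [t.det, Derivation.map_one_eq_zero, one_smul]
    have hinv : (t.toMatrix)⁻¹ = t.inv.toMatrix := Matrix.inv_eq_left_inv t.inv_mul
    rw [hinv, trM_apply]
    symm
    refine Finset.sum_eq_zero fun a _ => ?_
    rw [lm_apply]
    refine Finset.sum_eq_zero fun b _ => ?_
    rw [dM_apply]
    have hij := t.hij
    simp only [Matrix.TransvectionStruct.toMatrix, Matrix.TransvectionStruct.inv,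
      Matrix.transvection, Matrix.add_apply, Matrix.single_apply, map_add]
    have h1 : D k F ((1 : Matrix (Fin r) (Fin r) F) b a) = 0 :=
      congrFun (congrFun (dM_one (k := k)) b) a
    rw [h1, zero_add]
    by_cases h : t.i = b ∧ t.j = a
    · obtain ⟨rfl, rfl⟩ := h
      simp [hij, hij.symm]
    · simp [h]

theorem trForm_eq_trW {K : Type u} [Field K] {X : Scheme.{u}} [IsIntegral X]
    {f : X ⟶ Spec (.of K)} [Algebra k K] (g : GL (Fin r) (FF f))
    (A : Matrix (Fin r) (Fin r) (Ω[FF f⁄k])) :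
    trForm g A = trW k (FF f) K (rm (dM (g : Matrix (Fin r) (Fin r) (FF f)))
      ((g⁻¹ : GL (Fin r) (FF f)) : Matrix (Fin r) (Fin r) (FF f))) A := by
  simp only [trForm, trW_apply, rm_apply, dM_apply, map_sum, map_smul, LinearMap.sum_apply,
    LinearMap.smul_apply]
  exact Finset.sum_congr rfl fun i _ => Finset.sum_comm

end FormAlgebra

/-! ### Regular matrices and the polar shape of a connection matrix -/

section Local

variable {K : Type u} [Field K] {X : Scheme.{u}} [IsIntegral X] {f : X ⟶ Spec (.of K)}
  {k : Type u} [Field k] [Algebra k K] {r : ℕ} {x : X}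

theorem smul_mem_regForms {a : FF f} (ha : a ∈ O f x) {w : Ω[FF f⁄k]} (hw : w ∈ regForms f k x) :
    a • w ∈ regForms f k x := Submodule.smul_mem _ (⟨a, ha⟩ : O f x) hw

theorem smul_mem_baseForms {a : FF f} (ha : a ∈ O f x) {w : Ω[FF f⁄k]} (hw : w ∈ baseForms f k x) :
    a • w ∈ baseForms f k x := Submodule.smul_mem _ (⟨a, ha⟩ : O f x) hw

theorem smul_mem_regForms2 {a : FF f} (ha : a ∈ O f x) {w : RelForms2 k (FF f) K}
    (hw : w ∈ regForms2 f k x) : a • w ∈ regForms2 f k x :=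
  Submodule.smul_mem _ (⟨a, ha⟩ : O f x) hw

/-- The product of two forms that come from the base vanishes modulo `Ω²_K`. -/
theorem wedgeRel_baseForms {a b : Ω[FF f⁄k]} (ha : a ∈ baseForms f k x)
    (hb : b ∈ baseForms f k x) : wedgeRel k (FF f) K a b = 0 := by
  induction ha using Submodule.span_induction with
  | mem a ha =>
    obtain ⟨c, rfl⟩ := ha
    induction hb using Submodule.span_induction with
    | mem b hb =>
      obtain ⟨c', rfl⟩ := hb
      exact toRel_eq_zero k (FF f) K (Submodule.subset_span ⟨c, c', rfl⟩)
    | zero => rw [map_zero]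
    | add b b' _ _ h h' => rw [map_add, h, h', add_zero]
    | smul c b _ h => rw [O_smul, map_smul, h, smul_zero]
  | zero => rw [map_zero, LinearMap.zero_apply]
  | add b b' _ _ h h' => rw [map_add, LinearMap.add_apply, h, h', add_zero]
  | smul c b _ h => rw [O_smul, map_smul, LinearMap.smul_apply, h, smul_zero]

variable (x) in
/-- The entries of the matrix are regular functions at `x`. -/
def IntM (G : Matrix (Fin r) (Fin r) (FF f)) : Prop := ∀ i j, G i j ∈ O f x

variable (x) in
/-- The entries of the matrix are regular forms at `x`. -/
def RegM (P : Matrix (Fin r) (Fin r) (Ω[FF f⁄k])) : Prop := ∀ i j, P i j ∈ regForms f k x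

variable (x) in
/-- The entries of the matrix are forms in `𝒪_x ⊗ Ω¹_K`. -/
def BaseM (P : Matrix (Fin r) (Fin r) (Ω[FF f⁄k])) : Prop := ∀ i j, P i j ∈ baseForms f k x

variable (x) in
/-- The matrix is in `GL_r(𝒪_x)`. -/
structure IsGLInt (G : Matrix (Fin r) (Fin r) (FF f)) : Prop where
  int : IntM x G
  inv_int : IntM x G⁻¹
  det : IsUnit G.det

theorem IntM.mul {G H : Matrix (Fin r) (Fin r) (FF f)} (hG : IntM x G) (hH : IntM x H) :
    IntM x (G * H) := fun i j => by
  rw [Matrix.mul_apply]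
  exact sum_mem fun l _ => mul_mem (hG i l) (hH l j)

theorem IntM.add {G H : Matrix (Fin r) (Fin r) (FF f)} (hG : IntM x G) (hH : IntM x H) :
    IntM x (G + H) := fun i j => add_mem (hG i j) (hH i j)

theorem IntM.neg {G : Matrix (Fin r) (Fin r) (FF f)} (hG : IntM x G) :
    IntM x (-G) := fun i j => neg_mem (hG i j)

theorem IntM.smul {a : FF f} (ha : a ∈ O f x) {G : Matrix (Fin r) (Fin r) (FF f)}
    (hG : IntM x G) : IntM x (a • G) := fun i j => mul_mem ha (hG i j)

theorem IntM.det {G : Matrix (Fin r) (Fin r) (FF f)} (hG : IntM x G) : G.det ∈ O f x := by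
  have : G = (Matrix.of fun i j => (⟨G i j, hG i j⟩ : O f x)).map (O f x).subtype := rfl
  rw [this, ← RingHom.mapMatrix_apply, ← RingHom.map_det]
  exact Subtype.prop _

theorem RegM.add {P Q : Matrix (Fin r) (Fin r) (Ω[FF f⁄k])} (hP : RegM x P) (hQ : RegM x Q) :
    RegM x (P + Q) := fun i j => add_mem (hP i j) (hQ i j)

theorem RegM.sub {P Q : Matrix (Fin r) (Fin r) (Ω[FF f⁄k])} (hP : RegM x P) (hQ : RegM x Q) :
    RegM x (P - Q) := fun i j => sub_mem (hP i j) (hQ i j)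

theorem RegM.smul {a : FF f} (ha : a ∈ O f x) {P : Matrix (Fin r) (Fin r) (Ω[FF f⁄k])}
    (hP : RegM x P) : RegM x (a • P) := fun i j => smul_mem_regForms ha (hP i j)

theorem RegM.lm {G : Matrix (Fin r) (Fin r) (FF f)} {P : Matrix (Fin r) (Fin r) (Ω[FF f⁄k])}
    (hG : IntM x G) (hP : RegM x P) : RegM x (lm G P) := fun i j => by
  rw [lm_apply]
  exact sum_mem fun l _ => smul_mem_regForms (hG i l) (hP l j)

theorem RegM.rm {G : Matrix (Fin r) (Fin r) (FF f)} {P : Matrix (Fin r) (Fin r) (Ω[FF f⁄k])}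
    (hP : RegM x P) (hG : IntM x G) : RegM x (rm P G) := fun i j => by
  rw [rm_apply]
  exact sum_mem fun l _ => smul_mem_regForms (hG l j) (hP i l)

theorem RegM.fm {G : Matrix (Fin r) (Fin r) (FF f)} {w : Ω[FF f⁄k]}
    (hG : IntM x G) (hw : w ∈ regForms f k x) : RegM x (fm G w) := fun i j =>
  smul_mem_regForms (hG i j) hw

theorem RegM.dM {G : Matrix (Fin r) (Fin r) (FF f)} (hG : IntM x G) :
    RegM x (dM (k := k) G) := fun i j => D_mem f k x ⟨_, hG i j⟩

theorem RegM.trM {P : Matrix (Fin r) (Fin r) (Ω[FF f⁄k])} (hP : RegM x P) :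
    trM P ∈ regForms f k x := by
  rw [trM_apply]
  exact sum_mem fun i _ => hP i i

theorem RegM.trW {P Q : Matrix (Fin r) (Fin r) (Ω[FF f⁄k])} (hP : RegM x P) (hQ : RegM x Q) :
    trW k (FF f) K P Q ∈ regForms2 f k x := by
  rw [trW_apply]
  exact sum_mem fun i _ => sum_mem fun j _ => wedge_regForms f k (hP i j) (hQ j i)

theorem BaseM.regM {P : Matrix (Fin r) (Fin r) (Ω[FF f⁄k])} (hP : BaseM x P) : RegM x P :=
  fun i j => baseForms_le f k x (hP i j)

theorem BaseM.add {P Q : Matrix (Fin r) (Fin r) (Ω[FF f⁄k])} (hP : BaseM x P) (hQ : BaseM x Q) :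
    BaseM x (P + Q) := fun i j => add_mem (hP i j) (hQ i j)

theorem BaseM.smul {a : FF f} (ha : a ∈ O f x) {P : Matrix (Fin r) (Fin r) (Ω[FF f⁄k])}
    (hP : BaseM x P) : BaseM x (a • P) := fun i j => smul_mem_baseForms ha (hP i j)

theorem BaseM.lm {G : Matrix (Fin r) (Fin r) (FF f)} {P : Matrix (Fin r) (Fin r) (Ω[FF f⁄k])}
    (hG : IntM x G) (hP : BaseM x P) : BaseM x (lm G P) := fun i j => by
  rw [lm_apply]
  exact sum_mem fun l _ => smul_mem_baseForms (hG i l) (hP l j)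

theorem BaseM.rm {G : Matrix (Fin r) (Fin r) (FF f)} {P : Matrix (Fin r) (Fin r) (Ω[FF f⁄k])}
    (hP : BaseM x P) (hG : IntM x G) : BaseM x (rm P G) := fun i j => by
  rw [rm_apply]
  exact sum_mem fun l _ => smul_mem_baseForms (hG l j) (hP i l)

theorem BaseM.trW {P Q : Matrix (Fin r) (Fin r) (Ω[FF f⁄k])} (hP : BaseM x P) (hQ : BaseM x Q) :
    trW k (FF f) K P Q = 0 := by
  rw [trW_apply]
  exact Finset.sum_eq_zero fun i _ => Finset.sum_eq_zero fun j _ =>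
    wedgeRel_baseForms (hP i j) (hQ j i)

variable (x) in
/-- The matrix has the shape `g dz / z ^ m + η / z ^ n`. -/
def Shape (z : FF f) (m n : ℕ) (A : Matrix (Fin r) (Fin r) (Ω[FF f⁄k]))
    (g : Matrix (Fin r) (Fin r) (FF f)) (η : Matrix (Fin r) (Fin r) (Ω[FF f⁄k])) : Prop :=
  IntM x g ∧ BaseM x η ∧ A = (z ^ m)⁻¹ • fm g (D k (FF f) z) + (z ^ n)⁻¹ • η

/-- The connection matrix in another basis. -/
def gauge (φ : Matrix (Fin r) (Fin r) (FF f)) (A : Matrix (Fin r) (Fin r) (Ω[FF f⁄k])) :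
    Matrix (Fin r) (Fin r) (Ω[FF f⁄k]) := lm φ⁻¹ (rm A φ + dM φ)

variable (k) in
/-- The matrix version of `Tr(dg g⁻¹ A)`. -/
def trD (g : Matrix (Fin r) (Fin r) (FF f)) (A : Matrix (Fin r) (Fin r) (Ω[FF f⁄k])) :
    RelForms2 k (FF f) K := trW k (FF f) K (rm (dM g) g⁻¹) A

theorem IsGLInt.mul_inv {G : Matrix (Fin r) (Fin r) (FF f)} (hG : IsGLInt x G) : G * G⁻¹ = 1 :=
  Matrix.mul_nonsing_inv _ hG.det

theorem IsGLInt.inv_mul {G : Matrix (Fin r) (Fin r) (FF f)} (hG : IsGLInt x G) : G⁻¹ * G = 1 :=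
  Matrix.nonsing_inv_mul _ hG.det

theorem IsGLInt.inv {G : Matrix (Fin r) (Fin r) (FF f)} (hG : IsGLInt x G) : IsGLInt x G⁻¹ :=
  ⟨hG.inv_int, by rw [Matrix.nonsing_inv_nonsing_inv _ hG.det]; exact hG.int,
    Matrix.isUnit_nonsing_inv_det _ hG.det⟩

theorem IsGLInt.mul {G H : Matrix (Fin r) (Fin r) (FF f)} (hG : IsGLInt x G) (hH : IsGLInt x H) :
    IsGLInt x (G * H) :=
  ⟨hG.int.mul hH.int, by rw [Matrix.mul_inv_rev]; exact hH.inv_int.mul hG.inv_int,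
    by rw [Matrix.det_mul]; exact hG.det.mul hH.det⟩

/-- The inverse is the adjugate divided by the determinant, and the adjugate has regular entries. -/
theorem isGLInt_iff_det {G : Matrix (Fin r) (Fin r) (FF f)} (hG : IntM x G) :
    IsGLInt x G ↔ IsUnit (⟨G.det, hG.det⟩ : O f x) := by
  rw [isUnit_iff_inv_mem]
  constructor
  · intro h
    refine ⟨h.det.ne_zero, ?_⟩
    change G.det⁻¹ ∈ _
    have h1 : G.det * (G⁻¹).det = 1 := by rw [← Matrix.det_mul, h.mul_inv, Matrix.det_one]
    rw [← eq_inv_of_mul_eq_one_right h1]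
    exact h.inv_int.det
  · rintro ⟨h0, h1⟩
    refine ⟨hG, fun i j => ?_, isUnit_iff_ne_zero.2 h0⟩
    have : G = (Matrix.of fun i j => (⟨G i j, hG i j⟩ : O f x)).map (O f x).subtype := rfl
    rw [Matrix.inv_def, Ring.inverse_eq_inv', Matrix.smul_apply, smul_eq_mul]
    refine mul_mem h1 ?_
    rw [this, ← RingHom.mapMatrix_apply, ← RingHom.map_adjugate]
    exact Subtype.prop _

/-- Invertibility over `𝒪_x` depends only on the matrix modulo the maximal ideal. -/
theorem IsGLInt.congr {G H : Matrix (Fin r) (Fin r) (FF f)} (hG : IsGLInt x G) (hH : IntM x H)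
    (h : ∀ i j, ∃ a ∈ IsLocalRing.maximalIdeal (O f x), H i j = G i j + a) : IsGLInt x H := by
  rw [isGLInt_iff_det hH]
  have h1 := (isGLInt_iff_det hG.int).1 hG
  rw [← IsLocalRing.residue_ne_zero_iff_isUnit] at h1 ⊢
  -- The residue of the determinant is the determinant of the residues, so whether it is a unit
  -- depends only on the reduced matrix.
  have key : ∀ {M : Matrix (Fin r) (Fin r) (FF f)} (hM : IntM x M),
      IsLocalRing.residue (O f x) ⟨M.det, hM.det⟩ =
        ((Matrix.of fun i j => (⟨M i j, hM i j⟩ : O f x)).map (IsLocalRing.residue (O f x))).det := by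
    intro M hM
    rw [← RingHom.mapMatrix_apply, ← RingHom.map_det]
    congr 1
    apply Subtype.ext
    change M.det = (O f x).subtype _
    rw [RingHom.map_det]
    rfl
  rw [key hG.int] at h1
  rw [key hH]
  convert! h1 using 2
  ext i j
  obtain ⟨a, ha, hij⟩ := h i j
  rw [Matrix.map_apply, Matrix.map_apply, ← sub_eq_zero, ← map_sub, IsLocalRing.residue_eq_zero_iff]
  convert! ha using 1
  exact Subtype.ext (sub_eq_of_eq_add' hij)

/-- Differentiate `φ⁻¹ φ = 1` and multiply by `φ⁻¹` on the right. -/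
theorem IsGLInt.dM_inv {φ : Matrix (Fin r) (Fin r) (FF f)} (hφ : IsGLInt x φ) :
    dM (k := k) φ⁻¹ = - lm φ⁻¹ (rm (dM φ) φ⁻¹) := by
  have h := dM_mul (k := k) φ⁻¹ φ
  rw [hφ.inv_mul, dM_one] at h
  have h2 := congrArg (fun P => RelAD.rm P φ⁻¹) h
  simp only [map_zero, LinearMap.zero_apply, map_add, LinearMap.add_apply, rm_rm, hφ.mul_inv,
    rm_one, rm_lm] at h2
  exact eq_neg_of_add_eq_zero_left h2.symm

theorem trW_conj {φ : Matrix (Fin r) (Fin r) (FF f)} (hφ : IsGLInt x φ)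
    (P Q : Matrix (Fin r) (Fin r) (Ω[FF f⁄k])) :
    trW k (FF f) K (lm φ⁻¹ (rm P φ)) (lm φ⁻¹ (rm Q φ)) = trW k (FF f) K P Q := by
  rw [trW_lm, trW_rm, rm_lm, rm_rm, lm_lm, hφ.mul_inv, rm_one, one_lm]

/-- `Tr(dg g⁻¹ A)` after a change of basis. -/
theorem trD_conj {φ γ : Matrix (Fin r) (Fin r) (FF f)} (hφ : IsGLInt x φ) (hγ : IsGLInt x γ)
    (A : Matrix (Fin r) (Fin r) (Ω[FF f⁄k])) :
    trD k (φ⁻¹ * γ * φ) (gauge φ A) =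
      trW k (FF f) K (rm (dM γ) γ⁻¹ + lm γ (rm (rm (dM φ) φ⁻¹) γ⁻¹) - rm (dM φ) φ⁻¹)
        (A + rm (dM φ) φ⁻¹) := by
  have h1 : gauge φ A = lm φ⁻¹ (rm (A + rm (dM φ) φ⁻¹) φ) := by
    rw [gauge, map_add rm, LinearMap.add_apply, rm_rm, hφ.inv_mul, rm_one]
  -- With `θ = dφ φ⁻¹`, the logarithmic derivative of `φ⁻¹ γ φ` is the conjugate of `dγ γ⁻¹ + γ θ
  -- γ⁻¹ - θ`. The gauge transform is the conjugate of `A + θ` by the same matrix, so the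
  -- conjugations disappear in the trace.
  have h2 : rm (dM (k := k) (φ⁻¹ * γ * φ)) (φ⁻¹ * γ * φ)⁻¹ =
      lm φ⁻¹ (rm (rm (dM γ) γ⁻¹ + lm γ (rm (rm (dM φ) φ⁻¹) γ⁻¹) - rm (dM φ) φ⁻¹) φ) := by
    have e1 : (φ⁻¹ * γ * φ)⁻¹ = φ⁻¹ * γ⁻¹ * φ := by
      rw [Matrix.mul_inv_rev, Matrix.mul_inv_rev, Matrix.nonsing_inv_nonsing_inv _ hφ.det,
        Matrix.mul_assoc]
    have e2 : φ * (φ⁻¹ * γ⁻¹ * φ) = γ⁻¹ * φ := by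
      rw [← Matrix.mul_assoc, ← Matrix.mul_assoc, hφ.mul_inv, Matrix.one_mul]
    have e3 : γ * (γ⁻¹ * φ) = φ := by rw [← Matrix.mul_assoc, hγ.mul_inv, Matrix.one_mul]
    rw [e1, dM_mul, dM_mul, hφ.dM_inv]
    simp only [map_add, map_sub, map_neg, LinearMap.add_apply, LinearMap.sub_apply,
      LinearMap.neg_apply, rm_rm, rm_lm, lm_lm, Matrix.mul_assoc, hφ.inv_mul]
    rw [← Matrix.mul_assoc φ⁻¹ γ⁻¹ φ, e2, e3, hφ.inv_mul, rm_one]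
    abel
  rw [trD, h1, h2, trW_conj hφ]

end Local

/-! ### Independence of the local basis -/

section LocalIndependence

variable {K : Type u} [Field K] {X : Scheme.{u}} [IsIntegral X] {f : X ⟶ Spec (.of K)}
  {k : Type u} [Field k] [Algebra k K] {r : ℕ} {x : X}

theorem IsLocalParam.ne_zero {z : O f x} (hz : IsLocalParam f x z) : (z : FF f) ≠ 0 :=
  fun h => hz.1 (Subtype.ext h)

/-- The functional is the derivation `∂/∂z` relative to `K`: a vector dual to `dz` in the relative
forms, composed with `relMap`. It is integral on regular forms because `dz` generates `ω` at `x`. -/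
theorem exists_dual_param [SmoothOfRelativeDimension 1 f] (hx : IsRational f x) {z : O f x}
    (hz : IsLocalParam f x z) :
    ∃ l : Ω[FF f⁄k] →ₗ[FF f] FF f, l (D k (FF f) (z : FF f)) = 1 ∧
      (∀ w ∈ baseForms f k x, l w = 0) ∧ (∀ w ∈ regForms f k x, l w ∈ O f x) ∧
      ∀ c : K, l (D k (FF f) (algebraMap K (FF f) c)) = 0 := by
  obtain ⟨l, hl⟩ := Module.Projective.exists_dual_eq_one (FF f) (D_param_ne_zero hx hz)
  refine ⟨l ∘ₗ relMap f k, ?_, fun w hw => ?_, fun w hw => ?_, fun c => ?_⟩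
  · rw [LinearMap.comp_apply, relMap_D, hl]
  · rw [LinearMap.comp_apply, relMap_baseForms hw, map_zero]
  · obtain ⟨h, hh⟩ := (mem_regForms_iff_param hx hz).1 (relMap_regForms hw)
    rw [LinearMap.comp_apply, hh, map_smul, hl, smul_eq_mul, mul_one]
    exact h.2
  · rw [LinearMap.comp_apply, relMap_const, map_zero]

theorem D_inv_pow (z : FF f) (hz : z ≠ 0) (n : ℕ) :
    D k (FF f) (z ^ n)⁻¹ = (-(n : FF f) * (z ^ (n + 1))⁻¹) • D k (FF f) z := by
  rw [Derivation.leibniz_inv, Derivation.leibniz_pow, ← Nat.cast_smul_eq_nsmul (FF f), smul_smul,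
    smul_smul]
  congr 1
  rcases n with _ | n
  · simp
  · rw [Nat.add_sub_cancel]
    field_simp
    ring

/-- For `η = a dc` one has `dη = da ∧ dc`, and the contraction is `l(da) dc` because `l` kills `dc`.
-/
theorem contract_extDeriv_baseForms (l : Ω[FF f⁄k] →ₗ[FF f] FF f)
    (hl : ∀ w ∈ baseForms f k x, l w = 0) (hl' : ∀ w ∈ regForms f k x, l w ∈ O f x)
    {η : Ω[FF f⁄k]} (hη : η ∈ baseForms f k x) :
    contract k (FF f) l (extDeriv k (FF f) η) ∈ regForms f k x := by
  induction hη using Submodule.span_induction with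
  | mem w hw => obtain ⟨c, rfl⟩ := hw; rw [extDeriv_D, map_zero]; exact zero_mem _
  | zero => rw [map_zero, map_zero]; exact zero_mem _
  | add w w' _ _ h h' => rw [map_add, map_add]; exact add_mem h h'
  | smul a w hw h =>
    rw [O_smul, extDeriv_smul, map_add, contract_wedge, map_smul, hl w hw, zero_smul, sub_zero]
    exact add_mem (smul_mem_regForms (hl' _ (D_mem f k x a)) (baseForms_le f k x hw))
      (smul_mem_regForms a.2 h)

/-- The polar part of the vanishing of the vertical curvature. -/
theorem commutator_regular [SmoothOfRelativeDimension 1 f] (hx : IsRational f x) {z : O f x}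
    (hz : IsLocalParam f x z) {m n : ℕ} (hmn : n ≤ m) {A : Matrix (Fin r) (Fin r) (Ω[FF f⁄k])}
    {g : Matrix (Fin r) (Fin r) (FF f)} {η : Matrix (Fin r) (Fin r) (Ω[FF f⁄k])}
    (hA : Shape x (z : FF f) m n A g η)
    (hcurv : ∀ i j, extDeriv k (FF f) (A i j) + ∑ l, wedge k (FF f) (A i l) (A l j) ∈
      baseForms2 k (FF f) K) :
    RegM x (((z : FF f) ^ n)⁻¹ • (lm g η - rm η g) -
      ((n : FF f) * (z : FF f) ^ m * ((z : FF f) ^ (n + 1))⁻¹) • η) := by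
  intro i j
  obtain ⟨hg, hη, hA⟩ := hA
  obtain ⟨l, hlz, hlb, hlr, hlc⟩ := exists_dual_param (k := k) hx hz
  have hz0 := hz.ne_zero
  set ζ : FF f := (z : FF f) with hζ
  -- The contracted curvature is zero, since two-forms from the base are killed; its quadratic and
  -- linear parts are computed separately.
  have hc := contract_baseForms2 k (FF f) K l hlc (hcurv i j)
  have hAij : ∀ i j, A i j = (ζ ^ m)⁻¹ • g i j • D k (FF f) ζ + (ζ ^ n)⁻¹ • η i j := fun i j => by
    rw [hA]; rfl
  have hlA : ∀ i j, l (A i j) = (ζ ^ m)⁻¹ * g i j := fun i j => by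
    rw [hAij, map_add, map_smul, map_smul, map_smul, hlz, hlb _ (hη i j)]
    simp
  -- The contraction of `A ∧ A` is `z⁻ᵐ [g, A]`. The `dz` part of `A` commutes with `g`, so only
  -- `[g, η]` is left.
  have hquad : contract k (FF f) l (∑ l, wedge k (FF f) (A i l) (A l j)) =
      (ζ ^ m)⁻¹ • (ζ ^ n)⁻¹ • (lm g η - rm η g) i j := by
    rw [map_sum]
    simp only [contract_wedge, hlA]
    have h1 : ∑ y, (((ζ ^ m)⁻¹ * g i y) • A y j - ((ζ ^ m)⁻¹ * g y j) • A i y) =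
        (ζ ^ m)⁻¹ • (lm g A - rm A g) i j := by
      rw [Matrix.sub_apply, lm_apply, rm_apply, ← Finset.sum_sub_distrib, Finset.smul_sum]
      exact Finset.sum_congr rfl fun y _ => by rw [smul_sub, mul_smul, mul_smul]
    have h2 : lm g A - rm A g = (ζ ^ n)⁻¹ • (lm g η - rm η g) := by
      rw [hA]
      simp only [map_add, map_smul, LinearMap.add_apply, LinearMap.smul_apply, lm_fm, rm_fm]
      module
    rw [h1, h2]
    rfl
  -- The term with `-n` is the derivative of the factor `z⁻ⁿ` in front of `η`. The derivative of
  -- `z⁻ᵐ` contributes nothing, because `dz ∧ dz = 0`.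
  have hlin : contract k (FF f) l (extDeriv k (FF f) (A i j)) =
      (ζ ^ m)⁻¹ • (l (D k (FF f) (g i j)) • D k (FF f) ζ - D k (FF f) (g i j)) +
      ((-(n : FF f) * (ζ ^ (n + 1))⁻¹) • η i j +
        (ζ ^ n)⁻¹ • contract k (FF f) l (extDeriv k (FF f) (η i j))) := by
    rw [hAij, map_add, map_add, extDeriv_smul, extDeriv_smul_D, extDeriv_smul, map_add, map_add,
      D_inv_pow ζ hz0, D_inv_pow ζ hz0]
    simp only [map_smul, LinearMap.smul_apply, contract_wedge, hlz, hlb _ (hη i j), wedge_self,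
      smul_zero, map_zero, zero_add, one_smul, zero_smul, sub_zero]
  rw [map_add, hquad, hlin] at hc
  have hr1 : l (D k (FF f) (g i j)) • D k (FF f) ζ - D k (FF f) (g i j) ∈ regForms f k x :=
    sub_mem (smul_mem_regForms (hlr _ (D_mem f k x ⟨_, hg i j⟩)) (D_mem f k x z))
      (D_mem f k x ⟨_, hg i j⟩)
  have hr2 := contract_extDeriv_baseForms l hlb hlr (hη i j)
  set ρ₁ := l (D k (FF f) (g i j)) • D k (FF f) ζ - D k (FF f) (g i j)
  set ρ₂ := contract k (FF f) l (extDeriv k (FF f) (η i j))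
  have hzm : ζ ^ m ≠ 0 := pow_ne_zero _ hz0
  -- After multiplication by `z ^ m`, every term other than the commutator and the `-n` term is
  -- regular, because `n ≤ m`.
  have h3 := congrArg (ζ ^ m • ·) hc
  simp only [smul_zero, smul_add, smul_smul, mul_inv_cancel₀ hzm, one_smul, ← mul_assoc,
    one_mul] at h3
  have hzmn : ζ ^ m * (ζ ^ n)⁻¹ = ζ ^ (m - n) := by
    rw [pow_sub₀ _ hz0 hmn]
  have h4 : (((ζ : FF f) ^ n)⁻¹ • (lm g η - rm η g) -
      ((n : FF f) * (ζ : FF f) ^ m * ((ζ : FF f) ^ (n + 1))⁻¹) • η) i j =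
      -ρ₁ - ζ ^ (m - n) • ρ₂ := by
    rw [hzmn] at h3
    have e : (((ζ : FF f) ^ n)⁻¹ • (lm g η - rm η g) -
      ((n : FF f) * (ζ : FF f) ^ m * ((ζ : FF f) ^ (n + 1))⁻¹) • η) i j =
      ((ζ : FF f) ^ n)⁻¹ • (lm g η - rm η g) i j -
      ((n : FF f) * (ζ : FF f) ^ m * ((ζ : FF f) ^ (n + 1))⁻¹) • η i j := rfl
    rw [e]
    have e2 : (n : FF f) * ζ ^ m * (ζ ^ (n + 1))⁻¹ = -(ζ ^ m * -(n : FF f) * (ζ ^ (n + 1))⁻¹) := by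
      ring
    rw [e2, neg_smul, sub_neg_eq_add, ← sub_eq_zero, ← h3]
    abel
  rw [h4]
  exact sub_mem (neg_mem hr1) (smul_mem_regForms (pow_mem z.2 _) hr2)

/-- The shape of the connection matrix in another basis. -/
theorem Shape.gauge [SmoothOfRelativeDimension 1 f] (hx : IsRational f x) {z : O f x}
    (hz : IsLocalParam f x z) {m n : ℕ} {A : Matrix (Fin r) (Fin r) (Ω[FF f⁄k])}
    {g : Matrix (Fin r) (Fin r) (FF f)} {η : Matrix (Fin r) (Fin r) (Ω[FF f⁄k])}
    (hA : Shape x (z : FF f) m n A g η) {φ : Matrix (Fin r) (Fin r) (FF f)} (hφ : IsGLInt x φ) :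
    ∃ (τ : Matrix (Fin r) (Fin r) (FF f)) (ψ η' : Matrix (Fin r) (Fin r) (Ω[FF f⁄k])),
      IntM x τ ∧ BaseM x ψ ∧ rm (dM φ) φ⁻¹ = fm τ (D k (FF f) (z : FF f)) + ψ ∧
      Shape x (z : FF f) m n (gauge φ A) (φ⁻¹ * (g + (z : FF f) ^ m • τ) * φ) η' := by
  have hz0 := hz.ne_zero
  have hdφ : RegM x (rm (dM (k := k) φ) φ⁻¹) := (RegM.dM hφ.int).rm hφ.inv_int
  -- Each entry of the regular matrix `dφ φ⁻¹` splits into a multiple of `dz` and a base form. Put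
  -- over the denominators `z ^ m` and `z ^ n`, these parts are added to `g` and `η` before
  -- conjugation by `φ`.
  choose τ ψ hψ h using fun i j => mem_regForms_param hx hz (hdφ i j)
  let T : Matrix (Fin r) (Fin r) (FF f) := Matrix.of fun i j => (τ i j : FF f)
  let Ψ : Matrix (Fin r) (Fin r) (Ω[FF f⁄k]) := Matrix.of ψ
  have hT : IntM x T := fun i j => (τ i j).2
  have hΨ : BaseM x Ψ := hψ
  have hθ : rm (dM φ) φ⁻¹ = fm T (D k (FF f) (z : FF f)) + Ψ := by
    ext i j
    exact h i j
  refine ⟨T, Ψ, lm φ⁻¹ (rm (η + (z : FF f) ^ n • Ψ) φ), hT, hΨ, hθ, ?_, ?_, ?_⟩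
  · exact (hφ.inv_int.mul (hA.1.add (hT.smul (pow_mem z.2 m)))).mul hφ.int
  · exact BaseM.lm hφ.inv_int (BaseM.rm (hA.2.1.add (hΨ.smul (pow_mem z.2 n))) hφ.int)
  · have h1 : RelAD.gauge φ A = lm φ⁻¹ (rm (A + rm (dM φ) φ⁻¹) φ) := by
      rw [RelAD.gauge, map_add rm, LinearMap.add_apply, rm_rm, hφ.inv_mul, rm_one]
    have hzm : ((z : FF f) ^ m)⁻¹ * (z : FF f) ^ m = 1 := inv_mul_cancel₀ (pow_ne_zero _ hz0)
    have hzn : ((z : FF f) ^ n)⁻¹ * (z : FF f) ^ n = 1 := inv_mul_cancel₀ (pow_ne_zero _ hz0)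
    have h2 : A + rm (dM φ) φ⁻¹ = ((z : FF f) ^ m)⁻¹ •
        fm (g + (z : FF f) ^ m • T) (D k (FF f) (z : FF f)) +
        ((z : FF f) ^ n)⁻¹ • (η + (z : FF f) ^ n • Ψ) := by
      rw [hθ, hA.2.2]
      simp only [map_add, map_smul, LinearMap.add_apply, LinearMap.smul_apply, smul_add, smul_smul,
        hzm, hzn, one_smul]
      abel
    rw [h1, h2]
    generalize g + (z : FF f) ^ m • T = γ
    generalize η + (z : FF f) ^ n • Ψ = η'
    rw [map_add rm, LinearMap.add_apply, map_add]
    simp only [map_smul, LinearMap.smul_apply, rm_fm, lm_fm, Matrix.mul_assoc]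

theorem trW_fm_fm (G H : Matrix (Fin r) (Fin r) (FF f)) (w : Ω[FF f⁄k]) :
    trW k (FF f) K (fm G w) (fm H w) = 0 := by
  rw [trW_apply]
  refine Finset.sum_eq_zero fun i _ => Finset.sum_eq_zero fun j _ => ?_
  rw [fm_apply, fm_apply, map_smul, map_smul, LinearMap.smul_apply, wedgeRel_self, smul_zero,
    smul_zero]

theorem Shape.pow_smul_regM {z : O f x} (hz0 : (z : FF f) ≠ 0) {m n : ℕ} (hmn : n ≤ m)
    {A : Matrix (Fin r) (Fin r) (Ω[FF f⁄k])}
    {g : Matrix (Fin r) (Fin r) (FF f)} {η : Matrix (Fin r) (Fin r) (Ω[FF f⁄k])}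
    (hA : Shape x (z : FF f) m n A g η) : RegM x ((z : FF f) ^ m • A) := by
  rw [hA.2.2, smul_add, smul_smul, smul_smul, mul_inv_cancel₀ (pow_ne_zero _ hz0), one_smul,
    ← pow_sub₀ _ hz0 hmn]
  exact (RegM.fm hA.1 (D_mem f k x z)).add (hA.2.1.regM.smul (pow_mem z.2 _))

/-- The difference of `dγ γ⁻¹ + γ θ γ⁻¹ - θ` and `dg g⁻¹` for `γ = g + z ^ m τ`, up to a
multiple of `z ^ m`. -/
theorem exists_log_difference {z : O f x} {m : ℕ}
    {g τ : Matrix (Fin r) (Fin r) (FF f)} (hg : IsGLInt x g) (hτ : IntM x τ)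
    (hγ : IsGLInt x (g + (z : FF f) ^ m • τ))
    {θ : Matrix (Fin r) (Fin r) (Ω[FF f⁄k])} (hθ : RegM x θ) :
    ∃ Y : Matrix (Fin r) (Fin r) (Ω[FF f⁄k]), RegM x Y ∧
      rm (dM (g + (z : FF f) ^ m • τ)) (g + (z : FF f) ^ m • τ)⁻¹ +
        lm (g + (z : FF f) ^ m • τ) (rm θ (g + (z : FF f) ^ m • τ)⁻¹) - θ - rm (dM g) g⁻¹ =
      ((m : FF f) * (z : FF f) ^ (m - 1)) • fm (τ * g⁻¹) (D k (FF f) (z : FF f)) +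
        (lm g (rm θ g⁻¹) - θ) + (z : FF f) ^ m • Y := by
  set ζ : FF f := (z : FF f) with hζ
  set γ := g + ζ ^ m • τ with hγdef
  -- From `γ⁻¹ - g⁻¹ = -γ⁻¹ (γ - g) g⁻¹`, where `γ - g = z ^ m τ`.
  let ρ : Matrix (Fin r) (Fin r) (FF f) := -(γ⁻¹ * τ * g⁻¹)
  have hρ : IntM x ρ := ((hγ.inv_int.mul hτ).mul hg.inv_int).neg
  have hinv : γ⁻¹ = g⁻¹ + ζ ^ m • ρ := by
    have h1 : ζ ^ m • τ = γ - g := by rw [hγdef, add_sub_cancel_left]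
    have h2 : ζ ^ m • ρ = -(γ⁻¹ * (γ - g) * g⁻¹) := by
      rw [← h1, Matrix.mul_smul, Matrix.smul_mul, smul_neg]
    rw [h2, Matrix.mul_sub, Matrix.sub_mul, hγ.inv_mul, Matrix.one_mul, Matrix.mul_assoc,
      hg.mul_inv, Matrix.mul_one]
    abel
  -- Differentiating `z ^ m` loses one power of `z`; this is the source of the only new term that is
  -- not a multiple of `z ^ m`, apart from the conjugation of `θ`.
  have hdγ : dM (k := k) γ = dM g + (ζ ^ m • dM τ +
      ((m : FF f) * ζ ^ (m - 1)) • fm τ (D k (FF f) ζ)) := by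
    rw [hγdef, map_add, dM_smul, Derivation.leibniz_pow, ← Nat.cast_smul_eq_nsmul (FF f),
      smul_smul, map_smul]
  refine ⟨rm (dM γ) ρ + rm (dM τ) g⁻¹ + lm τ (rm θ γ⁻¹) + lm g (rm θ ρ), ?_, ?_⟩
  · exact (((RegM.dM hγ.int).rm hρ).add ((RegM.dM hτ).rm hg.inv_int)).add
      (RegM.lm hτ (hθ.rm hγ.inv_int)) |>.add (RegM.lm hg.int (hθ.rm hρ))
  · have e1 : rm (dM (k := k) γ) γ⁻¹ = rm (dM γ) g⁻¹ + ζ ^ m • rm (dM γ) ρ := by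
      conv_lhs => rw [hinv]
      rw [map_add, map_smul]
    have e2 : rm (dM (k := k) γ) g⁻¹ = rm (dM g) g⁻¹ + (ζ ^ m • rm (dM τ) g⁻¹ +
        ((m : FF f) * ζ ^ (m - 1)) • fm (τ * g⁻¹) (D k (FF f) ζ)) := by
      rw [hdγ, map_add, map_add, map_smul, map_smul, LinearMap.add_apply, LinearMap.add_apply,
        LinearMap.smul_apply, LinearMap.smul_apply, rm_fm]
    have e3 : lm γ (rm θ γ⁻¹) = lm g (rm θ g⁻¹) + ζ ^ m • lm g (rm θ ρ) +
        ζ ^ m • lm τ (rm θ γ⁻¹) := by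
      have : lm γ (rm θ γ⁻¹) = lm g (rm θ γ⁻¹) + ζ ^ m • lm τ (rm θ γ⁻¹) := by
        conv_lhs => rw [hγdef]
        rw [map_add, map_smul, LinearMap.add_apply, LinearMap.smul_apply]
      rw [this]
      congr 1
      conv_lhs => rw [hinv]
      rw [map_add, map_smul, map_add, map_smul]
    rw [e1, e2, e3]
    simp only [smul_add]
    abel

/-- A change of basis of `E` at a point of `𝔇` changes `Tr(dg g⁻¹ A)` by a regular form. -/
theorem trD_gauge_sub_mem [SmoothOfRelativeDimension 1 f] (hx : IsRational f x) {z : O f x}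
    (hz : IsLocalParam f x z) {m n : ℕ} (hmn : n + 1 = m ∨ (m = 1 ∧ n = 1))
    {A : Matrix (Fin r) (Fin r) (Ω[FF f⁄k])}
    {g : Matrix (Fin r) (Fin r) (FF f)} {η : Matrix (Fin r) (Fin r) (Ω[FF f⁄k])}
    (hA : Shape x (z : FF f) m n A g η)
    (hcurv : ∀ i j, extDeriv k (FF f) (A i j) + ∑ l, wedge k (FF f) (A i l) (A l j) ∈
      baseForms2 k (FF f) K) (hg : IsGLInt x g)
    {φ τ : Matrix (Fin r) (Fin r) (FF f)} (hφ : IsGLInt x φ)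
    {ψ : Matrix (Fin r) (Fin r) (Ω[FF f⁄k])} (hτ : IntM x τ) (hψ : BaseM x ψ)
    (hθ : rm (dM φ) φ⁻¹ = fm τ (D k (FF f) (z : FF f)) + ψ)
    (hγ : IsGLInt x (g + (z : FF f) ^ m • τ)) :
    trD k (φ⁻¹ * (g + (z : FF f) ^ m • τ) * φ) (gauge φ A) - trD k g A ∈ regForms2 f k x := by
  have hz0 := hz.ne_zero
  have hle : n ≤ m := by omega
  have hC := commutator_regular hx hz hle hA hcurv
  have hP := hA.pow_smul_regM hz0 hle
  have hθr : RegM x (rm (dM (k := k) φ) φ⁻¹) := (RegM.dM hφ.int).rm hφ.inv_int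
  obtain ⟨Y, hY, hW⟩ := exists_log_difference (k := k) hg hτ hγ hθr
  rw [trD_conj hφ hγ, trD]
  set θ := rm (dM (k := k) φ) φ⁻¹ with hθdef
  set γ := g + (z : FF f) ^ m • τ with hγdef
  set L := rm (dM γ) γ⁻¹ + lm γ (rm θ γ⁻¹) - θ with hL
  have hLr : RegM x L := (((RegM.dM hγ.int).rm hγ.inv_int).add
    (RegM.lm hγ.int (hθr.rm hγ.inv_int))).sub hθr
  clear_value L
  set dz := D k (FF f) (z : FF f) with hdz
  have hdzr : dz ∈ regForms f k x := D_mem f k x z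
  -- The product of `L` and `θ` is regular, so only the pairing of `L - dg g⁻¹` with the polar
  -- matrix `A` matters.
  have e0 : trW k (FF f) K L (A + θ) - trW k (FF f) K (rm (dM g) g⁻¹) A =
      trW k (FF f) K L θ + trW k (FF f) K (L - rm (dM g) g⁻¹) A := by
    rw [map_add, map_sub, LinearMap.sub_apply]
    abel
  have e1 : trW k (FF f) K ((z : FF f) ^ m • Y) A = trW k (FF f) K Y ((z : FF f) ^ m • A) := by
    rw [map_smul, map_smul, LinearMap.smul_apply]
  -- The `dz` part of `A` drops out against `dz`, so the pole has order at most `n`.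
  have e2 : trW k (FF f) K (fm (τ * g⁻¹) dz) A =
      ((z : FF f) ^ n)⁻¹ • trW k (FF f) K (fm τ dz) (lm g⁻¹ η) := by
    rw [hA.2.2, map_add, map_smul, trW_fm_fm, smul_zero, zero_add, map_smul, ← rm_fm, trW_rm]
  -- Cyclicity moves the conjugation from `θ` to `A`, where it becomes the commutator with `g`.
  have e3 : trW k (FF f) K (lm g (rm θ g⁻¹) - θ) A =
      -(trW k (FF f) K θ (lm g⁻¹ (((z : FF f) ^ n)⁻¹ • (lm g η - rm η g)))) := by
    have h1 : lm g A - rm A g = ((z : FF f) ^ n)⁻¹ • (lm g η - rm η g) := by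
      rw [hA.2.2]
      simp only [map_add, map_smul, LinearMap.add_apply, LinearMap.smul_apply, lm_fm, rm_fm]
      module
    rw [← h1, map_sub, LinearMap.sub_apply, trW_lm, trW_rm, map_sub, map_sub, lm_lm, hg.inv_mul,
      one_lm]
    abel
  rw [e0, hW, map_add, map_add, LinearMap.add_apply, LinearMap.add_apply, e1, map_smul,
    LinearMap.smul_apply, e2, e3]
  refine add_mem (hLr.trW hθr) (add_mem ?_ (hY.trW hP))
  have hη : RegM x (lm g⁻¹ η) := RegM.lm hg.inv_int hA.2.1.regM
  rcases hmn with rfl | ⟨rfl, rfl⟩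
  -- Here `m - 1 = n`: the factor `z ^ (m - 1)` cancels the pole of the first term, and the
  -- commutator divided by `z ^ n` is regular since it differs from a regular matrix by `n η`.
  · have hzn : (z : FF f) ^ n ≠ 0 := pow_ne_zero _ hz0
    refine add_mem ?_ (neg_mem (hθr.trW (RegM.lm hg.inv_int ?_)))
    · rw [Nat.add_sub_cancel, smul_smul, mul_assoc, mul_inv_cancel₀ hzn, mul_one]
      exact smul_mem_regForms2 (natCast_mem _ _) ((RegM.fm hτ hdzr).trW hη)
    · rw [mul_assoc, mul_inv_cancel₀ (pow_ne_zero _ hz0), mul_one] at hC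
      have := hC.add (hA.2.1.regM.smul (natCast_mem (O f x) n))
      rwa [sub_add_cancel] at this
  -- Here `m = n = 1`: modulo regular forms the commutator term is `-Tr(θ ∧ g⁻¹ η) / z`. Its `ψ`
  -- part is zero modulo `Ω²_K`, and its `τ dz` part cancels the first term.
  · have hz' : (z : FF f) ^ (1 : ℕ) * ((z : FF f) ^ (1 + 1))⁻¹ = ((z : FF f) ^ 1)⁻¹ := by
      field_simp
    rw [Nat.cast_one, one_mul, hz'] at hC
    set R := ((z : FF f) ^ 1)⁻¹ • (lm g η - rm η g) - ((z : FF f) ^ 1)⁻¹ • η with hR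
    have e4 : ((z : FF f) ^ 1)⁻¹ • (lm g η - rm η g) = ((z : FF f) ^ 1)⁻¹ • η + R := by
      rw [hR]; abel
    have e5 : trW k (FF f) K ψ (lm g⁻¹ η) = 0 := hψ.trW (BaseM.lm hg.inv_int hA.2.1)
    have e6 : trW k (FF f) K θ (lm g⁻¹ η) = trW k (FF f) K (fm τ dz) (lm g⁻¹ η) := by
      rw [hθ, map_add, LinearMap.add_apply, e5, add_zero]
    have e7 : (((1 : ℕ) : FF f) * (z : FF f) ^ (1 - 1)) = 1 := by simp
    rw [e4, map_add (lm g⁻¹), map_smul, map_add, map_smul, e6, e7, one_smul, neg_add,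
      add_neg_cancel_left]
    exact neg_mem (hθr.trW (RegM.lm hg.inv_int hC))

end LocalIndependence

/-! ### Change of basis of a connection -/

section ChangeOfBasis

variable {K : Type u} [Field K] {X : Scheme.{u}} [IsIntegral X] {f : X ⟶ Spec (.of K)}
  {k : Type u} [Field k] [Algebra k K] {r : ℕ} {x : X}
  {V : Type v} [AddCommGroup V] [Module (FF f) V]

theorem toMatrix_inv (e e' : Module.Basis (Fin r) (FF f) V) :
    (e.toMatrix e')⁻¹ = e'.toMatrix e :=
  Matrix.inv_eq_left_inv (Module.Basis.toMatrix_mul_toMatrix_flip e' e)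

theorem toMatrix_det_isUnit (e e' : Module.Basis (Fin r) (FF f) V) :
    IsUnit (e.toMatrix e').det :=
  Matrix.isUnit_det_of_left_inverse (Module.Basis.toMatrix_mul_toMatrix_flip e' e)

theorem repr_mem_of_mem_span (e : Module.Basis (Fin r) (FF f) V) {v : V}
    (hv : v ∈ Submodule.span (O f x) (Set.range e)) (i : Fin r) : e.repr v i ∈ O f x := by
  induction hv using Submodule.span_induction with
  | mem v hv =>
    obtain ⟨j, rfl⟩ := hv
    rw [Module.Basis.repr_self, Finsupp.single_apply]
    split_ifs
    · exact one_mem _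
    · exact zero_mem _
  | zero => rw [map_zero]; exact zero_mem _
  | add v w _ _ h h' => rw [map_add]; exact add_mem h h'
  | smul a v _ h =>
    have : e.repr (a • v) i = (a : FF f) * e.repr v i := by
      rw [show a • v = (a : FF f) • v from rfl, map_smul]
      rfl
    rw [this]
    exact mul_mem a.2 h

theorem Bundle.IsBasisAt.intM {E : Bundle f r V} {e e' : Module.Basis (Fin r) (FF f) V}
    (he : E.IsBasisAt x e) (he' : E.IsBasisAt x e') : IntM x (e.toMatrix e') := fun i j => by
  refine repr_mem_of_mem_span e ?_ i
  have h : Submodule.span (O f x) (Set.range e) = Submodule.span (O f x) (Set.range e') :=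
    he.symm.trans he'
  rw [h]
  exact Submodule.subset_span ⟨j, rfl⟩

theorem Bundle.IsBasisAt.isGLInt {E : Bundle f r V} {e e' : Module.Basis (Fin r) (FF f) V}
    (he : E.IsBasisAt x e) (he' : E.IsBasisAt x e') : IsGLInt x (e.toMatrix e') :=
  ⟨he.intM he', by rw [toMatrix_inv]; exact he'.intM he, toMatrix_det_isUnit e e'⟩

/-- The connection matrix in another basis is the gauge transform. -/
theorem matrix_eq_gauge (nabla : Conn f k V) (e e' : Module.Basis (Fin r) (FF f) V) :
    nabla.matrix e' = gauge (e.toMatrix e') (nabla.matrix e) := by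
  let co (b : Module.Basis (Fin r) (FF f) V) (l : Fin r) : V ⊗[FF f] Ω[FF f⁄k] →ₗ[FF f] Ω[FF f⁄k] :=
    (TensorProduct.lid (FF f) (Ω[FF f⁄k])).toLinearMap ∘ₗ (b.coord l).rTensor (Ω[FF f⁄k])
  have hco : ∀ b l v w, co b l (v ⊗ₜ w) = b.repr v l • w := fun b l v w => rfl
  -- The coordinates in `e'` are obtained from those in `e` by the inverse transition matrix; this
  -- is the factor `φ⁻¹` of the gauge transform.
  have hchange : ∀ l t, co e' l t = ∑ m, e'.toMatrix e l m • co e m t := by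
    intro l t
    induction t using TensorProduct.induction_on with
    | zero => simp
    | add a b ha hb => simp only [map_add, ha, hb, smul_add, Finset.sum_add_distrib]
    | tmul v w =>
      simp only [hco, smul_smul, ← Finset.sum_smul]
      congr 1
      conv_lhs => rw [← e.sum_repr v]
      rw [map_sum, Finsupp.finsetSum_apply]
      refine Finset.sum_congr rfl fun m _ => ?_
      rw [map_smul, Finsupp.smul_apply, smul_eq_mul, mul_comm]
      rfl
  ext l j
  rw [gauge, toMatrix_inv, lm_apply]
  have he' : e' j = ∑ i, e.toMatrix e' i j • e i := (e.sum_toMatrix_smul_self e' j).symm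
  change co e' l (nabla.toFun (e' j)) = _
  rw [hchange]
  refine Finset.sum_congr rfl fun m _ => ?_
  congr 1
  rw [he', map_sum, map_sum, Matrix.add_apply, rm_apply, dM_apply]
  simp only [nabla.leibniz, map_add, map_smul, hco, Finset.sum_add_distrib]
  congr 1
  rw [Finset.sum_eq_single m]
  · simp
  · intro i _ hi
    simp [hi]
  · simp

/-- The unit `det` of a change of basis. -/
def detUnit (e e' : Module.Basis (Fin r) (FF f) V) : (FF f)ˣ := (toMatrix_det_isUnit e e').unit

theorem detUnit_val (e e' : Module.Basis (Fin r) (FF f) V) :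
    (detUnit e e' : FF f) = (e.toMatrix e').det := rfl

theorem detUnit_mul (e e' e'' : Module.Basis (Fin r) (FF f) V) :
    detUnit e e'' = detUnit e e' * detUnit e' e'' :=
  Units.ext (by
    rw [Units.val_mul, detUnit_val, detUnit_val, detUnit_val, ← Matrix.det_mul,
      Module.Basis.toMatrix_mul_toMatrix])

theorem traceForm_eq (nabla : Conn f k V) (e : Module.Basis (Fin r) (FF f) V) :
    nabla.traceForm e = trM (nabla.matrix e) := rfl

/-- The trace of the gauge transform exceeds `Tr A` by `Tr(φ⁻¹ dφ)`, which is `dlog det φ` by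
Jacobi's formula. It is the compatibility required of the cocycle of `(det E, det ∇)`. -/
theorem dlog_detUnit (nabla : Conn f k V) (e e' : Module.Basis (Fin r) (FF f) V) :
    dlog k (FF f) (detUnit e e') = nabla.traceForm e' - nabla.traceForm e := by
  have hu := toMatrix_det_isUnit e e'
  rw [traceForm_eq, traceForm_eq, matrix_eq_gauge nabla e e', gauge, map_add, map_add, trM_comm,
    rm_rm, Matrix.mul_nonsing_inv _ hu, rm_one, add_sub_cancel_left, dlog, detUnit_val,
    D_det _ hu.ne_zero, smul_smul, Units.val_inv_eq_inv_val, detUnit_val,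
    inv_mul_cancel₀ hu.ne_zero, one_smul]

theorem dlog_mem_regForms {p : (FF f)ˣ} (hp : (p : FF f) ∈ O f x)
    (hp' : ((p⁻¹ : (FF f)ˣ) : FF f) ∈ O f x) : dlog k (FF f) p ∈ regForms f k x :=
  smul_mem_regForms hp' (D_mem f k x ⟨_, hp⟩)

theorem Bundle.IsBasisAt.detUnit_mem {E : Bundle f r V} {e e' : Module.Basis (Fin r) (FF f) V}
    (he : E.IsBasisAt x e) (he' : E.IsBasisAt x e') :
    (detUnit e e' : FF f) ∈ O f x ∧ (((detUnit e e')⁻¹ : (FF f)ˣ) : FF f) ∈ O f x := by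
  have h : (detUnit e e')⁻¹ = detUnit e' e := by
    rw [inv_eq_iff_mul_eq_one, ← detUnit_mul]
    exact Units.ext (by rw [detUnit_val, Module.Basis.toMatrix_self, Matrix.det_one]; rfl)
  rw [h]
  exact ⟨(he.intM he').det, (he'.intM he).det⟩

theorem Bundle.IsBasisAt.traceForm_sub_mem {E : Bundle f r V}
    {e e' : Module.Basis (Fin r) (FF f) V} (nabla : Conn f k V)
    (he : E.IsBasisAt x e) (he' : E.IsBasisAt x e') :
    nabla.traceForm e' - nabla.traceForm e ∈ regForms f k x := by
  rw [← dlog_detUnit]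
  exact dlog_mem_regForms (he.detUnit_mem he').1 (he.detUnit_mem he').2

end ChangeOfBasis

/-! ### The local structure at the points of `𝔇` -/

section LocalStructure

variable {K : Type u} [Field K] {X : Scheme.{u}} [IsIntegral X] {f : X ⟶ Spec (.of K)}
  {k : Type u} [Field k] [Algebra k K] {r : ℕ} {x : X}
  {V : Type v} [AddCommGroup V] [Module (FF f) V] {𝔇 : X →₀ ℕ}

theorem isGLInt_of_isUnit {g : Matrix (Fin r) (Fin r) (O f x)} (hg : IsUnit g) :
    IsGLInt x (g.map (O f x).subtype) := by
  have hint : IntM x (g.map (O f x).subtype) := fun i j => (g i j).2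
  rw [isGLInt_iff_det hint]
  have h : (⟨(g.map (O f x).subtype).det, hint.det⟩ : O f x) = g.det :=
    Subtype.ext (RingHom.map_det (O f x).subtype g).symm
  rw [h]
  exact (Matrix.isUnit_iff_isUnit_det g).1 hg

/-- A determinant that is invertible modulo an ideal inside the maximal ideal is itself a unit. This
turns the isomorphism of the polar part on `E|_𝔇` into `g ∈ GL_r(𝒪_x)`. -/
theorem isUnit_of_isUnit_map_mk {g : Matrix (Fin r) (Fin r) (O f x)} {I : Ideal (O f x)}
    (hI : I ≤ IsLocalRing.maximalIdeal (O f x)) (hg : IsUnit (g.map (Ideal.Quotient.mk I))) :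
    IsUnit g := by
  rw [Matrix.isUnit_iff_isUnit_det] at hg ⊢
  rw [← RingHom.mapMatrix_apply, ← RingHom.map_det] at hg
  by_contra h
  obtain ⟨a, ha⟩ := Ideal.Quotient.mk_surjective hg.unit⁻¹.val
  have h1 : Ideal.Quotient.mk I (g.det * a) = 1 := by
    rw [map_mul, ha]
    exact hg.mul_val_inv
  have h2 : g.det * a - 1 ∈ IsLocalRing.maximalIdeal (O f x) := by
    apply hI
    rw [← Ideal.Quotient.eq_zero_iff_mem, map_sub, h1, map_one, sub_self]
  have h3 : g.det * a ∈ IsLocalRing.maximalIdeal (O f x) := Ideal.mul_mem_right _ _ h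
  have h4 : (1 : O f x) ∈ IsLocalRing.maximalIdeal (O f x) := by
    have := sub_mem h3 h2
    rwa [sub_sub_cancel] at this
  exact h4 isUnit_one

theorem HasPolarShape.shape {A : Matrix (Fin r) (Fin r) (Ω[FF f⁄k])} {z : O f x} {m n : ℕ}
    {g : Matrix (Fin r) (Fin r) (O f x)} (h : HasPolarShape x A z m n g) :
    ∃ η, Shape x (z : FF f) m n A (g.map (O f x).subtype) η := by
  obtain ⟨η, hη, hA⟩ := h
  refine ⟨η, fun i j => (g i j).2, hη, ?_⟩
  ext i j
  rw [hA, div_eq_inv_mul, mul_smul]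
  rfl

/-- The connection matrices at a point of `𝔇`, in all local bases. -/
theorem exists_local_structure [SmoothOfRelativeDimension 1 f] {E : Bundle f r V}
    {nabla : Conn f k V} (hvert : nabla.IsVertical r) (hadm : IsPseudoAdmissible 𝔇 E nabla)
    (hx : IsRational f x) (hm : 𝔇 x ≠ 0) :
    ∃ z : O f x, IsLocalParam f x z ∧ ∃ n : ℕ, (n + 1 = 𝔇 x ∨ (𝔇 x = 1 ∧ n = 1)) ∧
      ∃ τ : RelForms2 k (FF f) K, ∀ e, E.IsBasisAt x e → ∃ g η,
        Shape x (z : FF f) (𝔇 x) n (nabla.matrix e) g η ∧ IsGLInt x g ∧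
        trD k g (nabla.matrix e) - τ ∈ regForms2 f k x := by
  -- Pseudo-admissibility provides the polar shape in one basis only; the gauge transform carries it
  -- to all others, and the value of the trace in this basis serves as `τ`.
  have h0 : ∃ e, E.IsBasisAt x e ∧ ∃ z : O f x, IsLocalParam f x z ∧ ∃ n : ℕ,
      (n + 1 = 𝔇 x ∨ (𝔇 x = 1 ∧ n = 1)) ∧ ∃ g η,
        Shape x (z : FF f) (𝔇 x) n (nabla.matrix e) g η ∧ IsGLInt x g := by
    rcases Nat.lt_or_ge (𝔇 x) 2 with h | h
    · have h1 : 𝔇 x = 1 := by omega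
      obtain ⟨e, he, z, hz, g, hg, hu⟩ := hadm.pseudoLog x h1
      obtain ⟨η, hη⟩ := hg.shape
      exact ⟨e, he, z, hz, 1, Or.inr ⟨h1, rfl⟩, _, η, h1 ▸ hη, isGLInt_of_isUnit hu⟩
    · obtain ⟨e, he, z, hz, g, hg, hu⟩ := hadm.admissible x h
      obtain ⟨η, hη⟩ := hg.shape
      exact ⟨e, he, z, hz, 𝔇 x - 1, Or.inl (by omega), _, η, hη, isGLInt_of_isUnit
        (isUnit_of_isUnit_map_mk (Ideal.pow_le_self hm) hu)⟩
  obtain ⟨e, he, z, hz, n, hn, g, η, hA, hg⟩ := h0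
  refine ⟨z, hz, n, hn, trD k g (nabla.matrix e), fun e' he' => ?_⟩
  have hφ := he.isGLInt he'
  obtain ⟨τ, ψ, η', hτ, hψ, hθ, hA'⟩ := hA.gauge hx hz hφ
  -- As `m ≥ 1`, the correction `z ^ m τ` vanishes in the residue field and does not affect
  -- invertibility.
  have hγ : IsGLInt x (g + (z : FF f) ^ 𝔇 x • τ) := by
    refine hg.congr (hg.int.add (hτ.smul (pow_mem z.2 _))) fun i j =>
      ⟨z ^ 𝔇 x * ⟨τ i j, hτ i j⟩, Ideal.mul_mem_right _ _ ?_, rfl⟩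
    rw [hz.2]
    exact Ideal.pow_mem_of_mem _ (Ideal.mem_span_singleton_self z) _ (Nat.pos_of_ne_zero hm)
  rw [matrix_eq_gauge nabla e e']
  exact ⟨_, η', hA', (hφ.inv.mul hγ).mul hφ,
    trD_gauge_sub_mem hx hz hn hA (hvert e) hg hφ hτ hψ hθ hγ⟩

/-- The connection form of the determinant is a section of `Ω¹{𝔇}`. -/
theorem traceForm_inOmegaBrace [SmoothOfRelativeDimension 1 f] {E : Bundle f r V}
    {nabla : Conn f k V} (hvert : nabla.IsVertical r) (hadm : IsPseudoAdmissible 𝔇 E nabla)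
    (hx : 𝔇 x ≠ 0 → IsRational f x) {e : Module.Basis (Fin r) (FF f) V} (he : E.IsBasisAt x e) :
    InOmegaBrace f 𝔇 k x (nabla.traceForm e) := by
  by_cases hm : 𝔇 x = 0
  · refine Or.inl ⟨hm, ?_⟩
    obtain ⟨e', he', hreg⟩ := hadm.regular x hm
    have h1 := he'.traceForm_sub_mem nabla he
    have h2 : nabla.traceForm e' ∈ regForms f k x := RegM.trM (P := nabla.matrix e') hreg
    have := add_mem h1 h2
    rwa [sub_add_cancel] at this
  · refine Or.inr ⟨hm, ?_⟩
    have hx := hx hm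
    obtain ⟨z, hz, n, hn, _, h⟩ := exists_local_structure hvert hadm hx hm
    obtain ⟨g, η, hA, -, -⟩ := h e he
    have hz0 := hz.ne_zero
    refine ⟨z, hz, ?_⟩
    have htr : nabla.traceForm e = ((z : FF f) ^ 𝔇 x)⁻¹ • g.trace • D k (FF f) (z : FF f) +
        ((z : FF f) ^ n)⁻¹ • trM η := by
      rw [traceForm_eq, hA.2.2, map_add, map_smul, map_smul]
      congr 2
      rw [trM_apply, Matrix.trace, Finset.sum_smul]
      rfl
    have hgt : g.trace ∈ O f x := sum_mem fun i _ => hA.1 i i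
    have hηt : trM η ∈ baseForms f k x := by
      rw [trM_apply]
      exact sum_mem fun i _ => hA.2.1 i i
    rcases hn with hn | ⟨h1, rfl⟩
    · refine ⟨⟨_, hgt⟩, trM η, hηt, ?_⟩
      rw [htr, ← hn, Nat.add_sub_cancel, smul_smul, div_eq_inv_mul]
    -- A commutator has trace zero, so at a pseudo-logarithmic point the polar identity says that
    -- `Tr η / z` is regular. Its `dz` part `b` is absorbed into the coefficient of `dz / z`, which
    -- becomes `Tr g + z b`.
    · have hC := commutator_regular hx hz (by omega) hA (hvert e)
      have hC' := hC.trM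
      have hz' : (z : FF f) ^ (1 : ℕ) * ((z : FF f) ^ (1 + 1))⁻¹ = ((z : FF f) ^ 1)⁻¹ := by
        field_simp
      rw [h1, Nat.cast_one, one_mul, hz', map_sub, map_smul, map_sub, trM_comm, sub_self,
        smul_zero, zero_sub, map_smul] at hC'
      have hreg := neg_mem hC'
      rw [neg_neg] at hreg
      obtain ⟨b, η', hη', hb⟩ := mem_regForms_param hx hz hreg
      refine ⟨⟨_, hgt⟩ + z * b, η', hη', ?_⟩
      rw [htr, hb, h1, Nat.sub_self, pow_zero, inv_one, one_smul, smul_smul, ← add_assoc,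
        ← add_smul]
      congr 2
      simp only [Subring.coe_add, Subring.coe_mul, pow_one]
      field_simp

end LocalStructure

/-! ### Generators of `ω(𝔇)` -/

section Generators

variable {K : Type u} [Field K] {X : Scheme.{u}} [IsIntegral X] {f : X ⟶ Spec (.of K)}
  {x : X} {𝔇 : X →₀ ℕ}

theorem idealAt_eq_top (hm : 𝔇 x = 0) : idealAt f 𝔇 x = ⊤ := by
  rw [idealAt, hm, pow_zero, Ideal.one_eq_top]

theorem inOmegaD_iff_of_eq_zero (hm : 𝔇 x = 0) {w : Ω[FF f⁄K]} :
    InOmegaD f 𝔇 x w ↔ w ∈ regForms f K x := by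
  rw [InOmegaD, idealAt_eq_top hm]
  refine ⟨fun h => ?_, fun h a _ => Submodule.smul_mem _ a h⟩
  have := h 1 trivial
  rwa [O_smul, OneMemClass.coe_one, one_smul] at this

theorem inOmegaD_of_mem {w : Ω[FF f⁄K]} (hw : w ∈ regForms f K x) : InOmegaD f 𝔇 x w :=
  fun a _ => Submodule.smul_mem _ a hw

theorem inOmegaD_iff_param [SmoothOfRelativeDimension 1 f] (hx : IsRational f x) {z : O f x}
    (hz : IsLocalParam f x z) {w : Ω[FF f⁄K]} :
    InOmegaD f 𝔇 x w ↔
      ∃ a : O f x, w = (a : FF f) • ((z : FF f) ^ 𝔇 x)⁻¹ • D K (FF f) (z : FF f) := by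
  have hzm : (z : FF f) ^ 𝔇 x ≠ 0 := pow_ne_zero _ hz.ne_zero
  have hid : idealAt f 𝔇 x = Ideal.span {z ^ 𝔇 x} := by
    rw [idealAt, hz.2, Ideal.span_singleton_pow]
  constructor
  · intro h
    obtain ⟨a, ha⟩ := (mem_regForms_iff_param hx hz).1
      (h (z ^ 𝔇 x) (hid ▸ Ideal.mem_span_singleton_self _))
    refine ⟨a, ?_⟩
    rw [O_smul] at ha
    rw [smul_comm, ← ha, smul_smul]
    exact (by rw [SubmonoidClass.coe_pow, inv_mul_cancel₀ hzm, one_smul])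
  · rintro ⟨a, rfl⟩ b hb
    rw [hid, Ideal.mem_span_singleton] at hb
    obtain ⟨c, rfl⟩ := hb
    refine (mem_regForms_iff_param hx hz).2 ⟨c * a, ?_⟩
    rw [O_smul, smul_smul, smul_smul]
    congr 1
    simp only [Subring.coe_mul, SubmonoidClass.coe_pow]
    field_simp

theorem exists_ne_zero_mem_regForms [SmoothOfRelativeDimension 1 f] (x : X) :
    ∃ t ∈ regForms f K x, t ≠ 0 ∧ ∀ w : Ω[FF f⁄K], ∃ a : FF f, w = a • t := by
  obtain ⟨U, hxU, t, ht0, ht, hU⟩ := exists_generator f K x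
  exact ⟨_, relMap_regForms
    (hU x hxU ▸ Submodule.mem_sup_left (Submodule.mem_span_singleton_self t)), ht0, ht⟩

theorem GeneratesOmegaD.ne_zero [SmoothOfRelativeDimension 1 f] {t : Ω[FF f⁄K]}
    (ht : GeneratesOmegaD f 𝔇 x t) : t ≠ 0 := by
  rintro rfl
  obtain ⟨w, hw, hw0, -⟩ := exists_ne_zero_mem_regForms (f := f) x
  obtain ⟨a, ha⟩ := (ht w).1 (inOmegaD_of_mem hw)
  exact hw0 (by rw [ha, O_smul, smul_zero])

variable (f) in
/-- Two non-zero relative forms differ by a function. -/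
theorem exists_ratio [SmoothOfRelativeDimension 1 f] {t t' : Ω[FF f⁄K]} (ht : t ≠ 0)
    (ht' : t' ≠ 0) : ∃ a : (FF f)ˣ, t' = (a : FF f) • t := by
  -- Any point would do: only the one-dimensionality of the relative forms over the function field
  -- is used.
  obtain ⟨w, -, hw0, hw⟩ := exists_ne_zero_mem_regForms (f := f) (genericPoint X)
  obtain ⟨a, rfl⟩ := hw t
  obtain ⟨b, rfl⟩ := hw t'
  have ha : a ≠ 0 := fun h => ht (by rw [h, zero_smul])
  have hb : b ≠ 0 := fun h => ht' (by rw [h, zero_smul])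
  refine ⟨Units.mk0 b hb * (Units.mk0 a ha)⁻¹, ?_⟩
  rw [smul_smul, Units.val_mul, Units.val_inv_eq_inv_val, Units.val_mk0, Units.val_mk0,
    mul_assoc, inv_mul_cancel₀ ha, mul_one]

theorem ratio_mem [SmoothOfRelativeDimension 1 f] {t t' : Ω[FF f⁄K]}
    (ht : GeneratesOmegaD f 𝔇 x t) (ht' : GeneratesOmegaD f 𝔇 x t') {a : (FF f)ˣ}
    (h : t' = (a : FF f) • t) : (a : FF f) ∈ O f x ∧ ((a⁻¹ : (FF f)ˣ) : FF f) ∈ O f x := by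
  have key : ∀ {t t' : Ω[FF f⁄K]}, GeneratesOmegaD f 𝔇 x t → GeneratesOmegaD f 𝔇 x t' →
      ∀ a : FF f, t' = a • t → a ∈ O f x := by
    intro t t' ht ht' a h
    obtain ⟨b, hb⟩ := (ht t').1 ((ht' t').2 ⟨1, by rw [O_smul, OneMemClass.coe_one, one_smul]⟩)
    rw [h, O_smul] at hb
    rw [smul_left_injective (FF f) ht.ne_zero hb]
    exact b.2
  refine ⟨key ht ht' _ h, key ht' ht _ ?_⟩
  rw [h, smul_smul, Units.inv_mul, one_smul]

theorem generatesOmegaD_smul {t : Ω[FF f⁄K]} (ht : GeneratesOmegaD f 𝔇 x t) {a : (FF f)ˣ}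
    (ha : (a : FF f) ∈ O f x) (ha' : ((a⁻¹ : (FF f)ˣ) : FF f) ∈ O f x) :
    GeneratesOmegaD f 𝔇 x ((a : FF f) • t) := by
  intro w
  rw [ht w]
  constructor
  · rintro ⟨b, rfl⟩
    refine ⟨b * ⟨_, ha'⟩, ?_⟩
    rw [O_smul, O_smul, smul_smul, Subring.coe_mul, mul_assoc, Units.inv_mul, mul_one]
  · rintro ⟨b, rfl⟩
    refine ⟨b * ⟨_, ha⟩, ?_⟩
    rw [O_smul, O_smul, smul_smul, Subring.coe_mul]

theorem generatesOmegaD_param [SmoothOfRelativeDimension 1 f] (hx : IsRational f x) {z : O f x}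
    (hz : IsLocalParam f x z) :
    GeneratesOmegaD f 𝔇 x (((z : FF f) ^ 𝔇 x)⁻¹ • D K (FF f) (z : FF f)) := fun w => by
  rw [inOmegaD_iff_param hx hz]
  rfl

/-- The form `(a - 1) t` is regular while `t` has a pole of exact order `m`, so `z ^ m` divides `a -
1`. Thus the rigidification by `s` puts the transition functions in `(1 + 𝓘)^×`. -/
theorem ratio_sub_one_mem [SmoothOfRelativeDimension 1 f] (hx : IsRational f x) {z : O f x}
    (hz : IsLocalParam f x z) {t t' : Ω[FF f⁄K]}
    (ht : GeneratesOmegaD f 𝔇 x t) (h0 : t' - t ∈ regForms f K x) {a : FF f} (ha : a ∈ O f x)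
    (h : t' = a • t) : (⟨a, ha⟩ : O f x) - 1 ∈ idealAt f 𝔇 x := by
  have hzm : (z : FF f) ^ 𝔇 x ≠ 0 := pow_ne_zero _ hz.ne_zero
  obtain ⟨u, hu⟩ := exists_ratio f (generatesOmegaD_param hx hz).ne_zero ht.ne_zero
  have hum := ratio_mem (generatesOmegaD_param hx hz) ht hu
  obtain ⟨b, hb⟩ := (mem_regForms_iff_param hx hz).1 h0
  rw [idealAt, hz.2, Ideal.span_singleton_pow, Ideal.mem_span_singleton]
  refine ⟨b * ⟨_, hum.2⟩, Subtype.ext ?_⟩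
  have h1 : ((a - 1) * u * ((z : FF f) ^ 𝔇 x)⁻¹) • D K (FF f) (z : FF f) =
      (b : FF f) • D K (FF f) (z : FF f) := by
    rw [← hb, h, hu, sub_mul, sub_mul, sub_smul, one_mul]
    simp only [smul_smul, mul_assoc]
  have h2 := smul_left_injective (FF f) (D_param_ne_zero hx hz) h1
  change a - 1 = (z : FF f) ^ 𝔇 x * ((b : FF f) * ((u⁻¹ : (FF f)ˣ) : FF f))
  rw [← h2, Units.val_inv_eq_inv_val]
  have hu0 := u.ne_zero
  field_simp

theorem exists_nhd_unit {a : (FF f)ˣ} (ha : (a : FF f) ∈ O f x)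
    (ha' : ((a⁻¹ : (FF f)ˣ) : FF f) ∈ O f x) :
    ∃ U : X.Opens, x ∈ U ∧ ∀ y ∈ U, (a : FF f) ∈ O f y ∧ ((a⁻¹ : (FF f)ˣ) : FF f) ∈ O f y := by
  obtain ⟨U, hU, h⟩ := exists_nhd_mem f ha
  obtain ⟨U', hU', h'⟩ := exists_nhd_mem f ha'
  exact ⟨U ⊓ U', ⟨hU, hU'⟩, fun y hy => ⟨h y hy.1, h' y hy.2⟩⟩

variable (f) in
/-- Near every point there is a form that generates `ω` at all points of a neighbourhood. -/
theorem exists_nhd_generates [SmoothOfRelativeDimension 1 f] (x : X) :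
    ∃ (U : X.Opens) (t : Ω[FF f⁄K]), x ∈ U ∧ ∀ y ∈ U, GeneratesOmegaD f 0 y t := by
  obtain ⟨U, hxU, t, -, -, hU⟩ := exists_generator f K x
  refine ⟨U, t, hxU, fun y hy w => ?_⟩
  rw [inOmegaD_iff_of_eq_zero (by simp), hU y hy, baseForms_self, sup_bot_eq,
    Submodule.mem_span_singleton]
  exact ⟨fun ⟨a, ha⟩ => ⟨a, ha.symm⟩, fun ⟨a, ha⟩ => ⟨a, ha.symm⟩⟩

/-- Allows `𝔇` to be replaced by `0` at points off its support. -/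
theorem generatesOmegaD_congr {𝔇' : X →₀ ℕ} (h : 𝔇 x = 𝔇' x) {t : Ω[FF f⁄K]} :
    GeneratesOmegaD f 𝔇 x t ↔ GeneratesOmegaD f 𝔇' x t := by
  simp only [GeneratesOmegaD, InOmegaD, idealAt, h]

/-- The points of the support of `𝔇` other than `x` form a closed set. -/
theorem isClosed_support (h𝔇 : ∀ x, 𝔇 x ≠ 0 → IsRational f x) (x : X) :
    IsClosed {y | 𝔇 y ≠ 0 ∧ y ≠ x} := by
  have hfin : {y | 𝔇 y ≠ 0 ∧ y ≠ x}.Finite :=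
    𝔇.support.finite_toSet.subset fun y hy => Finsupp.mem_support_iff.2 hy.1
  have : {y | 𝔇 y ≠ 0 ∧ y ≠ x} = ⋃ y ∈ {y | 𝔇 y ≠ 0 ∧ y ≠ x}, ({y} : Set X) :=
    (Set.biUnion_of_singleton _).symm
  rw [this]
  exact hfin.isClosed_biUnion fun y hy => (h𝔇 y hy.1).isClosed

/-- A neighbourhood of `x` that contains no point of `𝔇` except possibly `x`. -/
def awayFrom (h𝔇 : ∀ x, 𝔇 x ≠ 0 → IsRational f x) (x : X) : X.Opens :=
  ⟨{y | 𝔇 y ≠ 0 ∧ y ≠ x}ᶜ, (isClosed_support h𝔇 x).isOpen_compl⟩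

theorem mem_awayFrom_self (h𝔇 : ∀ x, 𝔇 x ≠ 0 → IsRational f x) (x : X) : x ∈ awayFrom h𝔇 x :=
  fun h => h.2 rfl

theorem eq_of_mem_awayFrom {h𝔇 : ∀ x, 𝔇 x ≠ 0 → IsRational f x} {x y : X}
    (hy : y ∈ awayFrom h𝔇 x) (h : 𝔇 y ≠ 0) : y = x := by
  by_contra hne
  exact hy ⟨h, hne⟩

/-- A generator of `ω(𝔇)` at a point of `𝔇` is a generator in a neighbourhood. -/
theorem exists_nhd_generates_of_param [IsLocallyNoetherian X] [SmoothOfRelativeDimension 1 f]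
    (h𝔇 : ∀ x, 𝔇 x ≠ 0 → IsRational f x) (hm : 𝔇 x ≠ 0) {z : O f x} (hz : IsLocalParam f x z)
    {s : Ω[FF f⁄K]} (hs : GeneratesOmegaD f 𝔇 x s) :
    ∃ U : X.Opens, x ∈ U ∧ ∀ y ∈ U, GeneratesOmegaD f 𝔇 y s := by
  have hx := h𝔇 x hm
  obtain ⟨U, t, hxU, ht⟩ := exists_nhd_generates f x
  have hz0 := hz.ne_zero
  have hdz : GeneratesOmegaD f 0 x (D K (FF f) (z : FF f)) := by
    have := generatesOmegaD_param (𝔇 := 0) hx hz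
    simpa using this
  obtain ⟨v, hv⟩ := exists_ratio f (ht x hxU).ne_zero hdz.ne_zero
  have hvm := ratio_mem (ht x hxU) hdz hv
  obtain ⟨u, hu⟩ := exists_ratio f (generatesOmegaD_param (𝔇 := 𝔇) hx hz).ne_zero hs.ne_zero
  have hum := ratio_mem (generatesOmegaD_param hx hz) hs hu
  obtain ⟨U₁, hxU₁, hU₁⟩ := exists_nhd_unit hvm.1 hvm.2
  obtain ⟨U₂, hxU₂, hU₂⟩ := exists_nhd_unit hum.1 hum.2
  obtain ⟨U₃, hxU₃, hU₃⟩ := exists_nhd_param f hx.isClosed hz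
  obtain ⟨U₄, hxU₄, hU₄⟩ := exists_nhd_mem f z.2
  refine ⟨U ⊓ U₁ ⊓ U₂ ⊓ U₃ ⊓ U₄ ⊓ awayFrom h𝔇 x,
    ⟨⟨⟨⟨⟨hxU, hxU₁⟩, hxU₂⟩, hxU₃⟩, hxU₄⟩, mem_awayFrom_self h𝔇 x⟩, ?_⟩
  rintro y ⟨⟨⟨⟨⟨hyU, hy1⟩, hy2⟩, hy3⟩, hy4⟩, hy5⟩
  by_cases hyx : y = x
  · rwa [hyx]
  have hy0 : 𝔇 y = 0 := by
    by_contra h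
    exact hyx (eq_of_mem_awayFrom hy5 h)
  rw [generatesOmegaD_congr (𝔇' := 0) (by simpa using hy0)]
  -- From `s = u z⁻ᵐ dz` and `dz = v t`, where `t` generates `ω` nearby: at `y ≠ x` the functions
  -- `u`, `v` and `z` are all units.
  let a : (FF f)ˣ := u * (Units.mk0 (z : FF f) hz0 ^ 𝔇 x)⁻¹ * v
  have ha : s = (a : FF f) • t := by
    rw [hu, hv]
    simp only [a, Units.val_mul, Units.val_inv_eq_inv_val, Units.val_pow_eq_pow_val, Units.val_mk0,
      smul_smul, mul_assoc]
  rw [ha]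
  refine generatesOmegaD_smul (ht y hyU) ?_ ?_
  · simp only [a, Units.val_mul, Units.val_inv_eq_inv_val, Units.val_pow_eq_pow_val, Units.val_mk0]
    rw [← inv_pow]
    exact mul_mem (mul_mem (hU₂ y hy2).1 (pow_mem (hU₃ y hy3 hyx) _)) (hU₁ y hy1).1
  · have : a⁻¹ = u⁻¹ * (Units.mk0 (z : FF f) hz0 ^ 𝔇 x) * v⁻¹ := by
      simp only [a, mul_inv, inv_inv]
    rw [this]
    simp only [Units.val_mul, Units.val_pow_eq_pow_val, Units.val_mk0]
    exact mul_mem (mul_mem (hU₂ y hy2).2 (pow_mem (hU₄ y hy4) _)) (hU₁ y hy1).2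

end Generators

/-! ### Čech cocycles -/

section Cech

variable {K : Type u} [Field K] {X : Scheme.{u}} [IsIntegral X] {f : X ⟶ Spec (.of K)}
  {k : Type u} [Field k] [Algebra k K] {x : X} {𝔇 : X →₀ ℕ}

/-- The coarsest common refinement of two coverings. -/
def PtCover.inter {X : Scheme.{u}} (𝒰 𝒱 : PtCover X) : PtCover X where
  U x := 𝒰.U x ⊓ 𝒱.U x
  mem x := ⟨𝒰.mem x, 𝒱.mem x⟩

theorem PtCover.le_inter_left {X : Scheme.{u}} (𝒰 𝒱 : PtCover X) : 𝒰 ≤ 𝒰.inter 𝒱 :=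
  fun _ => inf_le_left

theorem PtCover.le_inter_right {X : Scheme.{u}} (𝒰 𝒱 : PtCover X) : 𝒱 ≤ 𝒰.inter 𝒱 :=
  fun _ => inf_le_right

theorem AD2.mk_res {𝒰 𝒱 : PtCover X} (h : 𝒰 ≤ 𝒱) (c : cocycles2 f k 𝒰) :
    AD2.mk f k (resCocycle f k h c) = AD2.mk f k c :=
  AddCommGroup.DirectLimit.of_f (G := fun 𝒰 : PtCover X => CechH2 f k 𝒰)
    (f := fun _ _ h => resH2 f k h) (hij := h) (x := QuotientAddGroup.mk' _ c)

theorem AD2.mk_add {𝒰 : PtCover X} (c c' : cocycles2 f k 𝒰) :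
    AD2.mk f k (c + c') = AD2.mk f k c + AD2.mk f k c' := by
  simp only [AD2.mk, map_add]
  rfl

theorem AD2.mk_neg {𝒰 : PtCover X} (c : cocycles2 f k 𝒰) :
    AD2.mk f k (-c) = - AD2.mk f k c := by
  simp only [AD2.mk, map_neg]
  rfl

theorem AD2.mk_eq {𝒰 : PtCover X} {c c' : cocycles2 f k 𝒰}
    (h : ((c - c' : cocycles2 f k 𝒰) : Cochain2 f k 𝒰) ∈ coboundaries2 f k 𝒰) :
    AD2.mk f k c = AD2.mk f k c' := by
  rw [AD2.mk, AD2.mk]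
  congr 1
  rw [QuotientAddGroup.mk'_eq_mk']
  refine ⟨-(c - c'), ?_, by abel⟩
  exact AddSubgroup.neg_mem ((coboundaries2 f k 𝒰).addSubgroupOf (cocycles2 f k 𝒰)) h

/-- An element of the stalk involves only finitely many regular functions, each of which extends to
a neighbourhood. -/
theorem exists_nhd_regForms2 {w : RelForms2 k (FF f) K} (hw : w ∈ regForms2 f k x) :
    ∃ U : X.Opens, x ∈ U ∧ ∀ y ∈ U, w ∈ regForms2 f k y := by
  induction hw using Submodule.span_induction with
  | mem w hw =>
    obtain ⟨a, b, rfl⟩ := hw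
    obtain ⟨U, hU, h⟩ := exists_nhd_mem f a.2
    obtain ⟨U', hU', h'⟩ := exists_nhd_mem f b.2
    exact ⟨U ⊓ U', ⟨hU, hU'⟩, fun y hy =>
      Submodule.subset_span ⟨⟨_, h y hy.1⟩, ⟨_, h' y hy.2⟩, rfl⟩⟩
  | zero => exact ⟨⊤, trivial, fun y _ => zero_mem _⟩
  | add w w' _ _ h h' =>
    obtain ⟨U, hU, h⟩ := h
    obtain ⟨U', hU', h'⟩ := h'
    exact ⟨U ⊓ U', ⟨hU, hU'⟩, fun y hy => add_mem (h y hy.1) (h' y hy.2)⟩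
  | smul a w _ h =>
    obtain ⟨U, hU, h⟩ := h
    obtain ⟨U', hU', h'⟩ := exists_nhd_mem f a.2
    exact ⟨U ⊓ U', ⟨hU, hU'⟩, fun y hy => smul_mem_regForms2 (h' y hy.2) (h y hy.1)⟩

/-- `d log` of a unit congruent to `1` modulo `𝓘` at `x`, times a form in `Ω¹{𝔇}`, is regular. -/
theorem dlog_wedge_mem_stalk (h𝔇 : ∀ x, 𝔇 x ≠ 0 → IsRational f x) {p : (FF f)ˣ}
    (hp : (p : FF f) ∈ O f x) (hp' : ((p⁻¹ : (FF f)ˣ) : FF f) ∈ O f x)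
    (h1 : (⟨p, hp⟩ : O f x) - 1 ∈ idealAt f 𝔇 x) {α : Ω[FF f⁄k]}
    (hα : InOmegaBrace f 𝔇 k x α) :
    wedgeRel k (FF f) K (dlog k (FF f) p) α ∈ regForms2 f k x := by
  obtain ⟨U, hxU, hU⟩ := exists_nhd_unit hp hp'
  -- The congruence to `1` is known at `x` only; shrinking until `x` is the only possible point of
  -- `𝔇` makes it empty elsewhere.
  let q : unitsOn f (U ⊓ awayFrom h𝔇 x) := ⟨p, fun y hy => hU y hy.1⟩
  refine dlog_wedge_mem f 𝔇 k q (fun y hy => ?_) ⟨hxU, mem_awayFrom_self h𝔇 x⟩ hα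
  by_cases hy0 : 𝔇 y = 0
  · rw [idealAt_eq_top hy0]
    trivial
  · obtain rfl := eq_of_mem_awayFrom hy.2 hy0
    exact h1

/-- The cocycle `(0, β_j - β_i)`. -/
def differenceCocycle {𝒰 : PtCover X} (β : X → RelForms2 k (FF f) K)
    (hβ : ∀ i j, ∀ x ∈ 𝒰.U₂ i j, β j - β i ∈ regForms2 f k x) : cocycles2 f k 𝒰 :=
  ⟨(0, fun i j => ⟨β j - β i, (mem_forms2On f k).2 (hβ i j)⟩), by
    refine ⟨fun i j l n x hi hj hl hn => ?_, fun i j l x hx => ?_⟩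
    · simp only [Pi.zero_apply, map_zero, sub_zero, add_zero]
    · simp only [Pi.zero_apply, map_zero]
      abel⟩

/-- The boundary of a family of principal parts exists. -/
theorem exists_isBoundary [IsLocallyNoetherian X] (h𝔇 : ∀ x, 𝔇 x ≠ 0 → IsRational f x)
    (τ : X → RelForms2 k (FF f) K)
    (hτ : ∀ x, 𝔇 x ≠ 0 → ∃ z : O f x, IsLocalParam f x z ∧
      (z : FF f) ^ 𝔇 x • τ x ∈ regForms2 f k x) :
    ∃ c, IsBoundary f 𝔇 k τ c := by
  have hU : ∀ i, ∃ U : X.Opens, i ∈ U ∧ (𝔇 i ≠ 0 → ∀ y ∈ U, y ≠ i → τ i ∈ regForms2 f k y) := by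
    intro i
    by_cases hi : 𝔇 i = 0
    · exact ⟨⊤, trivial, fun h => absurd hi h⟩
    · obtain ⟨z, hz, hzτ⟩ := hτ i hi
      obtain ⟨U, hiU, hU⟩ := exists_nhd_regForms2 hzτ
      obtain ⟨U', hiU', hU'⟩ := exists_nhd_param f (h𝔇 i hi).isClosed hz
      refine ⟨U ⊓ U', ⟨hiU, hiU'⟩, fun _ y hy hyi => ?_⟩
      -- Near `i` the form `z ^ m τ_i` is regular, and `z` is invertible off `i`.
      have h := smul_mem_regForms2 (pow_mem (hU' y hy.2 hyi) (𝔇 i)) (hU y hy.1)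
      rwa [smul_smul, inv_pow, inv_mul_cancel₀ (pow_ne_zero _ hz.ne_zero), one_smul] at h
  choose U hiU hU using hU
  classical
  let 𝒰 : PtCover X := ⟨fun i => U i ⊓ awayFrom h𝔇 i, fun i => ⟨hiU i, mem_awayFrom_self h𝔇 i⟩⟩
  -- No member of the covering contains a point of `𝔇` other than its own index, so `τ i` itself is
  -- a lift there, and `0` is a lift when `i` is off `𝔇`.
  let β : X → RelForms2 k (FF f) K := fun i => if 𝔇 i = 0 then 0 else τ i
  have h1 : ∀ i, ∀ x ∈ 𝒰.U i, 𝔇 x ≠ 0 → β i - τ x ∈ regForms2 f k x := by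
    intro i x hx hm
    obtain rfl := eq_of_mem_awayFrom hx.2 hm
    simp only [β, if_neg hm, sub_self]
    exact zero_mem _
  have h2 : ∀ i, ∀ x ∈ 𝒰.U i, 𝔇 x = 0 → β i ∈ regForms2 f k x := by
    intro i x hx hm
    by_cases hi : 𝔇 i = 0
    · simp only [β, if_pos hi]
      exact zero_mem _
    · simp only [β, if_neg hi]
      refine hU i hi x hx.1 ?_
      rintro rfl
      exact hi hm
  refine ⟨_, 𝒰, β, differenceCocycle β fun i j x hx => ?_, h1, h2, rfl, fun i j => rfl, rfl⟩
  by_cases hm : 𝔇 x = 0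
  · exact sub_mem (h2 j x hx.2 hm) (h2 i x hx.1 hm)
  · have := sub_mem (h1 j x hx.2 hm) (h1 i x hx.1 hm)
    rwa [sub_sub_sub_cancel_right] at this

/-- The boundary depends only on the principal parts modulo regular forms. -/
theorem IsBoundary.unique {τ τ' : X → RelForms2 k (FF f) K} {c c' : AD2 f k}
    (hc : IsBoundary f 𝔇 k τ c) (hc' : IsBoundary f 𝔇 k τ' c')
    (h : ∀ x, 𝔇 x ≠ 0 → τ x - τ' x ∈ regForms2 f k x) : c = c' := by
  obtain ⟨𝒰, β, z, h1, h2, hz, hzβ, rfl⟩ := hc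
  obtain ⟨𝒰', β', z', h1', h2', hz', hzβ', rfl⟩ := hc'
  rw [← AD2.mk_res (𝒰.le_inter_left 𝒰') z, ← AD2.mk_res (𝒰.le_inter_right 𝒰') z']
  -- The minus sign matches the `-δ e` in the total differential.
  refine AD2.mk_eq ⟨0, fun i => ⟨-(β i - β' i), (mem_forms2On f k).2 fun x hx => neg_mem ?_⟩,
    fun i j l x hi hj hl => ?_, fun i j x hx => ?_⟩
  · by_cases hm : 𝔇 x = 0
    · exact sub_mem (h2 i x hx.1 hm) (h2' i x hx.2 hm)
    · have := add_mem (sub_mem (h1 i x hx.1 hm) (h1' i x hx.2 hm)) (h x hm)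
      convert! this using 1
      abel
  · have e1 : germK2 f (PtCover.mem₃ hi hj hl) (((resCocycle f k (𝒰.le_inter_left 𝒰') z -
        resCocycle f k (𝒰.le_inter_right 𝒰') z' : cocycles2 f k (𝒰.inter 𝒰')) :
        Cochain2 f k (𝒰.inter 𝒰')).1 i j l) =
        germK2 f (PtCover.mem₃ hi.1 hj.1 hl.1) (z.1.1 i j l) -
          germK2 f (PtCover.mem₃ hi.2 hj.2 hl.2) (z'.1.1 i j l) := rfl
    rw [e1, hz, hz']
    simp only [Pi.zero_apply, map_zero, sub_zero, add_zero]
  · have e1 : ((((resCocycle f k (𝒰.le_inter_left 𝒰') z -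
        resCocycle f k (𝒰.le_inter_right 𝒰') z' : cocycles2 f k (𝒰.inter 𝒰')) :
        Cochain2 f k (𝒰.inter 𝒰')).2 i j : forms2On f k _) : RelForms2 k (FF f) K) =
        (z.1.2 i j : RelForms2 k (FF f) K) - z'.1.2 i j := rfl
    rw [e1, hzβ, hzβ']
    simp only [Pi.zero_apply, map_zero]
    abel

/-! ### Restriction of the product and its dependence on the trivialisations -/

/-- Restriction of a cocycle of `(1 + 𝓘)^×` to a finer covering. -/
def RelPicCocycle.res {𝒰 𝒱 : PtCover X} (h : 𝒰 ≤ 𝒱) (L : RelPicCocycle f 𝔇 𝒰) :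
    RelPicCocycle f 𝔇 𝒱 where
  lam i j := resUnits f (inf_le_inf (h i) (h j)) (L.lam i j)
  one_mod i j := fun x hx => L.one_mod i j x ⟨h i hx.1, h j hx.2⟩
  cocycle := L.cocycle

/-- Restriction of a cocycle of `𝒪^× → Ω¹{𝔇}` to a finer covering. -/
def ConnCocycle.res {𝒰 𝒱 : PtCover X} (h : 𝒰 ≤ 𝒱) (C : ConnCocycle f 𝔇 k 𝒰) :
    ConnCocycle f 𝔇 k 𝒱 where
  g i j := resUnits f (inf_le_inf (h i) (h j)) (C.g i j)
  α := C.α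
  mem i x hx := C.mem i x (h i hx)
  cocycle := C.cocycle
  dlog_g := C.dlog_g

theorem cup_res {𝒰 𝒱 : PtCover X} (h : 𝒰 ≤ 𝒱) (L : RelPicCocycle f 𝔇 𝒰)
    (C : ConnCocycle f 𝔇 k 𝒰) : cup (L.res h) (C.res h) = resCocycle f k h (cup L C) := rfl

theorem mk_cup_res {𝒰 𝒱 : PtCover X} (h : 𝒰 ≤ 𝒱) (L : RelPicCocycle f 𝔇 𝒰)
    (C : ConnCocycle f 𝔇 k 𝒰) : AD2.mk f k (cup (L.res h) (C.res h)) = AD2.mk f k (cup L C) := by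
  rw [cup_res, AD2.mk_res]

theorem unitGerm_mul_mul {U V W T : X.Opens} {p : unitsOn f U} {q : unitsOn f V} {r : unitsOn f W}
    {t : unitsOn f T} (h : (p : (FF f)ˣ) * q = r * t) {x : X} (hU : x ∈ U) (hV : x ∈ V)
    (hW : x ∈ W) (hT : x ∈ T) :
    unitGerm f p hU * unitGerm f q hV = unitGerm f r hW * unitGerm f t hT :=
  Units.ext (Subtype.ext (congrArg Units.val h))

/-- The effect of a change of trivialisations on the product class. -/
theorem neg_mk_cup_add_eq {𝒰 : PtCover X} {L L' : RelPicCocycle f 𝔇 𝒰}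
    {C C' : ConnCocycle f 𝔇 k 𝒰} {μ h : ∀ i, unitsOn f (𝒰.U i)}
    (hL : ∀ i j, (L'.lam i j : (FF f)ˣ) * μ i = L.lam i j * μ j)
    (hC : ∀ i j, (C'.g i j : (FF f)ˣ) * h i = C.g i j * h j)
    (hα : ∀ i, C'.α i = C.α i + dlog k (FF f) (h i))
    {β β' : X → RelForms2 k (FF f) K} {z z' : cocycles2 f k 𝒰}
    (hz : z.1.1 = 0) (hz' : z'.1.1 = 0)
    (hβ : ∀ i j, (z.1.2 i j : RelForms2 k (FF f) K) = β j - β i)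
    (hβ' : ∀ i j, (z'.1.2 i j : RelForms2 k (FF f) K) = β' j - β' i)
    (hreg : ∀ i, ∀ x ∈ 𝒰.U i, wedgeRel k (FF f) K (dlog k (FF f) (μ i)) (C.α i) -
      (β i - β' i) ∈ regForms2 f k x) :
    -AD2.mk f k (cup L C) + AD2.mk f k z = -AD2.mk f k (cup L' C') + AD2.mk f k z' := by
  rw [← AD2.mk_neg, ← AD2.mk_neg, ← AD2.mk_add, ← AD2.mk_add]
  -- Changing first the generators and then the bases gives the symbols `{μ_i, g_ij}` and `{λ'_ij,
  -- h_j}`. The leftover forms `dlog μ_i ∧ α_i` need not be regular, since `μ_i` need not be `1`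
  -- modulo `𝓘`; only their combination with `β_i - β'_i` is a cochain.
  refine AD2.mk_eq ⟨fun i j => symbolOn f (resUnits f inf_le_left (μ i)) (C.g i j) -
      symbolOn f (L'.lam i j) (resUnits f inf_le_right (h j)),
    fun i => ⟨_, (mem_forms2On f k).2 (hreg i)⟩, fun i j l x hi hj hl => ?_, fun i j x hx => ?_⟩
  · have e1 : germK2 f (PtCover.mem₃ hi hj hl)
        (((-cup L C + z - (-cup L' C' + z') : cocycles2 f k 𝒰) : Cochain2 f k 𝒰).1 i j l) =
        -K2.symbol (unitGerm f (L.lam i j) (PtCover.mem₂ hi hj))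
            (unitGerm f (C.g j l) (PtCover.mem₂ hj hl)) +
          germK2 f (PtCover.mem₃ hi hj hl) (z.1.1 i j l) -
        (-K2.symbol (unitGerm f (L'.lam i j) (PtCover.mem₂ hi hj))
            (unitGerm f (C'.g j l) (PtCover.mem₂ hj hl)) +
          germK2 f (PtCover.mem₃ hi hj hl) (z'.1.1 i j l)) := rfl
    have e2 : ∀ (i j : X) (hi : x ∈ 𝒰.U i) (hj : x ∈ 𝒰.U j), germK2 f (PtCover.mem₂ hi hj)
        (symbolOn f (resUnits f inf_le_left (μ i)) (C.g i j) -
          symbolOn f (L'.lam i j) (resUnits f inf_le_right (h j))) =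
        K2.symbol (unitGerm f (μ i) hi) (unitGerm f (C.g i j) (PtCover.mem₂ hi hj)) -
          K2.symbol (unitGerm f (L'.lam i j) (PtCover.mem₂ hi hj)) (unitGerm f (h j) hj) :=
      fun i j hi hj => rfl
    rw [e1, e2 j l hj hl, e2 i l hi hl, e2 i j hi hj, hz, hz']
    -- `R1` expands the relation between `λ` and `λ'` against `g_jl`; `R2` expands the relation
    -- between `g` and `g'` against `λ'_ij`. With the two cocycle identities they reduce the claim
    -- to addition.
    have R1 := congrArg (fun p => K2.symbol p (unitGerm f (C.g j l) (PtCover.mem₂ hj hl)))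
      (unitGerm_mul_mul (hL i j) (PtCover.mem₂ hi hj) hi (PtCover.mem₂ hi hj) hj)
    have R2 := congrArg (fun p => K2.symbol (unitGerm f (L'.lam i j) (PtCover.mem₂ hi hj)) p)
      (unitGerm_mul_mul (hC j l) (PtCover.mem₂ hj hl) hj (PtCover.mem₂ hj hl) hl)
    simp only [K2.symbol_mul_left, K2.symbol_mul_right] at R1 R2
    rw [unitGerm_mul (L'.cocycle i j l) (PtCover.mem₂ hi hl) (PtCover.mem₂ hi hj)
        (PtCover.mem₂ hj hl),
      unitGerm_mul (C.cocycle i j l) (PtCover.mem₂ hi hl) (PtCover.mem₂ hi hj)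
        (PtCover.mem₂ hj hl), K2.symbol_mul_left, K2.symbol_mul_right]
    simp only [Pi.zero_apply, map_zero, add_zero]
    rw [eq_sub_of_add_eq R2, eq_sub_of_add_eq R1]
    abel
  · have e1 : ((((-cup L C + z - (-cup L' C' + z') : cocycles2 f k 𝒰) :
        Cochain2 f k 𝒰).2 i j : forms2On f k _) : RelForms2 k (FF f) K) =
        -(-wedgeRel k (FF f) K (dlog k (FF f) (L.lam i j)) (C.α j)) + z.1.2 i j -
        (-(-wedgeRel k (FF f) K (dlog k (FF f) (L'.lam i j)) (C'.α j)) + z'.1.2 i j) := rfl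
    have e2 : germK2 f hx
        (symbolOn f (resUnits f inf_le_left (μ i)) (C.g i j) -
          symbolOn f (L'.lam i j) (resUnits f inf_le_right (h j))) =
        germK2 f hx (symbolOn f (resUnits f inf_le_left (μ i)) (C.g i j)) -
          germK2 f hx (symbolOn f (L'.lam i j) (resUnits f inf_le_right (h j))) := rfl
    rw [e1, e2, map_sub, germ_symbolOn, germ_symbolOn, dlogGerm_symbol, dlogGerm_symbol, hβ, hβ']
    have R1 := congrArg (dlog k (FF f)) (hL i j)
    rw [dlog_mul, dlog_mul] at R1
    change _ = wedgeRel k (FF f) K (dlog k (FF f) (μ i)) (dlog k (FF f) (C.g i j)) -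
      wedgeRel k (FF f) K (dlog k (FF f) (L'.lam i j)) (dlog k (FF f) (h j)) -
      (wedgeRel k (FF f) K (dlog k (FF f) (μ j)) (C.α j) - (β j - β' j) -
      (wedgeRel k (FF f) K (dlog k (FF f) (μ i)) (C.α i) - (β i - β' i)))
    rw [hα, C.dlog_g, eq_sub_of_add_eq R1.symm]
    simp only [map_add, map_sub, LinearMap.add_apply, LinearMap.sub_apply]
    abel

end Cech

/-! ### The local and the global class -/

section Classes

variable {K : Type u} [Field K] {X : Scheme.{u}} [IsIntegral X] {f : X ⟶ Spec (.of K)}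
  {k : Type u} [Field k] [Algebra k K] {r : ℕ} {x : X}
  {V : Type v} [AddCommGroup V] [Module (FF f) V] {𝔇 : X →₀ ℕ}

/-- A scalar adds `dlog u` times the identity to `dg g⁻¹`, and pairing this with `A` gives its
trace. This links the local term to the connection form of `det ∇`. -/
theorem trD_smul {g : Matrix (Fin r) (Fin r) (FF f)} (hg : IsGLInt x g) (u : (FF f)ˣ)
    (A : Matrix (Fin r) (Fin r) (Ω[FF f⁄k])) :
    trD k ((u : FF f) • g) A =
      trD k g A + wedgeRel k (FF f) K (dlog k (FF f) u) (trM A) := by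
  have hu := u.ne_zero
  have h1 : ((u : FF f) • g)⁻¹ = (u : FF f)⁻¹ • g⁻¹ :=
    Matrix.inv_eq_left_inv (by
      rw [Matrix.smul_mul, Matrix.mul_smul, smul_smul, inv_mul_cancel₀ hu, one_smul, hg.inv_mul])
  rw [trD, h1, dM_smul, map_smul, map_add, LinearMap.add_apply, smul_add, map_smul,
    LinearMap.smul_apply, smul_smul, inv_mul_cancel₀ hu, one_smul, rm_fm, hg.mul_inv, map_add,
    LinearMap.add_apply, map_smul, LinearMap.smul_apply, trW_fm, one_lm, trD, dlog,
    Units.val_inv_eq_inv_val, map_smul, LinearMap.smul_apply]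

theorem IsGLInt.exists_GL {G : Matrix (Fin r) (Fin r) (FF f)} (hG : IsGLInt x G) :
    ∃ g : GL (Fin r) (O f x), ∀ i j, (g i j : FF f) = G i j := by
  let M : Matrix (Fin r) (Fin r) (O f x) := Matrix.of fun i j => ⟨G i j, hG.int i j⟩
  have hdet : IsUnit M.det := by
    have h := (isGLInt_iff_det hG.int).1 hG
    convert! h using 1
    exact Subtype.ext (RingHom.map_det (O f x).subtype M)
  exact ⟨Matrix.nonsingInvUnit M hdet, fun i j => rfl⟩

theorem trForm_map_eq (g : GL (Fin r) (O f x)) (A : Matrix (Fin r) (Fin r) (Ω[FF f⁄k])) :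
    trForm (Matrix.GeneralLinearGroup.map (O f x).subtype g) A =
      trD k ((g : Matrix (Fin r) (Fin r) (O f x)).map (O f x).subtype) A := by
  rw [trForm_eq_trW, trD, Matrix.coe_units_inv]
  rfl

/-- The principal part of `Tr(dg g⁻¹ A)` at a point of `𝔇`, for all local bases and all
trivialisations of `ω(𝔇)` at the point. -/
theorem exists_local_invariant [SmoothOfRelativeDimension 1 f] {E : Bundle f r V}
    {nabla : Conn f k V} (hvert : nabla.IsVertical r) (hadm : IsPseudoAdmissible 𝔇 E nabla)
    (hx : IsRational f x) (hm : 𝔇 x ≠ 0) :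
    ∃ z : O f x, IsLocalParam f x z ∧ ∃ τ : RelForms2 k (FF f) K, ∀ e, E.IsBasisAt x e →
      ∀ (s : Ω[FF f⁄K]) (u : (FF f)ˣ),
        s = (u : FF f) • ((z : FF f) ^ 𝔇 x)⁻¹ • D K (FF f) (z : FF f) →
        (u : FF f) ∈ O f x → ((u⁻¹ : (FF f)ˣ) : FF f) ∈ O f x →
        (∃ g : GL (Fin r) (O f x), ∀ i j, relMap f k (nabla.matrix e i j) = (g i j : FF f) • s) ∧
        ∀ g : GL (Fin r) (O f x),
          (∀ i j, relMap f k (nabla.matrix e i j) = (g i j : FF f) • s) →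
          trForm (Matrix.GeneralLinearGroup.map (O f x).subtype g) (nabla.matrix e) +
            wedgeRel k (FF f) K (dlog k (FF f) u) (nabla.traceForm e) - τ ∈ regForms2 f k x ∧
          (z : FF f) ^ 𝔇 x • trForm (Matrix.GeneralLinearGroup.map (O f x).subtype g)
            (nabla.matrix e) ∈ regForms2 f k x := by
  obtain ⟨z, hz, n, hn, τ, h⟩ := exists_local_structure hvert hadm hx hm
  refine ⟨z, hz, τ, fun e he s u hs hu hu' => ?_⟩
  obtain ⟨g₀, η, hA, hg₀, hτ⟩ := h e he
  have hz0 := hz.ne_zero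
  -- Base forms vanish relative to `K`, so the relative connection is `g₀ dz / z ^ m`, which is `g₀
  -- u⁻¹ s`.
  have hrel : ∀ i j, relMap f k (nabla.matrix e i j) =
      (g₀ i j * ((u⁻¹ : (FF f)ˣ) : FF f)) • s := fun i j => by
    have : nabla.matrix e i j = ((z : FF f) ^ 𝔇 x)⁻¹ • g₀ i j • D k (FF f) (z : FF f) +
        ((z : FF f) ^ n)⁻¹ • η i j := by
      rw [hA.2.2]
      rfl
    rw [this, map_add, map_smul, map_smul, map_smul, relMap_D, relMap_baseForms (hA.2.1 i j),
      smul_zero, add_zero, hs, smul_smul, smul_smul, smul_smul]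
    refine congrArg (· • D K (FF f) (z : FF f)) ?_
    generalize g₀ i j = a
    generalize ((z : FF f) ^ 𝔇 x)⁻¹ = b
    have hu1 : ((u⁻¹ : (FF f)ˣ) : FF f) * (u : FF f) = 1 := Units.inv_mul u
    linear_combination (-(a * b)) * hu1
  have hs0 : s ≠ 0 := by
    rw [hs]
    exact smul_ne_zero u.ne_zero (smul_ne_zero (inv_ne_zero (pow_ne_zero _ hz0))
      (D_param_ne_zero hx hz))
  constructor
  · have hG : IsGLInt x (((u⁻¹ : (FF f)ˣ) : FF f) • g₀) := by
      refine ⟨hg₀.int.smul hu', ?_, ?_⟩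
      · have : (((u⁻¹ : (FF f)ˣ) : FF f) • g₀)⁻¹ = (u : FF f) • g₀⁻¹ :=
          Matrix.inv_eq_left_inv (by
            rw [Matrix.smul_mul, Matrix.mul_smul, smul_smul, Units.mul_inv, one_smul,
              hg₀.inv_mul])
        rw [this]
        exact hg₀.inv_int.smul hu
      · rw [Matrix.det_smul]
        exact (u⁻¹.isUnit.pow _).mul hg₀.det
    obtain ⟨g, hg⟩ := hG.exists_GL
    refine ⟨g, fun i j => ?_⟩
    rw [hrel, hg, Matrix.smul_apply, smul_eq_mul, mul_comm]
  · intro g hg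
    have hgi : IsGLInt x ((g : Matrix (Fin r) (Fin r) (O f x)).map (O f x).subtype) :=
      isGLInt_of_isUnit g.isUnit
    -- As `s ≠ 0`, the relative connection determines `g`; hence `g₀ = u g`, and `trD_smul` isolates
    -- the dependence on `u`.
    have hgg : g₀ = (u : FF f) • (g : Matrix (Fin r) (Fin r) (O f x)).map (O f x).subtype := by
      ext i j
      have h1 := smul_left_injective (FF f) hs0 ((hrel i j).symm.trans (hg i j))
      change g₀ i j = (u : FF f) * (g i j : FF f)
      have h2 : g₀ i j * ((u⁻¹ : (FF f)ˣ) : FF f) = (g i j : FF f) := h1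
      rw [← h2, mul_left_comm, Units.mul_inv, mul_one]
    rw [trForm_map_eq]
    constructor
    · rw [hgg, trD_smul hgi] at hτ
      exact hτ
    · rw [trD, ← map_smul]
      exact ((RegM.dM hgi.int).rm hgi.inv_int).trW (hA.pow_smul_regM hz0 (by omega))

/-- The ratio of a generator of `ω(𝔇)` at `x` and the standard one. -/
theorem exists_param_ratio [SmoothOfRelativeDimension 1 f] (hx : IsRational f x) {z : O f x}
    (hz : IsLocalParam f x z) {s : Ω[FF f⁄K]} (hs : GeneratesOmegaD f 𝔇 x s) :
    ∃ u : (FF f)ˣ, s = (u : FF f) • ((z : FF f) ^ 𝔇 x)⁻¹ • D K (FF f) (z : FF f) ∧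
      (u : FF f) ∈ O f x ∧ ((u⁻¹ : (FF f)ˣ) : FF f) ∈ O f x := by
  obtain ⟨u, hu⟩ := exists_ratio f (generatesOmegaD_param (𝔇 := 𝔇) hx hz).ne_zero hs.ne_zero
  exact ⟨u, hu, ratio_mem (generatesOmegaD_param hx hz) hs hu⟩

/-- The class of `Tr(dg g⁻¹ A)` exists. -/
theorem exists_isLocalClass [IsLocallyNoetherian X] [SmoothOfRelativeDimension 1 f]
    (h𝔇 : ∀ x, 𝔇 x ≠ 0 → IsRational f x) {E : Bundle f r V} {nabla : Conn f k V}
    (hvert : nabla.IsVertical r) (hadm : IsPseudoAdmissible 𝔇 E nabla) {s : Ω[FF f⁄K]}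
    (hs : IsTrivializing 𝔇 s) {e : X → Module.Basis (Fin r) (FF f) V} (he : IsLocalBases 𝔇 E e) :
    ∃ c, IsLocalClass 𝔇 nabla s e c := by
  have hg : ∀ x, ∃ g : GL (Fin r) (O f x), 𝔇 x ≠ 0 →
      (∀ i j, relMap f k (nabla.matrix (e x) i j) = (g i j : FF f) • s) ∧
      ∃ z : O f x, IsLocalParam f x z ∧ (z : FF f) ^ 𝔇 x • trForm
        (Matrix.GeneralLinearGroup.map (O f x).subtype g) (nabla.matrix (e x)) ∈ regForms2 f k x := by
    intro x
    by_cases hm : 𝔇 x = 0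
    -- Off `𝔇` the matrix plays no role.
    · exact ⟨1, fun h => absurd hm h⟩
    · obtain ⟨z, hz, τ, h⟩ := exists_local_invariant hvert hadm (h𝔇 x hm) hm
      obtain ⟨u, hu, hum, hum'⟩ := exists_param_ratio (h𝔇 x hm) hz (hs x hm)
      obtain ⟨⟨g, hg⟩, h2⟩ := h (e x) (he x hm) s u hu hum hum'
      exact ⟨g, fun _ => ⟨hg, z, hz, (h2 g hg).2⟩⟩
  choose g hg using hg
  obtain ⟨c, hc⟩ := exists_isBoundary h𝔇 (fun x => trForm
    (Matrix.GeneralLinearGroup.map (O f x).subtype (g x)) (nabla.matrix (e x)))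
    fun x hm => (hg x hm).2
  exact ⟨c, g, fun x hm => (hg x hm).1, hc⟩

/-- The class of `Tr(dg g⁻¹ A)` does not depend on the local bases. -/
theorem IsLocalClass.unique [SmoothOfRelativeDimension 1 f]
    (h𝔇 : ∀ x, 𝔇 x ≠ 0 → IsRational f x) {E : Bundle f r V} {nabla : Conn f k V}
    (hvert : nabla.IsVertical r) (hadm : IsPseudoAdmissible 𝔇 E nabla) {s : Ω[FF f⁄K]}
    (hs : IsTrivializing 𝔇 s) {e e' : X → Module.Basis (Fin r) (FF f) V}
    (he : IsLocalBases 𝔇 E e) (he' : IsLocalBases 𝔇 E e') {c c' : AD2 f k}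
    (hc : IsLocalClass 𝔇 nabla s e c) (hc' : IsLocalClass 𝔇 nabla s e' c') : c = c' := by
  obtain ⟨g, hg, hc⟩ := hc
  obtain ⟨g', hg', hc'⟩ := hc'
  refine hc.unique hc' fun x hm => ?_
  obtain ⟨z, hz, τ, h⟩ := exists_local_invariant hvert hadm (h𝔇 x hm) hm
  obtain ⟨u, hu, hum, hum'⟩ := exists_param_ratio (h𝔇 x hm) hz (hs x hm)
  have h1 := ((h (e x) (he x hm) s u hu hum hum').2 (g x) (hg x hm)).1
  have h2 := ((h (e' x) (he' x hm) s u hu hum hum').2 (g' x) (hg' x hm)).1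
  -- The same `u` occurs for both bases, and the two traces differ by a regular form, so the
  -- correction terms agree modulo regular forms.
  have h3 := wedge_regForms f k (dlog_mem_regForms hum hum')
    ((he x hm).traceForm_sub_mem nabla (he' x hm))
  rw [map_sub] at h3
  convert! add_mem (sub_mem h1 h2) h3 using 1
  abel

/-- The product class exists. -/
theorem exists_isGlobalClass [IsLocallyNoetherian X] [SmoothOfRelativeDimension 1 f]
    (h𝔇 : ∀ x, 𝔇 x ≠ 0 → IsRational f x) {E : Bundle f r V} {nabla : Conn f k V}
    (hvert : nabla.IsVertical r) (hadm : IsPseudoAdmissible 𝔇 E nabla) {s : Ω[FF f⁄K]}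
    (hs : IsTrivializing 𝔇 s) : ∃ c, IsGlobalClass 𝔇 E nabla s c := by
  -- At a point of `𝔇` the section `s` itself is the generator; elsewhere any generator of `ω` on a
  -- neighbourhood that avoids `𝔇` will do.
  have ht : ∀ i, ∃ (U : X.Opens) (t : Ω[FF f⁄K]), i ∈ U ∧ ∀ y ∈ U, GeneratesOmegaD f 𝔇 y t ∧
      (𝔇 y ≠ 0 → t - s ∈ regForms f K y) := by
    intro i
    by_cases hi : 𝔇 i = 0
    · obtain ⟨U, t, hiU, ht⟩ := exists_nhd_generates f i
      have h0 : ∀ y ∈ awayFrom h𝔇 i, 𝔇 y = 0 := fun y hy => by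
        by_contra h
        exact h (eq_of_mem_awayFrom hy h ▸ hi)
      refine ⟨U ⊓ awayFrom h𝔇 i, t, ⟨hiU, mem_awayFrom_self h𝔇 i⟩, fun y hy => ⟨?_, fun h =>
        absurd (h0 y hy.2) h⟩⟩
      rw [generatesOmegaD_congr (𝔇' := 0) (by simpa using h0 y hy.2)]
      exact ht y hy.1
    · obtain ⟨z, hz, -⟩ := exists_local_structure hvert hadm (h𝔇 i hi) hi
      obtain ⟨U, hiU, hU⟩ := exists_nhd_generates_of_param h𝔇 hi hz (hs i hi)
      refine ⟨U, s, hiU, fun y hy => ⟨hU y hy, fun _ => ?_⟩⟩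
      rw [sub_self]
      exact zero_mem _
  choose U t hiU ht using ht
  choose W hiW e he using E.locally_free
  let 𝒰 : PtCover X := ⟨fun i => U i ⊓ W i, fun i => ⟨hiU i, hiW i⟩⟩
  have ht0 : ∀ i, t i ≠ 0 := fun i => (ht i i (hiU i)).1.ne_zero
  choose a ha using fun i j => exists_ratio f (ht0 i) (ht0 j)
  have ham : ∀ i j, ∀ x ∈ 𝒰.U₂ i j, (a i j : FF f) ∈ O f x ∧
      (((a i j)⁻¹ : (FF f)ˣ) : FF f) ∈ O f x := fun i j x hx =>
    ratio_mem (ht i x hx.1.1).1 (ht j x hx.2.1).1 (ha i j)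
  let L : RelPicCocycle f 𝔇 𝒰 :=
    { lam := fun i j => ⟨a i j, ham i j⟩
      one_mod := fun i j x hx => by
        by_cases hm : 𝔇 x = 0
        · rw [idealAt_eq_top hm]
          trivial
        · obtain ⟨z, hz, -⟩ := exists_local_structure hvert hadm (h𝔇 x hm) hm
          have h1 := sub_mem ((ht j x hx.2.1).2 hm) ((ht i x hx.1.1).2 hm)
          rw [sub_sub_sub_cancel_right] at h1
          exact ratio_sub_one_mem (h𝔇 x hm) hz (ht i x hx.1.1).1 h1 (ham i j x hx).1 (ha i j)
      cocycle := fun i j l => Units.ext (smul_left_injective (FF f) (ht0 i) (by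
        change (a i l : FF f) • t i = ((a i j * a j l : (FF f)ˣ) : FF f) • t i
        rw [← ha, Units.val_mul, mul_comm, mul_smul, ← ha, ← ha])) }
  let C : ConnCocycle f 𝔇 k 𝒰 :=
    { g := fun i j => ⟨detUnit (e i) (e j), fun x hx =>
        Bundle.IsBasisAt.detUnit_mem (E := E) (he i x hx.1.2) (he j x hx.2.2)⟩
      α := fun i => nabla.traceForm (e i)
      mem := fun i x hx => traceForm_inOmegaBrace hvert hadm (h𝔇 x) (he i x hx.2)
      cocycle := fun i j l => detUnit_mul (e i) (e j) (e l)
      dlog_g := fun i j => dlog_detUnit nabla (e i) (e j) }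
  exact ⟨_, 𝒰, L, C, ⟨t, fun i x hx => (ht i x hx.1).1, fun i x hx => (ht i x hx.1).2, ha⟩,
    ⟨e, fun i x hx => he i x hx.2, fun i j => rfl, fun i => rfl⟩, rfl⟩

/-- The difference of the two classes does not depend on any choice. -/
theorem neg_global_add_local_unique [SmoothOfRelativeDimension 1 f]
    (h𝔇 : ∀ x, 𝔇 x ≠ 0 → IsRational f x) {E : Bundle f r V} {nabla : Conn f k V}
    (hvert : nabla.IsVertical r) (hadm : IsPseudoAdmissible 𝔇 E nabla) {s s' : Ω[FF f⁄K]}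
    (hs : IsTrivializing 𝔇 s) (hs' : IsTrivializing 𝔇 s')
    {e e' : X → Module.Basis (Fin r) (FF f) V}
    (he : IsLocalBases 𝔇 E e) (he' : IsLocalBases 𝔇 E e') {a b a' b' : AD2 f k}
    (ha : IsGlobalClass 𝔇 E nabla s a) (hb : IsLocalClass 𝔇 nabla s e b)
    (ha' : IsGlobalClass 𝔇 E nabla s' a') (hb' : IsLocalClass 𝔇 nabla s' e' b') :
    -a + b = -a' + b' := by
  obtain ⟨𝒰, L, C, ⟨t, ht, hts, hlam⟩, ⟨ε, hε, hCg, hCα⟩, rfl⟩ := ha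
  obtain ⟨𝒰', L', C', ⟨t', ht', hts', hlam'⟩, ⟨ε', hε', hCg', hCα'⟩, rfl⟩ := ha'
  obtain ⟨g, hg, 𝒱, β, ζ, hβ, hβ0, hζ, hζβ, rfl⟩ := hb
  obtain ⟨g', hg', 𝒱', β', ζ', hβ', hβ0', hζ', hζβ', rfl⟩ := hb'
  let 𝒲 := (𝒰.inter 𝒰').inter (𝒱.inter 𝒱')
  have w1 : 𝒰 ≤ 𝒲 := (𝒰.le_inter_left 𝒰').trans (PtCover.le_inter_left _ _)
  have w2 : 𝒰' ≤ 𝒲 := (𝒰.le_inter_right 𝒰').trans (PtCover.le_inter_left _ _)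
  have w3 : 𝒱 ≤ 𝒲 := (𝒱.le_inter_left 𝒱').trans (PtCover.le_inter_right _ _)
  have w4 : 𝒱' ≤ 𝒲 := (𝒱.le_inter_right 𝒱').trans (PtCover.le_inter_right _ _)
  have ht0 : ∀ i, t i ≠ 0 := fun i => (ht i i (𝒰.mem i)).ne_zero
  have ht0' : ∀ i, t' i ≠ 0 := fun i => (ht' i i (𝒰'.mem i)).ne_zero
  choose μ hμ using fun i => exists_ratio f (ht0 i) (ht0' i)
  have hμm : ∀ i, ∀ x ∈ 𝒲.U i, (μ i : FF f) ∈ O f x ∧ (((μ i)⁻¹ : (FF f)ˣ) : FF f) ∈ O f x :=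
    fun i x hx => ratio_mem (ht i x (w1 i hx)) (ht' i x (w2 i hx)) (hμ i)
  have hCgU : ∀ i j, (C.g i j : (FF f)ˣ) = detUnit (ε i) (ε j) := fun i j => Units.ext (hCg i j)
  have hCgU' : ∀ i j, (C'.g i j : (FF f)ˣ) = detUnit (ε' i) (ε' j) :=
    fun i j => Units.ext (hCg' i j)
  rw [← mk_cup_res w1 L C, ← mk_cup_res w2 L' C', ← AD2.mk_res w3 ζ, ← AD2.mk_res w4 ζ']
  refine neg_mk_cup_add_eq (μ := fun i => ⟨μ i, hμm i⟩)
    (h := fun i => ⟨detUnit (ε i) (ε' i), fun x hx =>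
      Bundle.IsBasisAt.detUnit_mem (hε i x (w1 i hx)) (hε' i x (w2 i hx))⟩)
    (β := β) (β' := β') (fun i j => ?_) (fun i j => ?_) (fun i => ?_) ?_ ?_ hζβ hζβ' ?_
  · refine Units.ext (smul_left_injective (FF f) (ht0 i) ?_)
    change ((L'.lam i j * μ i : (FF f)ˣ) : FF f) • t i = ((L.lam i j * μ j : (FF f)ˣ) : FF f) • t i
    rw [Units.val_mul, mul_smul, ← hμ, ← hlam', Units.val_mul, mul_comm, mul_smul, ← hlam, ← hμ]
  · change (C'.g i j : (FF f)ˣ) * detUnit (ε i) (ε' i) = C.g i j * detUnit (ε j) (ε' j)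
    rw [hCgU, hCgU', mul_comm, ← detUnit_mul, ← detUnit_mul]
  · change C'.α i = C.α i + dlog k (FF f) (detUnit (ε i) (ε' i))
    rw [hCα, hCα', dlog_detUnit nabla, add_sub_cancel]
  · change (resCochain f k w3 ζ.1).1 = 0
    funext i j l
    change resK2 f _ (ζ.1.1 i j l) = 0
    rw [hζ]
    exact map_zero _
  · change (resCochain f k w4 ζ'.1).1 = 0
    funext i j l
    change resK2 f _ (ζ'.1.1 i j l) = 0
    rw [hζ']
    exact map_zero _
  · intro i x hx
    change wedgeRel k (FF f) K (dlog k (FF f) (μ i)) (C.α i) - (β i - β' i) ∈ regForms2 f k x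
    have hα := C.mem i x (w1 i hx)
    by_cases hm : 𝔇 x = 0
    · have hα' : C.α i ∈ regForms f k x := by
        rcases hα with h | h
        · exact h.2
        · exact absurd hm h.1
      exact sub_mem (wedge_regForms f k (dlog_mem_regForms (hμm i x hx).1 (hμm i x hx).2) hα')
        (sub_mem (hβ0 i x (w3 i hx) hm) (hβ0' i x (w4 i hx) hm))
    · have hx' := h𝔇 x hm
      obtain ⟨z, hz, τ, h⟩ := exists_local_invariant hvert hadm hx' hm
      obtain ⟨u, hu, hum, hum'⟩ := exists_param_ratio hx' hz (hs x hm)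
      obtain ⟨u', hu', hvm, hvm'⟩ := exists_param_ratio hx' hz (hs' x hm)
      -- Together `f1`, `f2`, `f3` say that `β_i` is `τ - dlog u ∧ α_i` modulo regular forms; the
      -- primed versions say the same of `β'_i` with `u'`. The invariant `τ` is common to both.
      have f1 := hβ i x (w3 i hx) hm
      have f1' := hβ' i x (w4 i hx) hm
      have f2 := ((h (e x) (he x hm) s u hu hum hum').2 (g x) (hg x hm)).1
      have f2' := ((h (e' x) (he' x hm) s' u' hu' hvm hvm').2 (g' x) (hg' x hm)).1
      have f3 := wedge_regForms f k (dlog_mem_regForms hum hum')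
        (Bundle.IsBasisAt.traceForm_sub_mem nabla (hε i x (w1 i hx)) (he x hm))
      have f3' := wedge_regForms f k (dlog_mem_regForms hvm hvm')
        (Bundle.IsBasisAt.traceForm_sub_mem nabla (hε i x (w1 i hx)) (he' x hm))
      rw [← hCα, map_sub] at f3 f3'
      obtain ⟨q, hq⟩ := exists_ratio f (hs x hm).ne_zero (ht0 i)
      obtain ⟨q', hq'⟩ := exists_ratio f (hs' x hm).ne_zero (ht0' i)
      have hqm := ratio_mem (hs x hm) (ht i x (w1 i hx)) hq
      have hqm' := ratio_mem (hs' x hm) (ht' i x (w2 i hx)) hq'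
      -- The ratios `q = t_i / s` and `q' = t'_i / s'` are congruent to `1` modulo `𝓘`, so their
      -- logarithmic derivatives contribute only regular forms.
      have f4 := dlog_wedge_mem_stalk h𝔇 hqm.1 hqm.2
        (ratio_sub_one_mem hx' hz (hs x hm) (hts i x (w1 i hx) hm) hqm.1 hq) hα
      have f4' := dlog_wedge_mem_stalk h𝔇 hqm'.1 hqm'.2
        (ratio_sub_one_mem hx' hz (hs' x hm) (hts' i x (w2 i hx) hm) hqm'.1 hq') hα
      -- Both sides express `t'_i` in terms of `dz / z ^ m`; hence `dlog μ_i` is `dlog u' - dlog u`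
      -- up to `dlog q' - dlog q`.
      have hprod : μ i * (q * u) = q' * u' := by
        refine Units.ext (smul_left_injective (FF f)
          (generatesOmegaD_param (𝔇 := 𝔇) hx' hz).ne_zero ?_)
        change ((μ i * (q * u) : (FF f)ˣ) : FF f) • _ = ((q' * u' : (FF f)ˣ) : FF f) • _
        rw [Units.val_mul, Units.val_mul, Units.val_mul, mul_smul, mul_smul, mul_smul, ← hu, ← hq,
          ← hμ, ← hu', ← hq']
      have hlog := congrArg (dlog k (FF f)) hprod
      rw [dlog_mul, dlog_mul, dlog_mul] at hlog
      rw [eq_sub_of_add_eq hlog]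
      simp only [map_add, map_sub, LinearMap.add_apply, LinearMap.sub_apply]
      have := add_mem (sub_mem (add_mem (sub_mem f1' f1) (sub_mem f2' f2)) (sub_mem f3' f3))
        (sub_mem f4' f4)
      convert! this using 1
      abel

end Classes

end RelAD

end

/-! ### The theorem -/

theorem proposition2p2 {k K : Type u} [Field k] [CharZero k] [Field K] [Algebra k K]
    {X : AlgebraicGeometry.Scheme.{u}} [AlgebraicGeometry.IsIntegral X]
    (f : X ⟶ AlgebraicGeometry.Spec (CommRingCat.of K))
    [AlgebraicGeometry.IsProper f] [AlgebraicGeometry.SmoothOfRelativeDimension 1 f]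
    (𝔇 : X →₀ ℕ) (h𝔇 : ∀ x, 𝔇 x ≠ 0 → RelAD.IsRational f x)
    {r : ℕ} {V : Type v} [AddCommGroup V] [Module (RelAD.FF f) V]
    (E : RelAD.Bundle f r V) (nabla : RelAD.Conn f k V)
    (hvert : nabla.IsVertical r) (hadm : RelAD.IsPseudoAdmissible 𝔇 E nabla) :
    (∀ s, RelAD.IsTrivializing 𝔇 s →
      ∃ τ : RelAD.AD2 f k, ∀ e, RelAD.IsLocalBases 𝔇 E e →
        ∀ c, RelAD.IsLocalClass 𝔇 nabla s e c ↔ c = τ) ∧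
    (∃ γ : RelAD.AD2 f k, ∀ s, RelAD.IsTrivializing 𝔇 s →
      ∀ e, RelAD.IsLocalBases 𝔇 E e →
        ∀ c, (∃ a b, RelAD.IsGlobalClass 𝔇 E nabla s a ∧ RelAD.IsLocalClass 𝔇 nabla s e b ∧
          c = -a + b) ↔ c = γ) := by
  have : IsLocallyNoetherian X := LocallyOfFiniteType.isLocallyNoetherian f
  choose W hW e₀ he₀ using E.locally_free
  have hb₀ : RelAD.IsLocalBases 𝔇 E e₀ := fun x _ => he₀ x x (hW x)
  constructor
  · intro s hs
    obtain ⟨τ, hτ⟩ := RelAD.exists_isLocalClass h𝔇 hvert hadm hs hb₀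
    -- The equivalence with `c = τ` combines existence of the class for every choice of bases with
    -- its uniqueness across all choices.
    refine ⟨τ, fun e he c => ⟨fun hc =>
      RelAD.IsLocalClass.unique h𝔇 hvert hadm hs he hb₀ hc hτ, ?_⟩⟩
    rintro rfl
    obtain ⟨c', hc'⟩ := RelAD.exists_isLocalClass h𝔇 hvert hadm hs he
    rwa [RelAD.IsLocalClass.unique h𝔇 hvert hadm hs hb₀ he hτ hc']
  · by_cases hex : ∃ s : Ω[RelAD.FF f⁄K], RelAD.IsTrivializing 𝔇 s
    · obtain ⟨s₀, hs₀⟩ := hex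
      obtain ⟨a₀, ha₀⟩ := RelAD.exists_isGlobalClass h𝔇 hvert hadm hs₀
      obtain ⟨b₀, hb⟩ := RelAD.exists_isLocalClass h𝔇 hvert hadm hs₀ hb₀
      refine ⟨-a₀ + b₀, fun s hs e he c => ⟨?_, ?_⟩⟩
      · rintro ⟨a, b, ha, hb', rfl⟩
        exact RelAD.neg_global_add_local_unique h𝔇 hvert hadm hs hs₀ he hb₀ ha hb' ha₀ hb
      · rintro rfl
        obtain ⟨a, ha⟩ := RelAD.exists_isGlobalClass h𝔇 hvert hadm hs
        obtain ⟨b, hb'⟩ := RelAD.exists_isLocalClass h𝔇 hvert hadm hs he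
        exact ⟨a, b, ha, hb',
          RelAD.neg_global_add_local_unique h𝔇 hvert hadm hs₀ hs hb₀ he ha₀ hb ha hb'⟩
    -- Without a trivializing section the claim is empty, so any value of `γ` serves.
    · exact ⟨0, fun s hs => absurd ⟨s, hs⟩ hex⟩
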